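/- Consider axisymmetric solutions without swirl of the incompressible Euler equations in $\mathbb R^3$, in cylindrical coordinates $(r,\theta,z)$, with velocity $u=u_r(r,z,t)e_r+u_z(r,z,t)e_z$ and scalar vorticity $\omega=-\partial_z u_r+\partial_r u_z$. At each time $u$ is recovered from $\omega$ by the Biot–Savart law, and $\omega/r$ is transported by the volume-preserving flow of $u$, i.e. $(\partial_t+u_r\partial_r+u_z\partial_z)(\omega/r)=0$. Let $\omega(\cdot,t)$, $t\ge 0$, be such a global-in-time solution with $u\in L^2(\mathbb R^3)$ and $\omega,\ \omega/r\in L^1(\mathbb R^3)\cap L^\infty(\mathbb R^3)$ at every time. Let $\omega_0=\omega(\cdot,0)$, and assume that $\omega_0(r,-z)=-\omega_0(r,z)$ and $\omega_0(r,z)\ge 0$ for $z\ge 0$. Put $\Pi=\{r>0\}$ and $\Pi^+=\{(r,z): r>0,\ z>0\}$, $$Z(t)=\iint_{\Pi^+} z\,\omega(r,z,t)\,dr\,dz,\quad m_0=\iint_{\Pi^+}\omega_0\,dr\,dz,\quad A_0=\Big\|\frac{\omega_0}{r}\Big\|_{L^\infty},\quad E_0=\iint_{\Pi} r\,(u_r^2+u_z^2)\big|_{t=0}\,dr\,dz,$$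 and assume $Z(0)<\infty$. Then there are constants $R_0=R_0(m_0,A_0,E_0)\ge 1$ and $c_0=c_0(m_0,A_0,E_0,Z(0))>0$, depending only on the indicated quantities, such that for every $0<m\le m_0$, every $t\ge 0$ and every $R\ge R_0$ the following holds: if $$\iint_{\Pi^+\cap\{r\le R\}}\omega(r,z,t)\,dr\,dz\ \ge\ m,$$ then $Z(t)$ and the two integrals below are finite, $Z$ is differentiable at $t$ (from the right if $t=0$), and $$-Z'(t)=\int_0^\infty \frac{u_z(0,z,t)^2}{2}\,dz+\iint_{\Pi^+}\frac{u_r(r,z,t)^2}{r}\,dr\,dz\ \ge\ \frac{c_0\,m^4}{R^4}.$$ -/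

import Mathlib

open MeasureTheory Set

noncomputable section

namespace AxiEuler

/-- The meridional half plane; a point `p` has cylindrical coordinates `p.1 = r > 0`, `p.2 = z`.
The axis `r = 0` is a null set and is left out. -/
def halfPlane : Set (ℝ × ℝ) := {p | 0 < p.1}

/-- The upper quadrant `r > 0`, `z > 0`. -/
def quadrant : Set (ℝ × ℝ) := {p | 0 < p.1 ∧ 0 < p.2}

/-- The measure `r dr dz` on the half plane. Up to the factor `2π` it is the image of Lebesgue
measure on three-space, so an axisymmetric function is in `L^p` of three-space iff its profile is
in `L^p` of this measure, with the same essential supremum. -/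
def axiMeasure : Measure (ℝ × ℝ) :=
  (volume.restrict halfPlane).withDensity fun p => ENNReal.ofReal p.1

/-- Squared distance in three-space between the point with cylindrical coordinates `(p.1, 0, p.2)`
and the point with cylindrical coordinates `(q.1, θ, q.2)`. -/
def distSq (p q : ℝ × ℝ) (θ : ℝ) : ℝ :=
  p.1 ^ 2 + q.1 ^ 2 - 2 * p.1 * q.1 * Real.cos θ + (p.2 - q.2) ^ 2

/-- Radial component of the Biot-Savart velocity of an axisymmetric vorticity profile `w`, with the
sign convention `w = -∂_z u_r + ∂_r u_z`. In three-space the law is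
`u(x) = (1/4π) ∫ (x - y) × (w e_θ)(y) / |x - y|^3 dy`; with `x = (p.1, 0, p.2)`,
`y = (q.1 cos θ, q.1 sin θ, q.2)`, `e_θ = (-sin θ, cos θ, 0)` and `dy = q.1 dθ dq`
the first component of `(x - y) × e_θ` is `-(p.2 - q.2) cos θ`.
It is defined for `p.1 ≥ 0`, the axis included. -/
def velR (w : ℝ × ℝ → ℝ) (p : ℝ × ℝ) : ℝ :=
  (1 / (4 * Real.pi)) * ∫ q in halfPlane,
    (∫ θ in (0 : ℝ)..(2 * Real.pi), -((p.2 - q.2) * Real.cos θ) / √(distSq p q θ) ^ 3)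
      * q.1 * w q

/-- Vertical component of the Biot-Savart velocity, in the same convention: the third component of
`(x - y) × e_θ` is `p.1 cos θ - q.1`. -/
def velZ (w : ℝ × ℝ → ℝ) (p : ℝ × ℝ) : ℝ :=
  (1 / (4 * Real.pi)) * ∫ q in halfPlane,
    (∫ θ in (0 : ℝ)..(2 * Real.pi), (p.1 * Real.cos θ - q.1) / √(distSq p q θ) ^ 3)
      * q.1 * w q

/-- The class `u ∈ L²`, `w ∈ L¹ ∩ L^∞`, `w / r ∈ L¹ ∩ L^∞` (all over three-space), `u` being the
Biot-Savart velocity of `w`. -/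
structure InClass (w : ℝ × ℝ → ℝ) : Prop where
  memLp_velR : MemLp (velR w) 2 axiMeasure
  memLp_velZ : MemLp (velZ w) 2 axiMeasure
  memLp_one : MemLp w 1 axiMeasure
  memLp_top : MemLp w ⊤ axiMeasure
  memLp_div_one : MemLp (fun p => w p / p.1) 1 axiMeasure
  memLp_div_top : MemLp (fun p => w p / p.1) ⊤ axiMeasure

/-- `Φ` is the volume preserving particle trajectory map on `[0, ∞)` of the (divergence free)
axisymmetric velocity field with components `uR`, `uZ`. -/
structure IsFlow (uR uZ : ℝ → ℝ × ℝ → ℝ) (Φ : ℝ → ℝ × ℝ → ℝ × ℝ) : Prop where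
  initial : ∀ p ∈ halfPlane, Φ 0 p = p
  maps_to : ∀ t, 0 ≤ t → ∀ p ∈ halfPlane, Φ t p ∈ halfPlane
  ode : ∀ t, 0 ≤ t → ∀ p ∈ halfPlane,
    HasDerivWithinAt (fun s => Φ s p) (uR t (Φ t p), uZ t (Φ t p)) (Ici 0) t
  volume_preserving : ∀ t, 0 ≤ t → MeasurePreserving (Φ t) axiMeasure axiMeasure

/-- `w t` (`t ≥ 0`) is a global solution of the axisymmetric Euler equations without swirl in the
above class, with initial vorticity `w 0`: the relative vorticity `w / r` is transported by the flow
of the velocity that `w` generates through the Biot-Savart law, that is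
`(∂_t + u_r ∂_r + u_z ∂_z) (w / r) = 0`. -/
structure IsSolution (w : ℝ → ℝ × ℝ → ℝ) : Prop where
  inClass : ∀ t, 0 ≤ t → InClass (w t)
  transported : ∃ Φ : ℝ → ℝ × ℝ → ℝ × ℝ,
    IsFlow (fun t => velR (w t)) (fun t => velZ (w t)) Φ ∧
    ∀ t, 0 ≤ t → ∀ᵐ p ∂axiMeasure, w t (Φ t p) / (Φ t p).1 = w 0 p / p.1

/-- Odd in `z`, and non-negative for `z ≥ 0` (almost everywhere). -/
structure IsOddNonneg (w : ℝ × ℝ → ℝ) : Prop where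
  odd : ∀ᵐ p ∂axiMeasure, w (p.1, -p.2) = -w p
  nonneg : ∀ᵐ p ∂axiMeasure, 0 ≤ p.2 → 0 ≤ w p

/-- The vertical moment over the upper quadrant. -/
def vertMoment (w : ℝ × ℝ → ℝ) : ℝ := ∫ p in quadrant, p.2 * w p

/-- The total vorticity mass in the upper quadrant. -/
def totalMass (w : ℝ × ℝ → ℝ) : ℝ := ∫ p in quadrant, w p

/-- The vorticity mass in the part `r ≤ R` of the upper quadrant. -/
def massIn (w : ℝ × ℝ → ℝ) (R : ℝ) : ℝ := ∫ p in quadrant ∩ {p | p.1 ≤ R}, w p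

/-- The `L^∞` norm of `w / r`. -/
def relSup (w : ℝ × ℝ → ℝ) : ℝ := (eLpNorm (fun p => w p / p.1) ⊤ axiMeasure).toReal

/-- The normalized kinetic energy, the integral of `r (u_r² + u_z²)` over the half plane. -/
def energy (w : ℝ × ℝ → ℝ) : ℝ := ∫ p, (velR w p ^ 2 + velZ w p ^ 2) ∂axiMeasure

end AxiEuler

end

/-!
The vertical moment `Z` decreases because, for odd vorticity, `Z' = ∫ u_z ω` over the quadrant is
minus the dissipation `D = ½ ∫ u_z(0, z)² dz + ∬ u_r² / r`; and `D` cannot be small while a definite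
amount of mass stays within a bounded distance of the axis, because that mass is a weighted average
of `u_r` and of `u_z` on the axis.

*The flow.* The Biot-Savart velocity is written as one integral over three-space (`vel`), so that
its estimates reduce to radial integrals: it is bounded and log-Lipschitz (`abs_vel_sub_le`), and
`|u_r| ≤ C r` (`abs_vel_numR_le'`), which keeps `ω` bounded on compact time intervals. An Osgood
argument in Lagrangian variables shows that the initial vorticity determines the flow
(`IsTransported.flow_unique`). Hence the flow commutes with the reflection in `z = 0`; oddness and
sign of the vorticity persist (`IsTransported.isOddNonneg`), and the quadrant is preserved. Pulled
back to time zero, `Z` is differentiated under the integral sign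
(`IsTransported.hasDerivWithinAt_vertMoment`).

*The dissipation identity.* At a fixed time, `∫ u_z ω = -D` is the divergence theorem for the field
`(½ (u_z² - u_r²), -u_r u_z)`, whose divergence is `u_z ω + u_r² / r`. Since `ω` is only bounded,
the kernels are regularised by `|x - y|² ↦ |x - y|² + ε²`. The regularised velocity is smooth enough
to differentiate, exactly divergence free (`div_free`), and its curl is a mollified vorticity
(`curl_eq`) that converges weakly to `ω` (`tendsto_integral_vortReg`). With a cutoff at scale `B`
this gives `quadratic_identity`; finiteness of `D` follows from the finite energy once the cross
term with the derivative of the cutoff is absorbed (`exists_bound_cutoff`), and `B → ∞` gives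
`dissipation_identity`.

*The lower bound.* The divergence theorem for fields that are linear in the velocity
(`linear_identity`) expresses a weighted integral of `ω` through `u_r` in the quadrant and `u_z` on
the axis only. With weights adapted to the region `r ≤ S`, `δ ≤ z ≤ S` and Young's inequality, a mass
`c` in that region forces `D ≥ c² δ / (43008 S²)` (`dissipation_ge`). Given a mass `m` in `r ≤ R`,
either half of it lies above height `R`, and since at most a quarter of `m` lies above
`S = R + 4 Z / m` one takes `δ = R`; or else the bound `|ω| ≤ A r` leaves a quarter of `m` in
`δ ≤ z ≤ R` with `δ = m / (4 (1 + A) R²)`, and one takes `S = R`. As `Z` does not exceed its initial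
value, both cases give a bound of order `m⁴ / R⁴` (`dissipation_lower_bound`), for all `R ≥ 1`.
-/

open Filter

noncomputable section

namespace AxiEuler

open scoped ENNReal Topology

/-! ### Cylindrical coordinates and three-space -/

/-- The measure `r dr dz dθ` on pairs of a meridional point and an angle. Unlike `axiMeasure` it is
genuinely Lebesgue measure of three-space, written in cylindrical coordinates
(`measurePreserving_cyl`), so radial integrals can be computed in it. -/
def angMeasure : Measure ((ℝ × ℝ) × ℝ) :=
  axiMeasure.prod (volume.restrict (Ioc 0 (2 * Real.pi)))

/-- The point of three-space with cylindrical coordinates `(q.1, θ, q.2)`. The height is the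
coordinate `0`, so that the planar polar coordinates are the last two. -/
def cyl (q : ℝ × ℝ) (θ : ℝ) : EuclideanSpace ℝ (Fin 3) :=
  !₂[q.2, q.1 * Real.cos θ, q.1 * Real.sin θ]

instance : SFinite axiMeasure := by unfold axiMeasure; infer_instance
instance : SFinite angMeasure := by unfold angMeasure; infer_instance

lemma measurableSet_halfPlane : MeasurableSet halfPlane :=
  measurableSet_lt measurable_const measurable_fst

lemma measurableSet_quadrant : MeasurableSet quadrant :=
  (measurableSet_lt measurable_const measurable_fst).inter
    (measurableSet_lt measurable_const measurable_snd)

lemma distSq_eq_norm (p q : ℝ × ℝ) (θ : ℝ) : distSq p q θ = ‖cyl p 0 - cyl q θ‖ ^ 2 := by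
  simp only [distSq, cyl, EuclideanSpace.norm_sq_eq, Fin.sum_univ_three, PiLp.sub_apply,
    Real.cos_zero, Real.sin_zero]
  simp only [mul_one, mul_zero, Real.norm_eq_abs, sq_abs, Matrix.cons_val_zero, Matrix.cons_val_one,
    Matrix.cons_val]
  linear_combination (-q.1 ^ 2) * Real.sin_sq_add_cos_sq θ

lemma lintegral_axi {f : ℝ × ℝ → ℝ≥0∞} (hf : Measurable f) :
    ∫⁻ q, f q ∂axiMeasure = ∫⁻ q in halfPlane, ENNReal.ofReal q.1 * f q := by
  unfold axiMeasure
  rw [lintegral_withDensity_eq_lintegral_mul _ (by fun_prop) hf]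
  rfl

lemma integral_axi (f : ℝ × ℝ → ℝ) :
    ∫ q, f q ∂axiMeasure = ∫ q in halfPlane, q.1 * f q := by
  unfold axiMeasure
  rw [integral_withDensity_eq_integral_toReal_smul (by fun_prop) (by simp)]
  refine setIntegral_congr_fun measurableSet_halfPlane fun q hq => ?_
  have : 0 < q.1 := hq
  simp [ENNReal.toReal_ofReal this.le]

lemma integrable_axi (f : ℝ × ℝ → ℝ) :
    Integrable f axiMeasure ↔ IntegrableOn (fun q => q.1 * f q) halfPlane := by
  unfold axiMeasure
  rw [integrable_withDensity_iff_integrable_smul' (by fun_prop) (by simp)]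
  refine integrableOn_congr_fun (fun q hq => ?_) measurableSet_halfPlane
  have : 0 < q.1 := hq
  simp [ENNReal.toReal_ofReal this.le]

lemma ae_axi_iff {s : ℝ × ℝ → Prop} :
    (∀ᵐ q ∂axiMeasure, s q) ↔ ∀ᵐ q ∂(volume.restrict halfPlane), s q := by
  unfold axiMeasure
  rw [ae_withDensity_iff (by fun_prop)]
  constructor
  · intro h
    filter_upwards [h, ae_restrict_mem measurableSet_halfPlane] with q hq hq'
    apply hq
    have : 0 < q.1 := hq'
    simpa using this
  · intro h
    filter_upwards [h] with q hq _ using hq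

lemma measurable_cyl : Measurable (fun x : (ℝ × ℝ) × ℝ => cyl x.1 x.2) := by
  unfold cyl
  have : Continuous (fun x : (ℝ × ℝ) × ℝ =>
      (!₂[x.1.2, x.1.1 * Real.cos x.2, x.1.1 * Real.sin x.2] : EuclideanSpace ℝ (Fin 3))) := by
    apply (PiLp.continuous_toLp 2 _).comp
    apply continuous_pi
    intro i
    fin_cases i <;> simp <;> fun_prop
  exact this.measurable

lemma lintegral_E3 {F : EuclideanSpace ℝ (Fin 3) → ℝ≥0∞} (hF : Measurable F) :
    ∫⁻ y, F y = ∫⁻ z : ℝ, ∫⁻ v : ℝ × ℝ, F !₂[z, v.1, v.2] := by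
  rw [← (PiLp.volume_preserving_toLp (Fin 3)).lintegral_comp hF,
    ← ((volume_preserving_piFinSuccAbove (fun _ : Fin 3 => ℝ) 0).symm _).lintegral_comp
      (f := fun a => F (WithLp.toLp 2 a))
      (hF.comp (PiLp.volume_preserving_toLp (Fin 3)).measurable)]
  have h2 : ∀ z : ℝ, ∫⁻ v : ℝ × ℝ, F !₂[z, v.1, v.2] = ∫⁻ v : Fin 2 → ℝ, F !₂[z, v 0, v 1] := by
    intro z
    rw [← (volume_preserving_finTwoArrow ℝ).lintegral_comp_emb
      (MeasurableEquiv.measurableEmbedding _)]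
    rfl
  simp_rw [h2]
  erw [lintegral_prod]
  · refine lintegral_congr fun z => lintegral_congr fun v => ?_
    congr 2
    ext i
    fin_cases i <;> rfl
  · apply Measurable.aemeasurable
    exact (hF.comp (PiLp.volume_preserving_toLp (Fin 3)).measurable).comp
      (MeasurableEquiv.measurable _)

/-- Integration in polar coordinates, with the angle in `(0, 2π]` instead of Mathlib's `(-π, π)`. -/
lemma lintegral_polar {f : ℝ × ℝ → ℝ≥0∞} (hf : Measurable f) :
    ∫⁻ v, f v = ∫⁻ r in Ioi (0:ℝ), ∫⁻ θ in Ioc 0 (2 * Real.pi),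
      ENNReal.ofReal r * f (r * Real.cos θ, r * Real.sin θ) := by
  have hm : Measurable fun x : ℝ × ℝ => ENNReal.ofReal x.1 * f
      (-(x.1 * Real.cos x.2), -(x.1 * Real.sin x.2)) := by
    fun_prop
  have h1 : ∫⁻ v, f v = ∫⁻ v, f (-v) := by
    rw [(Measure.measurePreserving_neg (volume : Measure (ℝ × ℝ))).lintegral_comp hf]
  rw [h1, ← lintegral_comp_polarCoord_symm, polarCoord_target]
  have h3 : (volume : Measure (ℝ × ℝ)).restrict (Ioi (0:ℝ) ×ˢ Ioo (-Real.pi) Real.pi)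
      = (volume.restrict (Ioi 0)).prod (volume.restrict (Ioo (-Real.pi) Real.pi)) := by
    rw [Measure.prod_restrict]; rfl
  rw [h3]
  simp only [polarCoord_symm_apply, smul_eq_mul, Prod.neg_mk]
  rw [lintegral_prod _ hm.aemeasurable]
  refine lintegral_congr fun r => ?_
  rw [setLIntegral_congr (Ioo_ae_eq_Ioc (α := ℝ)), ← lintegral_indicator measurableSet_Ioc,
    ← lintegral_indicator measurableSet_Ioc, ← lintegral_sub_right_eq_self _ Real.pi]
  refine lintegral_congr fun θ => ?_
  simp only [indicator, mem_Ioc]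
  have : (-Real.pi < θ - Real.pi ∧ θ - Real.pi ≤ Real.pi) ↔ (0 < θ ∧ θ ≤ 2 * Real.pi) := by
    constructor <;> rintro ⟨h, h'⟩ <;> constructor <;> linarith
  simp only [this, Real.cos_sub_pi, Real.sin_sub_pi, mul_neg, neg_neg]

lemma measurePreserving_cyl : MeasurePreserving (fun x : (ℝ × ℝ) × ℝ =>
    cyl x.1 x.2) angMeasure volume := by
  refine ⟨measurable_cyl, ?_⟩
  refine Measure.ext_of_lintegral _ fun F hF => ?_
  have hm : Measurable fun x : (ℝ × ℝ) × ℝ => F (cyl x.1 x.2) := hF.comp measurable_cyl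
  rw [lintegral_map hF measurable_cyl, lintegral_E3 hF, angMeasure,
    lintegral_prod _ hm.aemeasurable]
  have hm' : Measurable fun q : ℝ × ℝ => ∫⁻ θ in Ioc 0 (2 * Real.pi), F (cyl q θ) :=
    hm.lintegral_prod_right'
  rw [lintegral_axi hm']
  have h3 : (volume : Measure (ℝ × ℝ)).restrict halfPlane
      = (volume.restrict (Ioi 0)).prod volume := by
    have : halfPlane = Ioi (0:ℝ) ×ˢ (univ : Set ℝ) := by ext; simp [halfPlane]
    rw [this, Measure.volume_eq_prod, ← Measure.prod_restrict, Measure.restrict_univ]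
  rw [h3, lintegral_prod_symm _ (by fun_prop)]
  refine lintegral_congr fun z => ?_
  have hz : Measurable fun v : ℝ × ℝ => F !₂[z, v.1, v.2] := by
    apply hF.comp
    apply Continuous.measurable
    apply (PiLp.continuous_toLp 2 _).comp
    apply continuous_pi
    intro i
    fin_cases i <;> simp <;> fun_prop
  rw [lintegral_polar hz]
  refine lintegral_congr fun r => ?_
  rw [lintegral_const_mul]
  · rfl
  · exact hm.comp ((measurable_const (a := (r, z))).prodMk measurable_id)

lemma integrable_radial {g : ℝ → ℝ} (hg : Measurable g) (p : ℝ × ℝ) :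
    Integrable (fun x : (ℝ × ℝ) × ℝ => g (distSq p x.1 x.2)) angMeasure ↔
      IntegrableOn (fun ρ : ℝ => ρ ^ 2 * g (ρ ^ 2)) (Ioi 0) := by
  have h := integrable_fun_norm_addHaar (volume : Measure (EuclideanSpace ℝ (Fin 3)))
      (f := fun ρ => g (ρ ^ 2))
  simp only [finrank_euclideanSpace, Fintype.card_fin, smul_eq_mul] at h
  have e : (3:ℕ) - 1 = 2 := rfl
  rw [e] at h
  rw [← h]
  have h2 := ((measurePreserving_sub_right (volume : Measure (EuclideanSpace ℝ (Fin 3)))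
      (cyl p 0)).comp measurePreserving_cyl).integrable_comp (g := fun y => g (‖y‖ ^ 2))
      (Measurable.aestronglyMeasurable (by fun_prop))
  rw [← h2]
  simp only [distSq_eq_norm, Function.comp_def, norm_sub_rev]

/-- The integral of a function of the three-space distance to `p` does not depend on `p`. -/
lemma integral_radial {g : ℝ → ℝ} (hg : Measurable g) (p : ℝ × ℝ) :
    ∫ x, g (distSq p x.1 x.2) ∂angMeasure = 4 * Real.pi * ∫ ρ in Ioi (0:ℝ), ρ ^ 2 * g (ρ ^ 2) := by
  have h := integral_fun_norm_addHaar (volume : Measure (EuclideanSpace ℝ (Fin 3)))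
      (fun ρ => g (ρ ^ 2))
  simp only [finrank_euclideanSpace, Fintype.card_fin, smul_eq_mul] at h
  have e : (3:ℕ) - 1 = 2 := rfl
  rw [e, Measure.real, EuclideanSpace.volume_ball_fin_three, nsmul_eq_mul] at h
  have h4 : (ENNReal.ofReal 1 ^ 3 * ENNReal.ofReal (Real.pi * 4 / 3)).toReal = Real.pi * 4 / 3 := by
    simp; positivity
  rw [h4] at h
  have h2 := ((measurePreserving_sub_right (volume : Measure (EuclideanSpace ℝ (Fin 3)))
      (cyl p 0)).comp measurePreserving_cyl)
  have h3 := integral_map (μ := angMeasure) h2.measurable.aemeasurable (f := fun y => g (‖y‖ ^ 2))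
      (by
    apply Measurable.aestronglyMeasurable; fun_prop)
  rw [h2.map_eq, h] at h3
  simp only [distSq_eq_norm, norm_sub_rev (cyl p 0)]
  rw [Function.comp_def] at h3
  rw [← h3]
  push_cast; ring

lemma distSq_nonneg (p q : ℝ × ℝ) (θ : ℝ) : 0 ≤ distSq p q θ := by
  rw [distSq_eq_norm]; positivity

lemma distSq_comm (p q : ℝ × ℝ) (θ : ℝ) : distSq p q θ = distSq q p θ := by
  unfold distSq; ring

lemma continuous_distSq : Continuous fun x : (ℝ × ℝ) × (ℝ × ℝ) × ℝ => distSq x.1 x.2.1 x.2.2 := by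
  unfold distSq; fun_prop

@[fun_prop]
lemma continuous_distSq' {α : Type*} [TopologicalSpace α] {f g : α → ℝ × ℝ} {h : α → ℝ}
    (hf : Continuous f) (hg : Continuous g) (hh : Continuous h) :
    Continuous fun x => distSq (f x) (g x) (h x) :=
  continuous_distSq.comp (hf.prodMk (hg.prodMk hh))

@[fun_prop]
lemma measurable_distSq' {α : Type*} [MeasurableSpace α] {f g : α → ℝ × ℝ} {h : α → ℝ}
    (hf : Measurable f) (hg : Measurable g) (hh : Measurable h) :
    Measurable fun x => distSq (f x) (g x) (h x) :=
  continuous_distSq.measurable.comp (hf.prodMk (hg.prodMk hh))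

/-! ### Radial integrals -/

lemma integrable_radial_one (p : ℝ × ℝ) :
    Integrable (fun x : (ℝ × ℝ) × ℝ => 1 / (distSq p x.1 x.2 * (1 + distSq p x.1 x.2)))
      angMeasure := by
  rw [integrable_radial (g := fun s => 1 / (s * (1 + s))) (by fun_prop)]
  refine (integrable_inv_one_add_sq.integrableOn).congr_fun (fun ρ hρ => ?_) measurableSet_Ioi
  have : (0:ℝ) < ρ := hρ
  field_simp

lemma integral_radial_one (p : ℝ × ℝ) :
    ∫ x, 1 / (distSq p x.1 x.2 * (1 + distSq p x.1 x.2)) ∂angMeasure = 2 * Real.pi ^ 2 := by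
  rw [integral_radial (g := fun s => 1 / (s * (1 + s))) (by fun_prop)]
  have : ∫ ρ in Ioi (0:ℝ), ρ ^ 2 * (1 / (ρ ^ 2 * (1 + ρ ^ 2))) = ∫ ρ in Ioi (0:ℝ),
      (1 + ρ ^ 2)⁻¹ := by
    refine setIntegral_congr_fun measurableSet_Ioi (fun ρ hρ => ?_)
    have : (0:ℝ) < ρ := hρ
    field_simp
  rw [this, integral_Ioi_inv_one_add_sq]
  simp; ring

lemma radial_two_eq {η : ℝ} (hη : 0 < η) : ∀ ρ ∈ Ioi (0:ℝ),
    (1 + (η⁻¹ * ρ) ^ 2)⁻¹ = ρ ^ 2 * (η ^ 2 / (ρ ^ 2 * (ρ ^ 2 + η ^ 2))) := by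
  intro ρ hρ
  have : (0:ℝ) < ρ := hρ
  field_simp
  ring

lemma integrable_radial_two (p : ℝ × ℝ) {η : ℝ} (hη : 0 < η) :
    Integrable (fun x : (ℝ × ℝ) × ℝ => η ^ 2 / (distSq p x.1 x.2 * (distSq p x.1 x.2 + η ^ 2)))
      angMeasure := by
  rw [integrable_radial (g := fun s => η ^ 2 / (s * (s + η ^ 2))) (by fun_prop)]
  refine IntegrableOn.congr_fun ?_ (radial_two_eq hη) measurableSet_Ioi
  exact (integrable_inv_one_add_sq.comp_mul_left' (inv_ne_zero hη.ne')).integrableOn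

lemma integral_radial_two (p : ℝ × ℝ) {η : ℝ} (hη : 0 < η) :
    ∫ x, η ^ 2 / (distSq p x.1 x.2 * (distSq p x.1 x.2 + η ^ 2)) ∂angMeasure =
      2 * Real.pi ^ 2 * η := by
  rw [integral_radial (g := fun s => η ^ 2 / (s * (s + η ^ 2))) (by fun_prop),
    ← setIntegral_congr_fun measurableSet_Ioi (radial_two_eq hη)]
  have := integral_comp_mul_left_Ioi (fun x : ℝ => (1 + x ^ 2)⁻¹) 0 (inv_pos.2 hη)
  rw [this]
  simp
  ring

lemma radial_log_le {η : ℝ} (hη : 0 < η) : ∀ ρ ∈ Ioi (0:ℝ),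
    ρ ^ 2 * (1 / (√(ρ ^ 2 + η ^ 2) ^ 3 * (1 + ρ ^ 2))) ≤
      (Ioc (0:ℝ) 1).indicator (fun ρ => 2 * (ρ + η)⁻¹) ρ + (1 + ρ ^ 2)⁻¹ := by
  intro ρ hρ
  have h0 : (0:ℝ) < ρ := hρ
  set n := √(ρ ^ 2 + η ^ 2) with hn
  have hn2 : n ^ 2 = ρ ^ 2 + η ^ 2 := Real.sq_sqrt (by positivity)
  have hnp : 0 < n := Real.sqrt_pos.2 (by positivity)
  have h1 : ρ ^ 2 * (1 / (n ^ 3 * (1 + ρ ^ 2))) ≤ n⁻¹ * (1 + ρ ^ 2)⁻¹ := by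
    have : ρ ^ 2 ≤ n ^ 2 := by nlinarith
    calc ρ ^ 2 * (1 / (n ^ 3 * (1 + ρ ^ 2))) ≤ n ^ 2 * (1 / (n ^ 3 * (1 + ρ ^ 2))) := by gcongr
      _ = _ := by field_simp
  have h3 : (1 + ρ ^ 2)⁻¹ ≤ 1 := inv_le_one_of_one_le₀ (by nlinarith)
  by_cases h : ρ ≤ 1
  · rw [indicator_of_mem (by exact ⟨h0, h⟩)]
    have h2 : n⁻¹ ≤ 2 * (ρ + η)⁻¹ := by
      rw [← div_eq_mul_inv, inv_eq_one_div, div_le_div_iff₀ hnp (by positivity)]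
      nlinarith [sq_nonneg (ρ - η)]
    have : 0 ≤ (1 + ρ ^ 2)⁻¹ := by positivity
    have : n⁻¹ * (1 + ρ ^ 2)⁻¹ ≤ 2 * (ρ + η)⁻¹ * 1 := by gcongr
    linarith
  · rw [indicator_of_notMem (by rintro ⟨_, h'⟩; exact h h')]
    have h2 : n⁻¹ ≤ 1 := inv_le_one_of_one_le₀ (by nlinarith)
    have : n⁻¹ * (1 + ρ ^ 2)⁻¹ ≤ 1 * (1 + ρ ^ 2)⁻¹ := by gcongr
    linarith

lemma integrableOn_log_bound {η : ℝ} (hη : 0 < η) :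
    IntegrableOn (fun ρ : ℝ => (Ioc (0:ℝ) 1).indicator (fun ρ => 2 * (ρ + η)⁻¹) ρ) (Ioi 0) := by
  apply Integrable.integrableOn
  rw [integrable_indicator_iff measurableSet_Ioc]
  apply (ContinuousOn.integrableOn_Icc _).mono_set Ioc_subset_Icc_self
  refine continuousOn_const.mul (ContinuousOn.inv₀ (by fun_prop) fun x hx => ?_)
  have := hx.1; positivity

lemma integrable_radial_log (p : ℝ × ℝ) {η : ℝ} (hη : 0 < η) :
    Integrable (fun x : (ℝ × ℝ) × ℝ =>
      1 / (√(distSq p x.1 x.2 + η ^ 2) ^ 3 * (1 + distSq p x.1 x.2))) angMeasure := by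
  rw [integrable_radial (g := fun s => 1 / (√(s + η ^ 2) ^ 3 * (1 + s))) (by fun_prop)]
  refine ((integrableOn_log_bound hη).add integrable_inv_one_add_sq.integrableOn).mono'
    (Measurable.aestronglyMeasurable (by fun_prop)) ?_
  filter_upwards [ae_restrict_mem measurableSet_Ioi] with ρ hρ
  rw [Real.norm_of_nonneg (by positivity)]
  exact radial_log_le hη ρ hρ

/-- The integral of the kernel of degree `-3` cut off at scale `η` diverges only logarithmically.
This is the origin of the log-Lipschitz bound for the velocity. -/
lemma integral_radial_log_le (p : ℝ × ℝ) {η : ℝ} (hη : 0 < η) (h1 : η < 1) :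
    ∫ x, 1 / (√(distSq p x.1 x.2 + η ^ 2) ^ 3 * (1 + distSq p x.1 x.2)) ∂angMeasure
      ≤ 16 * Real.pi * (1 - Real.log η) := by
  have hi := (integrable_radial (g := fun s => 1 / (√(s + η ^ 2) ^ 3 * (1 + s))) (by fun_prop) p).1
    (integrable_radial_log p hη)
  rw [integral_radial (g := fun s => 1 / (√(s + η ^ 2) ^ 3 * (1 + s))) (by fun_prop)]
  have h := setIntegral_mono_on hi
    ((integrableOn_log_bound hη).add integrable_inv_one_add_sq.integrableOn) measurableSet_Ioi
    (radial_log_le hη)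
  simp only [Pi.add_apply] at h
  rw [integral_add (integrableOn_log_bound hη) integrable_inv_one_add_sq.integrableOn,
    integral_Ioi_inv_one_add_sq, setIntegral_indicator measurableSet_Ioc,
    inter_eq_right.2 Ioc_subset_Ioi_self, ← intervalIntegral.integral_of_le zero_le_one,
    intervalIntegral.integral_const_mul, intervalIntegral.integral_comp_add_right (fun x => x⁻¹),
    integral_inv_of_pos (by linarith) (by linarith), zero_add,
    Real.log_div (by linarith) hη.ne'] at h
  have h2 : Real.log (1 + η) ≤ 1 := by
    have := Real.log_le_sub_one_of_pos (show 0 < 1 + η by linarith)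
    linarith
  have h3 : Real.log η < 0 := Real.log_neg hη h1
  simp only [Real.arctan_zero, sub_zero] at h
  have h4 := Real.pi_lt_d2
  have h5 := Real.pi_pos
  calc _ ≤ 4 * Real.pi * (4 * (1 - Real.log η)) := by
        gcongr; linarith
    _ = _ := by ring

/-- An explicit antiderivative of the radial profile of the mollifier
`3 ε² / (|y|² + ε²) ^ (5 / 2)`, the Laplacian of `-(|y|² + ε²) ^ (-1 / 2)`. -/
lemma radial_bump_hasDerivAt {ε : ℝ} (hε : 0 < ε) (ρ : ℝ) :
    HasDerivAt (fun ρ : ℝ => ρ ^ 3 / √(ρ ^ 2 + ε ^ 2) ^ 3)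
      (ρ ^ 2 * (3 * ε ^ 2 / √(ρ ^ 2 + ε ^ 2) ^ 5)) ρ := by
  have hpos : 0 < ρ ^ 2 + ε ^ 2 := by positivity
  have hn2 : √(ρ ^ 2 + ε ^ 2) ^ 2 = ρ ^ 2 + ε ^ 2 := Real.sq_sqrt (by positivity)
  have hnp : 0 < √(ρ ^ 2 + ε ^ 2) := Real.sqrt_pos.2 (by positivity)
  have h1 : HasDerivAt (fun ρ : ℝ => √(ρ ^ 2 + ε ^ 2)) (2 * ρ / (2 * √(ρ ^ 2 + ε ^ 2))) ρ := by
    have h0 : HasDerivAt (fun ρ : ℝ => ρ ^ 2 + ε ^ 2) (2 * ρ) ρ := by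
      simpa using (hasDerivAt_pow 2 ρ).add_const (ε ^ 2)
    exact h0.sqrt hpos.ne'
  have h2 := (hasDerivAt_pow 3 ρ).fun_div (h1.fun_pow 3) (pow_pos hnp 3).ne'
  refine h2.congr_deriv ?_
  generalize √(ρ ^ 2 + ε ^ 2) = n at hn2 hnp
  have : ε ^ 2 = n ^ 2 - ρ ^ 2 := by linarith
  rw [this]
  field_simp
  push_cast
  ring

lemma radial_bump_tendsto {ε : ℝ} (hε : 0 < ε) :
    Filter.Tendsto (fun ρ : ℝ => ρ ^ 3 / √(ρ ^ 2 + ε ^ 2) ^ 3) Filter.atTop (nhds 1) := by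
  have h : Filter.Tendsto (fun ρ : ℝ => (1 / √(1 + (ε * ρ⁻¹) ^ 2)) ^ 3) Filter.atTop
      (nhds ((1 / √(1 + (ε * 0) ^ 2)) ^ 3)) := by
    have h0 : Filter.Tendsto (fun ρ : ℝ => ρ⁻¹) Filter.atTop (nhds 0) := tendsto_inv_atTop_zero
    have hc : Continuous fun x : ℝ => (1 / √(1 + (ε * x) ^ 2)) ^ 3 := by
      refine (continuous_const.div (by fun_prop) fun x => ?_).pow 3
      exact (Real.sqrt_pos.2 (by positivity)).ne'
    exact (hc.tendsto 0).comp h0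
  simp only [mul_zero, ne_eq, OfNat.ofNat_ne_zero, not_false_eq_true, zero_pow, add_zero,
    Real.sqrt_one, div_one, one_pow] at h
  refine h.congr' ?_
  filter_upwards [Filter.eventually_gt_atTop 0] with ρ hρ
  have : √(1 + (ε * ρ⁻¹) ^ 2) = √(ρ ^ 2 + ε ^ 2) / ρ := by
    rw [show 1 + (ε * ρ⁻¹) ^ 2 =
      (ρ ^ 2 + ε ^ 2) / ρ ^ 2 by field_simp, Real.sqrt_div (by positivity), Real.sqrt_sq hρ.le]
  rw [this]
  field_simp

lemma integrable_radial_bump (p : ℝ × ℝ) {ε : ℝ} (hε : 0 < ε) :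
    Integrable (fun x : (ℝ × ℝ) × ℝ => 3 * ε ^ 2 / √(distSq p x.1 x.2 + ε ^ 2) ^ 5) angMeasure := by
  rw [integrable_radial (g := fun s => 3 * ε ^ 2 / √(s + ε ^ 2) ^ 5) (by fun_prop)]
  exact integrableOn_Ioi_deriv_of_nonneg' (fun ρ _ => radial_bump_hasDerivAt hε ρ)
    (fun ρ _ => by positivity) (radial_bump_tendsto hε)

lemma integral_radial_bump (p : ℝ × ℝ) {ε : ℝ} (hε : 0 < ε) :
    ∫ x, 3 * ε ^ 2 / √(distSq p x.1 x.2 + ε ^ 2) ^ 5 ∂angMeasure = 4 * Real.pi := by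
  rw [integral_radial (g := fun s => 3 * ε ^ 2 / √(s + ε ^ 2) ^ 5) (by fun_prop),
    integral_Ioi_of_hasDerivAt_of_nonneg' (fun ρ _ => radial_bump_hasDerivAt hε ρ)
    (fun ρ _ => by positivity) (radial_bump_tendsto hε)]
  simp

/-! ### Bounded integrable densities -/

/-- `f` is integrable with integral of `|f|` at most `N`, and is essentially bounded by `M`. -/
structure IsDensity (f : ℝ × ℝ → ℝ) (M N : ℝ) : Prop where
  integrable : Integrable f axiMeasure
  nonneg : 0 ≤ M
  ae_le : ∀ᵐ q ∂axiMeasure, |f q| ≤ M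
  integral_le : ∫ q, |f q| ∂axiMeasure ≤ N

lemma measureReal_ang : (volume.restrict (Ioc 0 (2 * Real.pi))).real univ = 2 * Real.pi := by
  simp [Measure.real, Real.pi_pos.le]

lemma integrable_ang_fst {f : ℝ × ℝ → ℝ} (hf : Integrable f axiMeasure) :
    Integrable (fun x : (ℝ × ℝ) × ℝ => f x.1) angMeasure := hf.comp_fst _

lemma integral_ang_fst (f : ℝ × ℝ → ℝ) :
    ∫ x, f x.1 ∂angMeasure = 2 * Real.pi * ∫ q, f q ∂axiMeasure := by
  unfold angMeasure
  rw [integral_fun_fst, measureReal_ang, smul_eq_mul]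

lemma ae_ang_fst {s : ℝ × ℝ → Prop} (h : ∀ᵐ q ∂axiMeasure, s q) :
    ∀ᵐ x ∂angMeasure, s x.1 :=
  Measure.quasiMeasurePreserving_fst.ae h

lemma measurePreserving_ang {ρ : ℝ × ℝ → ℝ × ℝ} (h : MeasurePreserving ρ axiMeasure axiMeasure) :
    MeasurePreserving (fun x : (ℝ × ℝ) × ℝ => (ρ x.1, x.2)) angMeasure angMeasure :=
  h.prod (MeasurePreserving.id _)

lemma integrable_density_radial {f : ℝ × ℝ → ℝ} {M N : ℝ} (hf : IsDensity f M N)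
    {ρ : ℝ × ℝ → ℝ × ℝ} (hρ : MeasurePreserving ρ axiMeasure axiMeasure)
    {g : ℝ → ℝ} {p : ℝ × ℝ}
    (hi : Integrable (fun x : (ℝ × ℝ) × ℝ => g (distSq p x.1 x.2)) angMeasure) :
    Integrable (fun x : (ℝ × ℝ) × ℝ => |f x.1| * g (distSq p (ρ x.1) x.2)) angMeasure := by
  have h1 : Integrable (fun x : (ℝ × ℝ) × ℝ => g (distSq p (ρ x.1) x.2)) angMeasure :=
    (measurePreserving_ang hρ).integrable_comp_of_integrable hi
  refine h1.bdd_mul (c := M) (integrable_ang_fst hf.integrable).abs.aestronglyMeasurable ?_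
  filter_upwards [ae_ang_fst hf.ae_le] with x hx
  simpa using hx

lemma integral_density_radial_le {f : ℝ × ℝ → ℝ} {M N : ℝ} (hf : IsDensity f M N)
    {ρ : ℝ × ℝ → ℝ × ℝ} (hρ : MeasurePreserving ρ axiMeasure axiMeasure)
    {g : ℝ → ℝ} (h0 : ∀ s, 0 ≤ s → 0 ≤ g s) {p : ℝ × ℝ}
    (hi : Integrable (fun x : (ℝ × ℝ) × ℝ => g (distSq p x.1 x.2)) angMeasure) :
    ∫ x, |f x.1| * g (distSq p (ρ x.1) x.2) ∂angMeasure ≤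
      M * ∫ x, g (distSq p x.1 x.2) ∂angMeasure := by
  have h1 : Integrable (fun x : (ℝ × ℝ) × ℝ => g (distSq p (ρ x.1) x.2)) angMeasure :=
    (measurePreserving_ang hρ).integrable_comp_of_integrable hi
  have h2 : ∫ x, g (distSq p (ρ x.1) x.2) ∂angMeasure = ∫ x, g (distSq p x.1 x.2) ∂angMeasure := by
    have := integral_map (measurePreserving_ang hρ).measurable.aemeasurable (μ := angMeasure)
      (f := fun x : (ℝ × ℝ) × ℝ => g (distSq p x.1 x.2)) (by
        rw [(measurePreserving_ang hρ).map_eq]; exact hi.aestronglyMeasurable)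
    rw [(measurePreserving_ang hρ).map_eq] at this
    rw [this]
  rw [← h2, ← integral_const_mul]
  refine integral_mono_ae (integrable_density_radial hf hρ hi) (h1.const_mul M) ?_
  filter_upwards [ae_ang_fst hf.ae_le] with x hx
  exact mul_le_mul_of_nonneg_right hx (h0 _ (distSq_nonneg _ _ _))

lemma integrable_density_inv {f : ℝ × ℝ → ℝ} {M N : ℝ} (hf : IsDensity f M N)
    {ρ : ℝ × ℝ → ℝ × ℝ} (hρ : MeasurePreserving ρ axiMeasure axiMeasure) (p : ℝ × ℝ) :
    Integrable (fun x : (ℝ × ℝ) × ℝ => |f x.1| * (1 / distSq p (ρ x.1) x.2)) angMeasure := by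
  have h := integrable_density_radial hf hρ (g := fun s => 1 / (s * (1 + s)))
    (integrable_radial_one p)
  refine (h.add (integrable_ang_fst hf.integrable.abs)).mono' ?_ ?_
  · refine (integrable_ang_fst hf.integrable.abs).aestronglyMeasurable.mul ?_
    have := hρ.measurable
    exact Measurable.aestronglyMeasurable (by fun_prop)
  · refine Filter.Eventually.of_forall fun x => ?_
    have hs := distSq_nonneg p (ρ x.1) x.2
    set s := distSq p (ρ x.1) x.2
    simp only [Pi.add_apply]
    rw [Real.norm_of_nonneg (by positivity), ← mul_add_one]
    gcongr
    rcases hs.eq_or_lt with h0 | h0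
    · have : 1 / s = 0 := by rw [← h0]; simp
      rw [this]; positivity
    · rw [← sub_nonneg]
      have : 1 / (s * (1 + s)) + 1 - 1 / s = s / (1 + s) := by field_simp; ring
      rw [this]; positivity

/-- A density convolved with the kernel `1 / |y|²` is bounded. The volume preserving rearrangement
`ρ` costs nothing; it is the flow map when the integral is written in Lagrangian variables. -/
lemma integral_density_inv_le {f : ℝ × ℝ → ℝ} {M N : ℝ} (hf : IsDensity f M N)
    {ρ : ℝ × ℝ → ℝ × ℝ} (hρ : MeasurePreserving ρ axiMeasure axiMeasure) (p : ℝ × ℝ) :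
    ∫ x, |f x.1| * (1 / distSq p (ρ x.1) x.2) ∂angMeasure ≤
      2 * Real.pi ^ 2 * M + 2 * Real.pi * N := by
  have hi := integrable_density_radial hf hρ (g := fun s => 1 / (s * (1 + s)))
    (integrable_radial_one p)
  have h := integral_density_radial_le hf hρ (g := fun s => 1 / (s * (1 + s)))
    (fun s hs => by positivity) (integrable_radial_one p)
  rw [integral_radial_one] at h
  have h2 := integral_ang_fst (fun q => |f q|)
  have h3 : ∫ x, |f x.1| * (1 / distSq p (ρ x.1) x.2) ∂angMeasure ≤
      ∫ x, (|f x.1| * (1 / (distSq p (ρ x.1) x.2 * (1 + distSq p (ρ x.1) x.2))) +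
        |f x.1|) ∂angMeasure := by
    refine integral_mono (integrable_density_inv hf hρ p)
      (hi.add (integrable_ang_fst hf.integrable.abs)) ?_
    intro x
    have hs := distSq_nonneg p (ρ x.1) x.2
    simp only
    set s := distSq p (ρ x.1) x.2
    rw [← mul_add_one]
    gcongr
    rcases hs.eq_or_lt with h0 | h0
    · have : 1 / s = 0 := by rw [← h0]; simp
      rw [this]; positivity
    · rw [← sub_nonneg]
      have : 1 / (s * (1 + s)) + 1 - 1 / s = s / (1 + s) := by field_simp; ring
      rw [this]; positivity
  rw [integral_add hi (integrable_ang_fst hf.integrable.abs), h2] at h3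
  have := mul_le_mul_of_nonneg_left hf.integral_le Real.two_pi_pos.le
  linarith

lemma integrable_density_cube {f : ℝ × ℝ → ℝ} {M N : ℝ} (hf : IsDensity f M N)
    {ρ : ℝ × ℝ → ℝ × ℝ} (hρ : MeasurePreserving ρ axiMeasure axiMeasure) (p : ℝ × ℝ)
    {η : ℝ} (hη : 0 < η) :
    Integrable (fun x : (ℝ × ℝ) × ℝ => |f x.1| * (1 / √(distSq p (ρ x.1) x.2 + η ^ 2) ^ 3))
      angMeasure := by
  refine (integrable_ang_fst hf.integrable.abs).mul_bdd (c := 1 / η ^ 3) ?_ ?_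
  · have := hρ.measurable
    exact Measurable.aestronglyMeasurable (by fun_prop)
  · refine Filter.Eventually.of_forall fun x => ?_
    rw [Real.norm_of_nonneg (by positivity)]
    have : η ≤ √(distSq p (ρ x.1) x.2 + η ^ 2) :=
      Real.le_sqrt_of_sq_le (by linarith [distSq_nonneg p (ρ x.1) x.2])
    gcongr

lemma integral_density_cube_le {f : ℝ × ℝ → ℝ} {M N : ℝ} (hf : IsDensity f M N)
    {ρ : ℝ × ℝ → ℝ × ℝ} (hρ : MeasurePreserving ρ axiMeasure axiMeasure) (p : ℝ × ℝ)
    {η : ℝ} (hη : 0 < η) (h1 : η < 1) :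
    ∫ x, |f x.1| * (1 / √(distSq p (ρ x.1) x.2 + η ^ 2) ^ 3) ∂angMeasure ≤
      (32 * Real.pi * M + 2 * Real.pi * N) * (1 - Real.log η) := by
  have hi := integrable_density_radial hf hρ (g := fun s => 1 / (√(s + η ^ 2) ^ 3 * (1 + s)))
    (integrable_radial_log p hη)
  have h := integral_density_radial_le hf hρ (g := fun s => 1 / (√(s + η ^ 2) ^ 3 * (1 + s)))
    (fun s hs => by positivity) (integrable_radial_log p hη)
  have h2 := integral_ang_fst (fun q => |f q|)
  have h3 : ∫ x, |f x.1| * (1 / √(distSq p (ρ x.1) x.2 + η ^ 2) ^ 3) ∂angMeasure ≤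
      ∫ x, (2 * (|f x.1| * (1 / (√(distSq p (ρ x.1) x.2 + η ^ 2) ^ 3 * (1 + distSq p (ρ x.1) x.2))))
        + |f x.1|) ∂angMeasure := by
    refine integral_mono (integrable_density_cube hf hρ p hη)
      ((hi.const_mul 2).add (integrable_ang_fst hf.integrable.abs)) ?_
    intro x
    have hs := distSq_nonneg p (ρ x.1) x.2
    simp only
    set s := distSq p (ρ x.1) x.2
    have hnp : 0 < √(s + η ^ 2) := Real.sqrt_pos.2 (by positivity)
    rw [mul_left_comm, ← mul_add_one]
    gcongr
    by_cases hs1 : s ≤ 1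
    · have : 1 / √(s + η ^ 2) ^ 3 ≤ 2 * (1 / (√(s + η ^ 2) ^ 3 * (1 + s))) := by
        rw [mul_one_div, div_le_div_iff₀ (by positivity) (by positivity)]
        nlinarith [pow_pos hnp 3]
      linarith
    · have : 1 ≤ √(s + η ^ 2) := by
        rw [Real.one_le_sqrt]; nlinarith
      have : 1 / √(s + η ^ 2) ^ 3 ≤ 1 := by
        rw [div_le_one (by positivity)]; exact one_le_pow₀ this
      have : 0 ≤ 2 * (1 / (√(s + η ^ 2) ^ 3 * (1 + s))) := by positivity
      linarith
  rw [integral_add (hi.const_mul 2) (integrable_ang_fst hf.integrable.abs), h2,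
    integral_const_mul] at h3
  have h4 := mul_le_mul_of_nonneg_left hf.integral_le Real.two_pi_pos.le
  have h5 := mul_le_mul_of_nonneg_left (integral_radial_log_le p hη h1) hf.nonneg
  have h6 : Real.log η < 0 := Real.log_neg hη h1
  have h7 : 0 ≤ N := le_trans (integral_nonneg fun _ => abs_nonneg _) hf.integral_le
  have h8 : 0 ≤ 2 * Real.pi * N * (-Real.log η) := by
    have := Real.pi_pos
    have : 0 ≤ -Real.log η := by linarith
    positivity
  nlinarith

lemma integrable_density_two {f : ℝ × ℝ → ℝ} {M N : ℝ} (hf : IsDensity f M N)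
    {ρ : ℝ × ℝ → ℝ × ℝ} (hρ : MeasurePreserving ρ axiMeasure axiMeasure) (p : ℝ × ℝ)
    {η : ℝ} (hη : 0 < η) :
    Integrable (fun x : (ℝ × ℝ) × ℝ => |f x.1| * (η ^ 2 / (distSq p (ρ x.1) x.2 *
      (distSq p (ρ x.1) x.2 + η ^ 2)))) angMeasure :=
  integrable_density_radial hf hρ (g := fun s => η ^ 2 / (s * (s + η ^ 2)))
    (integrable_radial_two p hη)

lemma integral_density_two_le {f : ℝ × ℝ → ℝ} {M N : ℝ} (hf : IsDensity f M N)
    {ρ : ℝ × ℝ → ℝ × ℝ} (hρ : MeasurePreserving ρ axiMeasure axiMeasure) (p : ℝ × ℝ)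
    {η : ℝ} (hη : 0 < η) :
    ∫ x, |f x.1| * (η ^ 2 / (distSq p (ρ x.1) x.2 * (distSq p (ρ x.1) x.2 + η ^ 2))) ∂angMeasure
      ≤ 2 * Real.pi ^ 2 * M * η := by
  have := integral_density_radial_le hf hρ (g := fun s => η ^ 2 / (s * (s + η ^ 2)))
    (fun s hs => by positivity) (integrable_radial_two p hη)
  rw [integral_radial_two p hη] at this
  linarith

/-! ### The Biot-Savart kernels and the velocity -/

/-- The properties of the numerators of the two Biot-Savart kernels from which the estimates follow:
`ν p q θ` is bounded by the three-space distance of the two points, and is Lipschitz in them. -/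
structure IsNumerator (ν : ℝ × ℝ → ℝ × ℝ → ℝ → ℝ) : Prop where
  continuous : Continuous fun x : (ℝ × ℝ) × (ℝ × ℝ) × ℝ => ν x.1 x.2.1 x.2.2
  abs_le : ∀ p q θ, |ν p q θ| ≤ √(distSq p q θ)
  abs_sub_le : ∀ p q p' q' θ, |ν p q θ - ν p' q' θ| ≤ dist p p' + dist q q'

/-- The numerator of the radial Biot-Savart kernel, with the sign convention of `velR`. -/
def numR (p q : ℝ × ℝ) (θ : ℝ) : ℝ := -((p.2 - q.2) * Real.cos θ)

/-- The numerator of the vertical Biot-Savart kernel, as in `velZ`. -/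
def numZ (p q : ℝ × ℝ) (θ : ℝ) : ℝ := p.1 * Real.cos θ - q.1

lemma abs_mul_cos_le (a θ : ℝ) : |a * Real.cos θ| ≤ |a| := by
  rw [abs_mul]
  exact mul_le_of_le_one_right (abs_nonneg _) (Real.abs_cos_le_one θ)

lemma abs_fst_sub_le (p q : ℝ × ℝ) : |p.1 - q.1| ≤ dist p q := by
  rw [Prod.dist_eq]; exact le_max_left _ _

lemma abs_snd_sub_le (p q : ℝ × ℝ) : |p.2 - q.2| ≤ dist p q := by
  rw [Prod.dist_eq]; exact le_max_right _ _

lemma distSq_eq_add (p q : ℝ × ℝ) (θ : ℝ) :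
    distSq p q θ = (p.1 * Real.cos θ - q.1) ^ 2 + (p.1 * Real.sin θ) ^ 2 + (p.2 - q.2) ^ 2 := by
  unfold distSq
  linear_combination (-p.1 ^ 2) * Real.sin_sq_add_cos_sq θ

lemma isNumerator_numR : IsNumerator numR where
  continuous := by unfold numR; fun_prop
  abs_le p q θ := by
    unfold numR
    rw [abs_neg]
    refine (abs_mul_cos_le _ _).trans (Real.abs_le_sqrt ?_)
    rw [distSq_eq_add]; nlinarith [sq_nonneg (p.1 * Real.cos θ - q.1), sq_nonneg (p.1 * Real.sin θ)]
  abs_sub_le p q p' q' θ := by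
    unfold numR
    rw [show -((p.2 - q.2) * Real.cos θ) - -((p'.2 - q'.2) * Real.cos θ)
      = (q.2 - q'.2) * Real.cos θ - (p.2 - p'.2) * Real.cos θ by ring]
    refine (abs_sub _ _).trans ?_
    have h1 := (abs_mul_cos_le (q.2 - q'.2) θ).trans (abs_snd_sub_le q q')
    have h2 := (abs_mul_cos_le (p.2 - p'.2) θ).trans (abs_snd_sub_le p p')
    linarith

lemma isNumerator_numZ : IsNumerator numZ where
  continuous := by unfold numZ; fun_prop
  abs_le p q θ := by
    unfold numZ
    refine Real.abs_le_sqrt ?_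
    rw [distSq_eq_add]; nlinarith [sq_nonneg (p.2 - q.2), sq_nonneg (p.1 * Real.sin θ)]
  abs_sub_le p q p' q' θ := by
    unfold numZ
    rw [show p.1 * Real.cos θ - q.1 - (p'.1 * Real.cos θ - q'.1)
      = (p.1 - p'.1) * Real.cos θ - (q.1 - q'.1) by ring]
    refine (abs_sub _ _).trans ?_
    have h1 := abs_fst_sub_le q q'
    have h2 := (abs_mul_cos_le (p.1 - p'.1) θ).trans (abs_fst_sub_le p p')
    linarith

/-- The Biot-Savart kernel with numerator `ν`, regularised at the scale `ε`: the squared distance in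
the denominator is increased by `ε ^ 2`. The value `ε = 0` gives the kernel itself. -/
def kern (ν : ℝ × ℝ → ℝ × ℝ → ℝ → ℝ) (ε : ℝ) (p q : ℝ × ℝ) (θ : ℝ) : ℝ :=
  ν p q θ / √(distSq p q θ + ε ^ 2) ^ 3

lemma measurable_kern {ν : ℝ × ℝ → ℝ × ℝ → ℝ → ℝ} (hν : IsNumerator ν) (ε : ℝ) :
    Measurable fun x : (ℝ × ℝ) × (ℝ × ℝ) × ℝ => kern ν ε x.1 x.2.1 x.2.2 := by
  unfold kern
  exact hν.continuous.measurable.div (by fun_prop)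

lemma abs_kern_le {ν : ℝ × ℝ → ℝ × ℝ → ℝ → ℝ} (hν : IsNumerator ν) (ε : ℝ) (p q : ℝ × ℝ) (θ : ℝ) :
    |kern ν ε p q θ| ≤ 1 / distSq p q θ := by
  have h := hν.abs_le p q θ
  have hs := distSq_nonneg p q θ
  unfold kern
  rw [abs_div, abs_of_nonneg (by positivity : 0 ≤ √(distSq p q θ + ε ^ 2) ^ 3)]
  rcases hs.eq_or_lt with h0 | h0
  · rw [← h0, Real.sqrt_zero] at h
    have h1 : |ν p q θ| = 0 := le_antisymm h (abs_nonneg _)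
    rw [h1, ← h0]; simp
  · have h2 : √(distSq p q θ) ≤ √(distSq p q θ + ε ^ 2) := Real.sqrt_le_sqrt (by nlinarith)
    have h3 : 0 < √(distSq p q θ) := Real.sqrt_pos.2 h0
    calc _ ≤ √(distSq p q θ) / √(distSq p q θ) ^ 3 := by gcongr
      _ = 1 / √(distSq p q θ) ^ 2 := by field_simp
      _ = _ := by rw [Real.sq_sqrt hs]

lemma abs_kern_sub_reg_le {ν : ℝ × ℝ → ℝ × ℝ → ℝ → ℝ} (hν : IsNumerator ν) {η : ℝ} (hη : 0 < η)
    (p q : ℝ × ℝ) (θ : ℝ) :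
    |kern ν 0 p q θ - kern ν η p q θ| ≤ 3 * (η ^ 2 / (distSq p q θ * (distSq p q θ + η ^ 2))) := by
  have h := hν.abs_le p q θ
  have hs := distSq_nonneg p q θ
  unfold kern
  rw [zero_pow two_ne_zero, add_zero]
  rcases hs.eq_or_lt with h0 | h0
  · rw [← h0, Real.sqrt_zero] at h
    have h1 : ν p q θ = 0 := abs_eq_zero.1 (le_antisymm h (abs_nonneg _))
    rw [h1, ← h0]; simp
  · have h3 : 0 < √(distSq p q θ) := Real.sqrt_pos.2 h0
    have hd := Real.sq_sqrt hs
    have hn := Real.sq_sqrt (by positivity : 0 ≤ distSq p q θ + η ^ 2)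
    have h4 : √(distSq p q θ) < √(distSq p q θ + η ^ 2) := Real.sqrt_lt_sqrt hs (by nlinarith)
    generalize √(distSq p q θ + η ^ 2) = n at *
    generalize √(distSq p q θ) = d at *
    have hn0 : 0 < n := h3.trans h4
    rw [← hn, ← hd, div_sub_div _ _ (by positivity) (by positivity), abs_div,
      abs_of_pos (by positivity : 0 < d ^ 3 * n ^ 3)]
    have e1 : ν p q θ * n ^ 3 - d ^ 3 * ν p q θ = ν p q θ * (n ^ 3 - d ^ 3) := by ring
    have h5 : 0 ≤ n ^ 3 - d ^ 3 := by
      have := pow_le_pow_left₀ h3.le h4.le 3; linarith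
    rw [e1, abs_mul, abs_of_nonneg h5, ← mul_div_assoc, div_le_div_iff₀ (by positivity)
      (by positivity)]
    have h6 : |ν p q θ| * (n ^ 3 - d ^ 3) ≤ d * (n ^ 3 - d ^ 3) := by gcongr
    have h7 : (n ^ 3 - d ^ 3) * n ≤ 3 * η ^ 2 * n ^ 2 := by
      have e2 : η ^ 2 = n ^ 2 - d ^ 2 := by linarith
      have hnd : 0 < n - d := by linarith
      have : 0 ≤ (n - d) * (n * (2 * n * (n - d) + n * d + 3 * n * d - d ^ 2 + d * n)) := by
        have : 0 ≤ 2 * n * (n - d) + n * d + 3 * n * d - d ^ 2 + d * n := by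
          nlinarith [mul_pos hn0 hnd, mul_pos hn0 h3]
        positivity
      rw [e2]
      nlinarith [mul_pos (mul_pos hn0 hn0) (mul_pos hnd h3),
        mul_pos (mul_pos hn0 h3) (mul_pos hnd h3), mul_pos (mul_pos hn0 hn0) (mul_pos hnd hn0)]
    calc |ν p q θ| * (n ^ 3 - d ^ 3) * (d ^ 2 * n ^ 2) ≤ d * (n ^ 3 - d ^ 3) * (d ^ 2 * n ^ 2) := by
          gcongr
      _ = ((n ^ 3 - d ^ 3) * n) * (d ^ 3 * n) := by ring
      _ ≤ (3 * η ^ 2 * n ^ 2) * (d ^ 3 * n) := by gcongr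
      _ = _ := by ring

lemma abs_inv_cube_sub_le {a b n m δ : ℝ} (hn : 0 < n) (hm : 0 < m) (ha : |a| ≤ n) (hb : |b| ≤ m)
    (hab : |a - b| ≤ δ) (hnm : |n - m| ≤ δ) :
    |a / n ^ 3 - b / m ^ 3| ≤ 4 * δ * (1 / n ^ 3 + 1 / m ^ 3) := by
  wlog h : m ≤ n generalizing a b n m
  · have := this hm hn hb ha (by rwa [abs_sub_comm]) (by rwa [abs_sub_comm]) (le_of_not_ge h)
    rw [abs_sub_comm, add_comm (1 / n ^ 3)]; exact this
  have e : a / n ^ 3 - b / m ^ 3 = (a - b) / n ^ 3 - b * ((n ^ 3 - m ^ 3) / (n ^ 3 * m ^ 3)) := by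
    field_simp; ring
  have hδ : 0 ≤ δ := (abs_nonneg _).trans hab
  have hnm' : n - m ≤ δ := (le_abs_self _).trans hnm
  have h0 : 0 ≤ n ^ 3 - m ^ 3 := by
    have := pow_le_pow_left₀ hm.le h 3; linarith
  rw [e]
  refine (abs_sub _ _).trans ?_
  have t1 : |(a - b) / n ^ 3| ≤ δ * (1 / n ^ 3) := by
    rw [abs_div, abs_of_pos (by positivity : 0 < n ^ 3), mul_one_div]; gcongr
  have t2 : |b * ((n ^ 3 - m ^ 3) / (n ^ 3 * m ^ 3))| ≤ 3 * δ * (1 / m ^ 3) := by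
    rw [abs_mul, abs_of_nonneg (by positivity : 0 ≤ (n ^ 3 - m ^ 3) / (n ^ 3 * m ^ 3))]
    have h1 : n ^ 3 - m ^ 3 ≤ 3 * δ * n ^ 2 := by
      have e2 : n ^ 3 - m ^ 3 = (n - m) * (n ^ 2 + n * m + m ^ 2) := by ring
      have e3 : n ^ 2 + n * m + m ^ 2 ≤ 3 * n ^ 2 := by nlinarith
      rw [e2]
      calc _ ≤ δ * (3 * n ^ 2) := by
            apply mul_le_mul hnm' e3 (by positivity) hδ
        _ = _ := by ring
    calc _ ≤ m * ((3 * δ * n ^ 2) / (n ^ 3 * m ^ 3)) := by gcongr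
      _ ≤ n * ((3 * δ * n ^ 2) / (n ^ 3 * m ^ 3)) := by gcongr
      _ = _ := by field_simp
  have : 0 ≤ δ * (1 / n ^ 3) := by positivity
  have : 0 ≤ δ * (1 / m ^ 3) := by positivity
  linarith

lemma norm_cyl_sub_le (p q : ℝ × ℝ) (θ : ℝ) : ‖cyl p θ - cyl q θ‖ ≤ 2 * dist p q := by
  have h1 := abs_fst_sub_le p q
  have h2 := abs_snd_sub_le p q
  rw [← sq_le_sq₀ (norm_nonneg _) (by positivity)]
  simp only [cyl, EuclideanSpace.norm_sq_eq, Fin.sum_univ_three, PiLp.sub_apply]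
  simp only [Real.norm_eq_abs, sq_abs, Matrix.cons_val_zero, Matrix.cons_val_one, Matrix.cons_val]
  have e : (p.2 - q.2) ^ 2 + (p.1 * Real.cos θ - q.1 * Real.cos θ) ^ 2 +
      (p.1 * Real.sin θ - q.1 * Real.sin θ) ^ 2 = (p.2 - q.2) ^ 2 + (p.1 - q.1) ^ 2 := by
    linear_combination ((p.1 - q.1) ^ 2) * Real.sin_sq_add_cos_sq θ
  have h3 := sq_le_sq' (abs_le.1 h1).1 (abs_le.1 h1).2
  have h4 := sq_le_sq' (abs_le.1 h2).1 (abs_le.1 h2).2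
  rw [e]; nlinarith [dist_nonneg (x := p) (y := q)]

lemma abs_sqrt_add_sub_le {a b c : ℝ} (ha : 0 ≤ a) (hb : 0 ≤ b) (hc : 0 < c) :
    |√(a ^ 2 + c ^ 2) - √(b ^ 2 + c ^ 2)| ≤ |a - b| := by
  have hn := Real.sq_sqrt (by positivity : 0 ≤ a ^ 2 + c ^ 2)
  have hm := Real.sq_sqrt (by positivity : 0 ≤ b ^ 2 + c ^ 2)
  have h1 : a ≤ √(a ^ 2 + c ^ 2) := Real.le_sqrt_of_sq_le (by nlinarith)
  have h2 : b ≤ √(b ^ 2 + c ^ 2) := Real.le_sqrt_of_sq_le (by nlinarith)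
  have h3 : 0 < √(a ^ 2 + c ^ 2) := Real.sqrt_pos.2 (by positivity)
  have h4 : 0 < √(b ^ 2 + c ^ 2) := Real.sqrt_pos.2 (by positivity)
  generalize √(a ^ 2 + c ^ 2) = n at *
  generalize √(b ^ 2 + c ^ 2) = m at *
  have e : (n - m) * (n + m) = (a - b) * (a + b) := by nlinarith
  have e2 : |n - m| * (n + m) = |a - b| * (a + b) := by
    rw [← abs_of_pos (by linarith : 0 < n + m), ← abs_mul, e, abs_mul,
      abs_of_nonneg (by linarith : 0 ≤ a + b)]
  have e3 : |a - b| * (a + b) ≤ |a - b| * (n + m) := by gcongr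
  exact le_of_mul_le_mul_right (e2.trans_le e3) (by linarith)

/-- The kernel regularised at scale `η` is Lipschitz, with a constant of degree `-3` in the
distance. -/
lemma abs_kern_sub_le {ν : ℝ × ℝ → ℝ × ℝ → ℝ → ℝ} (hν : IsNumerator ν) {η : ℝ} (hη : 0 < η)
    (p q p' q' : ℝ × ℝ) (θ : ℝ) :
    |kern ν η p q θ - kern ν η p' q' θ| ≤ 8 * (dist p p' + dist q q') *
      (1 / √(distSq p q θ + η ^ 2) ^ 3 + 1 / √(distSq p' q' θ + η ^ 2) ^ 3) := by
  have hle : ∀ p q, √(distSq p q θ) ≤ √(distSq p q θ + η ^ 2) := fun p q =>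
    Real.sqrt_le_sqrt (by nlinarith)
  have hpos : ∀ p q, 0 < √(distSq p q θ + η ^ 2) := fun p q =>
    Real.sqrt_pos.2 (by have := distSq_nonneg p q θ; positivity)
  have h := abs_inv_cube_sub_le (δ := 2 * (dist p p' + dist q q')) (hpos p q) (hpos p' q')
    ((hν.abs_le p q θ).trans (hle p q)) ((hν.abs_le p' q' θ).trans (hle p' q'))
    ((hν.abs_sub_le p q p' q' θ).trans
    (by linarith [dist_nonneg (x := p) (y := p'), dist_nonneg (x := q) (y := q')])) ?_
  · refine h.trans_eq ?_; ring
  · rw [distSq_eq_norm, distSq_eq_norm]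
    refine (abs_sqrt_add_sub_le (norm_nonneg _) (norm_nonneg _) hη).trans ?_
    refine (abs_norm_sub_norm_le _ _).trans ?_
    rw [show cyl p 0 - cyl q θ - (cyl p' 0 - cyl q' θ) = (cyl p 0 - cyl p' 0) -
      (cyl q θ - cyl q' θ) by abel]
    refine (norm_sub_le _ _).trans ?_
    linarith [norm_cyl_sub_le p p' 0, norm_cyl_sub_le q q' θ]

/-- The component of the velocity with numerator `ν`, regularised at the scale `ε`, as one integral
over three-space. For `ε = 0` this is `velR` for `numR` and `velZ` for `numZ` (`velR_eq_vel`,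
`velZ_eq_vel`). It is defined on all of `ℝ × ℝ`, the axis included. -/
def vel (ν : ℝ × ℝ → ℝ × ℝ → ℝ → ℝ) (ε : ℝ) (w : ℝ × ℝ → ℝ) (p : ℝ × ℝ) : ℝ :=
  (1 / (4 * Real.pi)) * ∫ x, kern ν ε p x.1 x.2 * w x.1 ∂angMeasure

section
variable {ν : ℝ × ℝ → ℝ × ℝ → ℝ → ℝ} {f : ℝ × ℝ → ℝ} {M N : ℝ} {ρ : ℝ × ℝ → ℝ × ℝ}

lemma aesm_kern (hν : IsNumerator ν) (hρ : MeasurePreserving ρ axiMeasure axiMeasure) (ε : ℝ)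
    (p : ℝ × ℝ) :
    AEStronglyMeasurable (fun x : (ℝ × ℝ) × ℝ => kern ν ε p (ρ x.1) x.2) angMeasure := by
  have := hρ.measurable
  exact ((measurable_kern hν ε).comp (show Measurable fun x : (ℝ × ℝ) × ℝ => (p, ρ x.1, x.2)
    by fun_prop)).aestronglyMeasurable

lemma integrable_kern_mul (hν : IsNumerator ν) (hf : IsDensity f M N)
    (hρ : MeasurePreserving ρ axiMeasure axiMeasure) (ε : ℝ) (p : ℝ × ℝ) :
    Integrable (fun x : (ℝ × ℝ) × ℝ => kern ν ε p (ρ x.1) x.2 * f x.1) angMeasure := by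
  refine (integrable_density_inv hf hρ p).mono'
    ((aesm_kern hν hρ ε p).mul (integrable_ang_fst hf.integrable).aestronglyMeasurable)
    (Filter.Eventually.of_forall fun x => ?_)
  rw [norm_mul, mul_comm, Real.norm_eq_abs, Real.norm_eq_abs]
  gcongr
  exact abs_kern_le hν _ _ _ _

lemma integrable_kern (hν : IsNumerator ν) (hf : IsDensity f M N) (ε : ℝ) (p : ℝ × ℝ) :
    Integrable (fun x : (ℝ × ℝ) × ℝ => kern ν ε p x.1 x.2 * f x.1) angMeasure :=
  integrable_kern_mul hν hf (MeasurePreserving.id _) ε p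

lemma abs_vel_le (hν : IsNumerator ν) (hf : IsDensity f M N) (ε : ℝ) (p : ℝ × ℝ) :
    |vel ν ε f p| ≤ Real.pi * M + N := by
  unfold vel
  rw [abs_mul, abs_of_pos (by positivity)]
  have h1 : |∫ x, kern ν ε p x.1 x.2 * f x.1 ∂angMeasure| ≤
      ∫ x, |f x.1| * (1 / distSq p x.1 x.2) ∂angMeasure := by
    rw [← Real.norm_eq_abs]
    refine norm_integral_le_of_norm_le (integrable_density_inv hf (MeasurePreserving.id _) p)
      (Filter.Eventually.of_forall fun x => ?_)
    rw [norm_mul, mul_comm, Real.norm_eq_abs, Real.norm_eq_abs]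
    gcongr
    exact abs_kern_le hν _ _ _ _
  have h2 := integral_density_inv_le hf (MeasurePreserving.id _) p
  have hN : 0 ≤ N := le_trans (integral_nonneg fun _ => abs_nonneg _) hf.integral_le
  have hM := hf.nonneg
  have hp := Real.pi_pos
  rw [one_div_mul_eq_div, div_le_iff₀ (by positivity)]
  have h3 : 0 ≤ Real.pi ^ 2 * M := by positivity
  have h4 : 0 ≤ Real.pi * N := by positivity
  simp only [id] at h2
  nlinarith

/-- Regularising at the scale `η` changes the velocity by `O(η)`, uniformly in space. -/
lemma abs_vel_sub_reg_le (hν : IsNumerator ν) (hf : IsDensity f M N) {η : ℝ} (hη : 0 < η)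
    (p : ℝ × ℝ) :
    |vel ν 0 f p - vel ν η f p| ≤ 6 * Real.pi * M * η := by
  unfold vel
  rw [← mul_sub, ← integral_sub (integrable_kern hν hf _ _) (integrable_kern hν hf _ _),
    abs_mul, abs_of_pos (by positivity)]
  have h1 : |∫ x, (kern ν 0 p x.1 x.2 * f x.1 - kern ν η p x.1 x.2 * f x.1) ∂angMeasure| ≤
      ∫ x, 3 * (|f x.1| * (η ^ 2 / (distSq p x.1 x.2 * (distSq p x.1 x.2 + η ^ 2)))) ∂angMeasure :=
        by
    rw [← Real.norm_eq_abs]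
    refine norm_integral_le_of_norm_le
      ((integrable_density_two hf (MeasurePreserving.id _) p hη).const_mul 3)
      (Filter.Eventually.of_forall fun x => ?_)
    rw [← sub_mul, norm_mul, mul_comm, Real.norm_eq_abs, Real.norm_eq_abs, mul_left_comm]
    gcongr
    exact abs_kern_sub_reg_le hν hη _ _ _
  rw [integral_const_mul] at h1
  have h2 := integral_density_two_le hf (MeasurePreserving.id _) p hη
  have hM := hf.nonneg
  have hp := Real.pi_pos
  rw [one_div_mul_eq_div, div_le_iff₀ (by positivity)]
  simp only [id] at h2
  have : 0 ≤ Real.pi ^ 2 * M * η := by positivity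
  nlinarith

lemma velR_eq_vel (hf : IsDensity f M N) (p : ℝ × ℝ) : velR f p = vel numR 0 f p := by
  unfold vel velR
  have hi := integrable_kern isNumerator_numR hf 0 p
  unfold angMeasure at hi ⊢
  rw [integral_prod _ hi, integral_axi]
  congr 1
  refine integral_congr_ae (Filter.Eventually.of_forall fun q => ?_)
  simp only [kern, numR, integral_mul_const, intervalIntegral.integral_of_le Real.two_pi_pos.le,
    zero_pow two_ne_zero, add_zero]
  ring

lemma velZ_eq_vel (hf : IsDensity f M N) (p : ℝ × ℝ) : velZ f p = vel numZ 0 f p := by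
  unfold vel velZ
  have hi := integrable_kern isNumerator_numZ hf 0 p
  unfold angMeasure at hi ⊢
  rw [integral_prod _ hi, integral_axi]
  congr 1
  refine integral_congr_ae (Filter.Eventually.of_forall fun q => ?_)
  simp only [kern, numZ, integral_mul_const, intervalIntegral.integral_of_le Real.two_pi_pos.le,
    zero_pow two_ne_zero, add_zero]
  ring

end

/-! ### The radial velocity near the axis -/

lemma hasDerivAt_angle (p q : ℝ × ℝ) (ε θ : ℝ) (h : 0 < distSq p q θ + ε ^ 2) :
    HasDerivAt (fun θ => Real.sin θ / √(distSq p q θ + ε ^ 2) ^ 3)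
      (Real.cos θ / √(distSq p q θ + ε ^ 2) ^ 3 -
        3 * p.1 * q.1 * Real.sin θ ^ 2 / √(distSq p q θ + ε ^ 2) ^ 5) θ := by
  have h1 : HasDerivAt (fun θ => distSq p q θ + ε ^ 2) (2 * p.1 * q.1 * Real.sin θ) θ := by
    unfold distSq
    have := ((((Real.hasDerivAt_cos θ).const_mul (2 * p.1 * q.1)).const_sub
        (p.1 ^ 2 + q.1 ^ 2)).add_const ((p.2 - q.2) ^ 2)).add_const (ε ^ 2)
    refine this.congr_deriv (by ring)
  have hnp : 0 < √(distSq p q θ + ε ^ 2) := Real.sqrt_pos.2 h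
  have h2 := (Real.hasDerivAt_sin θ).fun_div ((h1.sqrt h.ne').fun_pow 3) (pow_pos hnp 3).ne'
  refine h2.congr_deriv ?_
  field_simp
  push_cast
  ring

/-- Integration by parts in the angle: it trades `cos θ / d ^ 3` for a kernel that carries the
factor `p.1`. The same identity makes the regularised velocity divergence free. -/
lemma integral_angle_eq_zero (p q : ℝ × ℝ) (ε : ℝ) (h : ∀ θ, 0 < distSq p q θ + ε ^ 2) :
    ∫ θ in (0:ℝ)..(2 * Real.pi), (Real.cos θ / √(distSq p q θ + ε ^ 2) ^ 3 -
        3 * p.1 * q.1 * Real.sin θ ^ 2 / √(distSq p q θ + ε ^ 2) ^ 5) = 0 := by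
  rw [intervalIntegral.integral_eq_sub_of_hasDerivAt (fun θ _ => hasDerivAt_angle p q ε θ (h θ))]
  · simp
  · apply Continuous.intervalIntegrable
    have hn : ∀ θ, √(distSq p q θ + ε ^ 2) ≠ 0 := fun θ => (Real.sqrt_pos.2 (h θ)).ne'
    refine Continuous.sub (Continuous.div (by fun_prop) (by fun_prop) fun θ => pow_ne_zero _ (hn θ))
      (Continuous.div (by fun_prop) (by fun_prop) fun θ => pow_ne_zero _ (hn θ))

lemma distSq_pos {p q : ℝ × ℝ} (hp : 0 ≤ p.1) (hq : 0 ≤ q.1) (h : p ≠ q)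
    (θ : ℝ) : 0 < distSq p q θ := by
  have h1 : (p.1 - q.1) ^ 2 + (p.2 - q.2) ^ 2 ≤ distSq p q θ := by
    unfold distSq
    nlinarith [mul_nonneg (mul_nonneg hp hq) (sub_nonneg.2 (Real.cos_le_one θ))]
  refine lt_of_lt_of_le ?_ h1
  by_contra hc
  apply h
  have : (p.1 - q.1) ^ 2 = 0 := by nlinarith [sq_nonneg (p.1 - q.1), sq_nonneg (p.2 - q.2)]
  have h2 : (p.2 - q.2) ^ 2 = 0 := by nlinarith [sq_nonneg (p.1 - q.1), sq_nonneg (p.2 - q.2)]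
  exact Prod.ext (sub_eq_zero.1 (pow_eq_zero_iff two_ne_zero |>.1 this))
    (sub_eq_zero.1 (pow_eq_zero_iff two_ne_zero |>.1 h2))

lemma ae_axi_pos : ∀ᵐ q ∂axiMeasure, 0 < q.1 :=
  ae_axi_iff.2 (ae_restrict_mem measurableSet_halfPlane)

lemma ae_axi_ne (p : ℝ × ℝ) : ∀ᵐ q ∂axiMeasure, p ≠ q := by
  rw [ae_axi_iff]
  refine ae_restrict_of_ae ?_
  filter_upwards [compl_mem_ae_iff.2 (measure_singleton (μ := (volume : Measure (ℝ × ℝ))) p)] with q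
    hq
  exact fun h => hq h.symm

/-- The angular mean of the radial kernel gains a factor `p.1`, since the term without it integrates
to zero over the angle. -/
lemma abs_integral_kern_numR_le {p q : ℝ × ℝ} (hp : 0 ≤ p.1) (hq : 0 ≤ q.1) (h : p ≠ q) (ε : ℝ) :
    |∫ θ in Ioc 0 (2 * Real.pi), kern numR ε p q θ| * q.1 ≤
      3 * p.1 * ∫ θ in Ioc 0 (2 * Real.pi), 1 / distSq p q θ := by
  have hd : ∀ θ, 0 < distSq p q θ := distSq_pos hp hq h
  have hd' : ∀ θ, 0 < distSq p q θ + ε ^ 2 := fun θ => by have := hd θ; positivity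
  have hn : ∀ θ, √(distSq p q θ + ε ^ 2) ≠ 0 := fun θ => (Real.sqrt_pos.2 (hd' θ)).ne'
  have h0 := integral_angle_eq_zero p q ε hd'
  rw [intervalIntegral.integral_sub] at h0
  rotate_left
  · exact (Continuous.div (by fun_prop) (by fun_prop) fun θ =>
      pow_ne_zero _ (hn θ)).intervalIntegrable _ _
  · exact (Continuous.div (by fun_prop) (by fun_prop) fun θ =>
      pow_ne_zero _ (hn θ)).intervalIntegrable _ _
  have e1 : ∫ θ in Ioc 0 (2 * Real.pi), kern numR ε p q θ =
      ∫ θ in Ioc 0 (2 * Real.pi), (-(p.2 - q.2)) *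
        (3 * p.1 * q.1 * Real.sin θ ^ 2 / √(distSq p q θ + ε ^ 2) ^ 5) := by
    rw [integral_const_mul, ← intervalIntegral.integral_of_le Real.two_pi_pos.le,
      ← intervalIntegral.integral_of_le Real.two_pi_pos.le, ← sub_eq_zero.1 h0,
      ← intervalIntegral.integral_const_mul]
    simp only [kern, numR]
    congr 1
    ext θ
    ring
  have hi : IntegrableOn (fun θ => 1 / distSq p q θ) (Ioc 0 (2 * Real.pi)) := by
    have : Continuous fun θ => 1 / distSq p q θ :=
      Continuous.div (by fun_prop) (by fun_prop) fun θ => (hd θ).ne'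
    exact this.integrableOn_Ioc
  have h3 : |∫ θ in Ioc 0 (2 * Real.pi), q.1 * kern numR ε p q θ| ≤
      ∫ θ in Ioc 0 (2 * Real.pi), 3 * p.1 * (1 / distSq p q θ) := by
    rw [integral_const_mul, e1, ← integral_const_mul, ← Real.norm_eq_abs]
    refine norm_integral_le_of_norm_le (hi.const_mul _) (Filter.Eventually.of_forall fun θ => ?_)
    have hs := Real.sq_sqrt (hd' θ).le
    have hnp := Real.sqrt_pos.2 (hd' θ)
    have hle : √(distSq p q θ) ≤ √(distSq p q θ + ε ^ 2) := Real.sqrt_le_sqrt (by nlinarith)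
    have hsd := Real.sq_sqrt (hd θ).le
    have hdp := Real.sqrt_pos.2 (hd θ)
    have a1 : |p.2 - q.2| ≤ √(distSq p q θ) := by
      refine Real.abs_le_sqrt ?_
      rw [distSq_eq_add]; nlinarith [sq_nonneg (p.1 * Real.cos θ - q.1),
        sq_nonneg (p.1 * Real.sin θ)]
    have a2 : (q.1 * Real.sin θ) ^ 2 ≤ √(distSq p q θ) ^ 2 := by
      rw [hsd, distSq_comm, distSq_eq_add]; nlinarith [sq_nonneg (q.1 * Real.cos θ - p.1),
        sq_nonneg (q.2 - p.2)]
    generalize √(distSq p q θ + ε ^ 2) = n at *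
    have e2 : q.1 * (-(p.2 - q.2) * (3 * p.1 * q.1 * Real.sin θ ^ 2 / n ^ 5)) =
      -((p.2 - q.2) * (3 * p.1 * ((q.1 * Real.sin θ) ^ 2 / n ^ 5))) := by ring
    rw [e2, Real.norm_eq_abs, abs_neg, abs_mul, abs_of_nonneg
      (by positivity : 0 ≤ 3 * p.1 * ((q.1 * Real.sin θ) ^ 2 / n ^ 5))]
    rw [← hsd]
    generalize √(distSq p q θ) = d at *
    calc |p.2 - q.2| * (3 * p.1 * ((q.1 * Real.sin θ) ^ 2 / n ^ 5))
        ≤ d * (3 * p.1 * (d ^ 2 / d ^ 5)) := by gcongr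
      _ = 3 * p.1 * (1 / d ^ 2) := by field_simp
  rw [integral_const_mul, integral_const_mul, abs_mul, abs_of_nonneg hq] at h3
  rw [mul_comm]; exact h3

lemma abs_vel_numR_le {w : ℝ × ℝ → ℝ} {M N M' N' : ℝ} (hw : IsDensity w M' N')
    (hf : IsDensity (fun q => w q / q.1) M N) {p : ℝ × ℝ} (hp : 0 ≤ p.1) (ε : ℝ) :
    |vel numR ε w p| ≤ p.1 * ∫ x, |w x.1 / x.1.1| * (1 / distSq p x.1 x.2) ∂angMeasure := by
  have hi := integrable_kern isNumerator_numR hw ε p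
  have hi2 := integrable_density_inv hf (MeasurePreserving.id _) p
  simp only [id] at hi2
  unfold vel
  unfold angMeasure at hi hi2 ⊢
  rw [integral_prod _ hi, integral_prod _ hi2]
  simp only [integral_mul_const, integral_const_mul]
  rw [abs_mul, abs_of_pos (by positivity : 0 < 1 / (4 * Real.pi))]
  have h1 : |∫ q, (∫ θ in Ioc 0 (2 * Real.pi), kern numR ε p q θ) * w q ∂axiMeasure| ≤
      ∫ q, 3 * p.1 * (|w q / q.1| * ∫ θ in Ioc 0 (2 * Real.pi), 1 / distSq p q θ) ∂axiMeasure := by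
    rw [← Real.norm_eq_abs]
    have hi3 := hi2.integral_prod_left
    simp only [integral_const_mul] at hi3
    refine norm_integral_le_of_norm_le (hi3.const_mul _) ?_
    filter_upwards [ae_axi_pos, ae_axi_ne p] with q hq hpq
    have h2 := abs_integral_kern_numR_le hp hq.le hpq ε
    have e : w q = q.1 * (w q / q.1) := by field_simp
    rw [norm_mul, Real.norm_eq_abs, Real.norm_eq_abs]
    nth_rewrite 1 [e]
    rw [abs_mul, abs_of_pos hq, ← mul_assoc]
    calc _ ≤ (3 * p.1 * ∫ θ in Ioc 0 (2 * Real.pi), 1 / distSq p q θ) * |w q / q.1| := by gcongr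
      _ = _ := by ring
  rw [integral_const_mul] at h1
  have h2 : 0 ≤ ∫ q, (|w q / q.1| * ∫ θ in Ioc 0 (2 * Real.pi), 1 / distSq p q θ) ∂axiMeasure := by
    refine integral_nonneg fun q => mul_nonneg (abs_nonneg _) (integral_nonneg fun θ => ?_)
    have := distSq_nonneg p q θ
    simp only [Pi.zero_apply]; positivity
  have hpi := Real.pi_gt_three
  rw [one_div_mul_eq_div, div_le_iff₀ (by positivity)]
  have h5 := mul_nonneg hp h2
  nlinarith

/-- The radial velocity vanishes linearly at the axis. -/
lemma abs_vel_numR_le' {w : ℝ × ℝ → ℝ} {M N M' N' : ℝ} (hw : IsDensity w M' N')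
    (hf : IsDensity (fun q => w q / q.1) M N) {p : ℝ × ℝ} (hp : 0 ≤ p.1) (ε : ℝ) :
    |vel numR ε w p| ≤ (2 * Real.pi ^ 2 * M + 2 * Real.pi * N) * p.1 := by
  refine (abs_vel_numR_le hw hf hp ε).trans ?_
  rw [mul_comm]
  have := integral_density_inv_le hf (MeasurePreserving.id _) p
  gcongr
  exact this

/-! ### Log-Lipschitz continuity of the velocity -/

section
variable {ν : ℝ × ℝ → ℝ × ℝ → ℝ → ℝ} {f h₁ h₂ : ℝ × ℝ → ℝ} {M N M₁ N₁ : ℝ} {ρ₁ ρ₂ : ℝ × ℝ → ℝ × ℝ}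

/-- The log-Lipschitz bound in Lagrangian form. The two integrals differ in the point (`x`, `y`), in
the rearrangement of the source (`ρ₁`, `ρ₂`) and in the density (`h₁`, `h₂`), each by `δ`. Both
kernels are replaced by their regularisations at scale `η`, which costs `O(η)`, and those have a
Lipschitz constant `O(1 - log η)` after integration. Leaving `η` free avoids the modulus
`δ (1 - log δ)`. -/
lemma abs_integral_kern_sub_le (hν : IsNumerator ν) (hf : IsDensity f M N)
    (hh₁ : IsDensity h₁ M₁ N₁) (hh₂ : IsDensity h₂ M₁ N₁)
    (hρ₁ : MeasurePreserving ρ₁ axiMeasure axiMeasure)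
    (hρ₂ : MeasurePreserving ρ₂ axiMeasure axiMeasure) {δ : ℝ}
    (hh : ∀ᵐ q ∂axiMeasure, |h₁ q - h₂ q| ≤ δ * |f q|)
    (hρ : ∀ᵐ q ∂axiMeasure, dist (ρ₁ q) (ρ₂ q) ≤ δ) {x y : ℝ × ℝ} (hxy : dist x y ≤ δ)
    {η : ℝ} (hη : 0 < η) (hη1 : η < 1) :
    |∫ z, kern ν 0 x (ρ₁ z.1) z.2 * h₁ z.1 ∂angMeasure - ∫ z,
      kern ν 0 y (ρ₂ z.1) z.2 * h₂ z.1 ∂angMeasure|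
      ≤ (12 * Real.pi ^ 2 * M₁ + 32 * (32 * Real.pi * M₁ + 2 * Real.pi * N₁) +
        (2 * Real.pi ^ 2 * M + 2 * Real.pi * N))
        * ((1 - Real.log η) * δ + η) := by
  have hδ : 0 ≤ δ := dist_nonneg.trans hxy
  have hN : 0 ≤ N := le_trans (integral_nonneg fun _ => abs_nonneg _) hf.integral_le
  have hN₁ : 0 ≤ N₁ := le_trans (integral_nonneg fun _ => abs_nonneg _) hh₁.integral_le
  have hM := hf.nonneg
  have hM₁ := hh₁.nonneg
  have hpi := Real.pi_pos
  have hlog : 1 ≤ 1 - Real.log η := by linarith [Real.log_neg hη hη1]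
  rw [← integral_sub (integrable_kern_mul hν hh₁ hρ₁ _ _) (integrable_kern_mul hν hh₂ hρ₂ _ _)]
  have i1 := (integrable_density_two hh₁ hρ₁ x hη).const_mul 3
  have i2 := (integrable_density_two hh₂ hρ₂ y hη).const_mul 3
  have i3 := (integrable_density_cube hh₁ hρ₁ x hη).const_mul (16 * δ)
  have i4 := (integrable_density_cube hh₁ hρ₂ y hη).const_mul (16 * δ)
  have i5 := (integrable_density_inv hf hρ₂ y).const_mul δ
  rw [← Real.norm_eq_abs]
  refine (norm_integral_le_of_norm_le ((((i1.add i2).add i3).add i4).add i5) ?_).trans ?_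
  · filter_upwards [ae_ang_fst hh, ae_ang_fst hρ] with z hz1 hz2
    simp only [Pi.add_apply]
    set A := kern ν 0 x (ρ₁ z.1) z.2
    set A' := kern ν η x (ρ₁ z.1) z.2
    set B := kern ν 0 y (ρ₂ z.1) z.2
    set B' := kern ν η y (ρ₂ z.1) z.2
    have b1 : |A - A'| ≤ _ := abs_kern_sub_reg_le hν hη x (ρ₁ z.1) z.2
    have b2 : |B - B'| ≤ _ := abs_kern_sub_reg_le hν hη y (ρ₂ z.1) z.2
    have b3 : |A' - B'| ≤ _ := abs_kern_sub_le hν hη x (ρ₁ z.1) y (ρ₂ z.1) z.2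
    have b4 : |B'| ≤ _ := abs_kern_le hν η y (ρ₂ z.1) z.2
    -- regularise both kernels, compare the regularised kernels, then compare the densities
    have e : A * h₁ z.1 - B * h₂ z.1 = (A - A') * h₁ z.1 - (B - B') * h₂ z.1 + (A' - B') * h₁ z.1
      + B' * (h₁ z.1 - h₂ z.1) := by ring
    rw [e, Real.norm_eq_abs]
    refine (abs_add_le _ _).trans (add_le_add ((abs_add_le _ _).trans ?_) ?_)
    · rw [add_assoc]
      refine add_le_add ((abs_sub _ _).trans (add_le_add ?_ ?_)) ?_
      · rw [abs_mul, mul_comm, mul_left_comm]; gcongr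
      · rw [abs_mul, mul_comm, mul_left_comm]; gcongr
      · rw [abs_mul, ← mul_add, ← mul_add, mul_comm, mul_left_comm]
        gcongr
        refine b3.trans (mul_le_mul_of_nonneg_right (by linarith) (by positivity))
    · rw [abs_mul]
      have hd := distSq_nonneg y (ρ₂ z.1) z.2
      calc _ ≤ (1 / distSq y (ρ₂ z.1) z.2) * (δ * |f z.1|) := by gcongr
        _ = _ := by ring
  have s1 := integral_density_two_le hh₁ hρ₁ x hη
  have s2 := integral_density_two_le hh₂ hρ₂ y hη
  have s3 := integral_density_cube_le hh₁ hρ₁ x hη hη1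
  have s4 := integral_density_cube_le hh₁ hρ₂ y hη hη1
  have s5 := integral_density_inv_le hf hρ₂ y
  rw [integral_add' (((i1.add i2).add i3).add i4) i5, integral_add' ((i1.add i2).add i3) i4,
    integral_add' (i1.add i2) i3,
    integral_add' i1 i2, integral_const_mul, integral_const_mul, integral_const_mul,
      integral_const_mul, integral_const_mul]
  have t3 := mul_le_mul_of_nonneg_left s3 (by positivity : 0 ≤ 16 * δ)
  have t4 := mul_le_mul_of_nonneg_left s4 (by positivity : 0 ≤ 16 * δ)
  have t5 := mul_le_mul_of_nonneg_left s5 hδ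
  generalize 1 - Real.log η = L at *
  set K := 32 * Real.pi * M₁ + 2 * Real.pi * N₁ with hK
  have hK0 : 0 ≤ K := by positivity
  set J := 2 * Real.pi ^ 2 * M + 2 * Real.pi * N with hJ
  have hJ0 : 0 ≤ J := by positivity
  set I := Real.pi ^ 2 * M₁ with hI
  have hI0 : 0 ≤ I := by positivity
  have hL0 : 0 ≤ L := by linarith
  have u1 : 0 ≤ I * (L * δ) := by positivity
  have u2 : 0 ≤ K * η := by positivity
  have u3 : 0 ≤ J * η := by positivity
  have u4 : J * δ ≤ J * (L * δ) := by
    gcongr; nlinarith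
  nlinarith

/-- The velocity is log-Lipschitz. -/
lemma abs_vel_sub_le (hν : IsNumerator ν) (hf : IsDensity f M N) {x y : ℝ × ℝ}
    {η : ℝ} (hη : 0 < η) (hη1 : η < 1) :
    |vel ν 0 f x - vel ν 0 f y| ≤
      (12 * Real.pi ^ 2 * M + 32 * (32 * Real.pi * M + 2 * Real.pi * N) +
      (2 * Real.pi ^ 2 * M + 2 * Real.pi * N))
        * ((1 - Real.log η) * dist x y + η) := by
  have h := abs_integral_kern_sub_le hν hf hf hf (MeasurePreserving.id _) (MeasurePreserving.id _)
    (δ := dist x y) (Filter.Eventually.of_forall fun q => by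
      simp only [sub_self, abs_zero]; positivity) (Filter.Eventually.of_forall fun q => by
      simp only [id, dist_self]; positivity) le_rfl hη hη1
  unfold vel
  rw [← mul_sub, abs_mul, abs_of_pos (by positivity)]
  have h1 : 1 / (4 * Real.pi) ≤ 1 := by
    rw [div_le_one (by positivity)]; linarith [Real.pi_gt_three]
  exact (mul_le_of_le_one_left (abs_nonneg _) h1).trans h

lemma continuous_vel (hν : IsNumerator ν) (hf : IsDensity f M N) : Continuous (vel ν 0 f) := by
  rw [Metric.continuous_iff]
  intro y e he
  have hN : 0 ≤ N := le_trans (integral_nonneg fun _ => abs_nonneg _) hf.integral_le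
  have hM := hf.nonneg
  have hpi := Real.pi_pos
  set C := 12 * Real.pi ^ 2 * M + 32 * (32 * Real.pi * M + 2 * Real.pi * N) +
    (2 * Real.pi ^ 2 * M + 2 * Real.pi * N) + 1 with hC
  have hC0 : 0 < C := by positivity
  set η := min (1 / 2) (e / (4 * C)) with hη
  have h0 : 0 < η := by positivity
  have h1 : η < 1 := lt_of_le_of_lt (min_le_left _ _) (by norm_num)
  have h2 : C * η ≤ e / 4 := by
    calc C * η ≤ C * (e / (4 * C)) := by gcongr; exact min_le_right _ _
      _ = e / 4 := by field_simp
  have hL : 0 < 1 - Real.log η := by linarith [Real.log_neg h0 h1]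
  refine ⟨e / (4 * (C * (1 - Real.log η))), by positivity, fun x hx => ?_⟩
  rw [Real.dist_eq]
  have h3 := abs_vel_sub_le hν hf (x := x) (y := y) h0 h1
  have h4 : C * (1 - Real.log η) * dist x y ≤ e / 4 := by
    calc _ ≤ C * (1 - Real.log η) * (e / (4 * (C * (1 - Real.log η)))) := by gcongr
      _ = _ := by field_simp
  have h5 : 0 ≤ ((1 - Real.log η) * dist x y + η) := by positivity
  have h6 : |vel ν 0 f x - vel ν 0 f y| ≤ C * ((1 - Real.log η) * dist x y + η) := by
    refine h3.trans ?_
    exact mul_le_mul_of_nonneg_right (by linarith) h5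
  nlinarith

end

/-! ### Osgood's uniqueness argument -/

/-- Osgood's lemma on a time interval of length `1 / (4 C)`. For fixed `η`, iterating the integral
inequality reduces any a priori bound `B` to `O(η) exp(2 C (1 - log η) (t - a))`. On so short an
interval the exponential is at most `O(η ^ (-1 / 2))`, and `η → 0` gives zero. -/
lemma osgood_step {ι E : Type*} [NormedAddCommGroup E] [NormedSpace ℝ E] {γ γ' : ι → ℝ → E}
    {a b C B : ℝ} (hC : 0 < C) (hB0 : 0 ≤ B) (hab : b ≤ a + 1 / (4 * C)) (h0 : ∀ i, γ i a = 0)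
    (hc : ∀ i, ContinuousOn (γ i) (Icc a b))
    (hd : ∀ i, ∀ t ∈ Ico a b, HasDerivWithinAt (γ i) (γ' i t) (Ici t) t)
    (hB : ∀ i, ∀ t ∈ Icc a b, ‖γ i t‖ ≤ B)
    (hbd : ∀ t ∈ Ico a b, ∀ δ, 0 ≤ δ → (∀ i, ‖γ i t‖ ≤ δ) → ∀ η, 0 < η → η < 1 → ∀ i,
      ‖γ' i t‖ ≤ C * ((1 - Real.log η) * δ + η)) :
    ∀ i, ∀ t ∈ Icc a b, γ i t = 0 := by
  have step : ∀ η, 0 < η → η < 1 → ∀ n : ℕ, ∀ i, ∀ t ∈ Icc a b,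
      ‖γ i t‖ ≤ (B / 2 ^ n + η / 2) * Real.exp (2 * C * (1 - Real.log η) * (t - a)) := by
    intro η hη hη1 n
    have hL : 0 < 1 - Real.log η := by linarith [Real.log_neg hη hη1]
    set L := 1 - Real.log η with hLdef
    induction n with
    | zero =>
      intro i t ht
      have h1 : 1 ≤ Real.exp (2 * C * L * (t - a)) :=
        Real.one_le_exp (mul_nonneg (by positivity) (by linarith [ht.1]))
      calc ‖γ i t‖ ≤ B := hB i t ht
        _ ≤ (B / 2 ^ 0 + η / 2) * 1 := by simp; linarith
        _ ≤ _ := by gcongr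
    | succ n ih =>
      intro i t ht
      set K := B / 2 ^ n + η / 2 with hK
      have hK0 : 0 ≤ K := by positivity
      have hder : ∀ s, HasDerivAt (fun s => K / 2 * Real.exp (2 * C * L * (s - a)) +
          C * η * (s - a) - K / 2)
          (C * (L * (K * Real.exp (2 * C * L * (s - a))) + η)) s := by
        intro s
        have h1 : HasDerivAt (fun s => 2 * C * L * (s - a)) (2 * C * L) s := by
          simpa using ((hasDerivAt_id s).sub_const a).const_mul (2 * C * L)
        have h2 : HasDerivAt (fun s => C * η * (s - a)) (C * η) s := by
          simpa using ((hasDerivAt_id s).sub_const a).const_mul (C * η)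
        refine (((h1.exp.const_mul (K / 2)).add h2).sub_const (K / 2)).congr_deriv ?_
        ring
      have h := image_norm_le_of_norm_deriv_right_le_deriv_boundary (hc i) (hd i)
          (by simp [h0 i]) hder
        (fun s hs => hbd s hs _ (by positivity) (fun j =>
        ih j s (Ico_subset_Icc_self hs)) η hη hη1 i) ht
      refine h.trans ?_
      have h1 : 1 ≤ Real.exp (2 * C * L * (t - a)) :=
        Real.one_le_exp (mul_nonneg (by positivity) (by linarith [ht.1]))
      have h2 : C * η * (t - a) ≤ η / 4 := by
        calc _ ≤ C * η * (1 / (4 * C)) := by gcongr; linarith [ht.2]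
          _ = _ := by field_simp
      have h3 : B / 2 ^ (n + 1) = B / 2 ^ n / 2 := by rw [pow_succ]; field_simp
      rw [h3]
      have e : B / 2 ^ n / 2 + η / 2 = K / 2 + η / 4 := by rw [hK]; ring
      rw [e]
      nlinarith
  intro i t ht
  have lim1 : ∀ η, 0 < η → η < 1 → ‖γ i t‖ ≤ η / 2 * Real.exp
      (2 * C * (1 - Real.log η) * (t - a)) := by
    intro η hη hη1
    have h1 : Filter.Tendsto (fun n : ℕ => (B / 2 ^ n + η / 2) * Real.exp
        (2 * C * (1 - Real.log η) * (t - a)))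
        Filter.atTop (nhds ((0 + η / 2) * Real.exp (2 * C * (1 - Real.log η) * (t - a)))) := by
      refine ((Filter.Tendsto.add_const _ ?_).mul_const _)
      exact tendsto_const_nhds.div_atTop (tendsto_pow_atTop_atTop_of_one_lt (by norm_num))
    have := ge_of_tendsto' h1 (fun n => step η hη hη1 n i t ht)
    rwa [zero_add] at this
  -- with `η = s ^ 2` the bound is linear in `s`
  have lim2 : ∀ s, 0 < s → s < 1 → ‖γ i t‖ ≤ s * (Real.exp (1 / 2) / 2) := by
    intro s hs hs1
    refine (lim1 (s ^ 2) (by positivity) (by nlinarith)).trans ?_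
    have hl : Real.log s < 0 := Real.log_neg hs hs1
    have e1 : 2 * C * (1 - Real.log (s ^ 2)) * (t - a) ≤ 1 / 2 - Real.log s := by
      rw [Real.log_pow]; push_cast
      calc _ ≤ 2 * C * (1 - 2 * Real.log s) * (1 / (4 * C)) := by
            have : 0 ≤ 1 - 2 * Real.log s := by linarith
            gcongr; linarith [ht.2]
        _ = _ := by field_simp; ring
    calc _ ≤ s ^ 2 / 2 * Real.exp (1 / 2 - Real.log s) := by gcongr
      _ = _ := by rw [Real.exp_sub, Real.exp_log hs]; field_simp
  have lim3 : ‖γ i t‖ ≤ 0 := by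
    refine le_of_forall_pos_le_add fun e he => ?_
    have hE := Real.exp_pos (1 / 2)
    have := lim2 (min (1 / 2) (e / (Real.exp (1 / 2) / 2))) (by positivity)
        (lt_of_le_of_lt (min_le_left _ _) (by norm_num))
    rw [zero_add]
    refine this.trans ?_
    calc _ ≤ e / (Real.exp (1 / 2) / 2) * (Real.exp (1 / 2) / 2) := by
          gcongr; exact min_le_right _ _
      _ = e := by field_simp
  simpa using lim3

/-- Osgood's lemma for a family of curves that is controlled through its supremum, the modulus of
continuity being that of a log-Lipschitz field. The supremum enters only through upper bounds `δ`,
so that it need not be measurable or attained. -/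
lemma osgood {ι E : Type*} [NormedAddCommGroup E] [NormedSpace ℝ E] {γ γ' : ι → ℝ → E}
    {T C B : ℝ} (hC : 0 < C) (hB0 : 0 ≤ B) (h0 : ∀ i, γ i 0 = 0)
    (hc : ∀ i, ContinuousOn (γ i) (Icc 0 T))
    (hd : ∀ i, ∀ t ∈ Ico 0 T, HasDerivWithinAt (γ i) (γ' i t) (Ici t) t)
    (hB : ∀ i, ∀ t ∈ Icc 0 T, ‖γ i t‖ ≤ B)
    (hbd : ∀ t ∈ Ico 0 T, ∀ δ, 0 ≤ δ → (∀ i, ‖γ i t‖ ≤ δ) → ∀ η, 0 < η → η < 1 → ∀ i,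
      ‖γ' i t‖ ≤ C * ((1 - Real.log η) * δ + η)) :
    ∀ i, ∀ t ∈ Icc 0 T, γ i t = 0 := by
  have step : ∀ n : ℕ, ∀ i, ∀ t ∈ Icc 0 T, t ≤ n * (1 / (4 * C)) → γ i t = 0 := by
    intro n
    induction n with
    | zero =>
      intro i t ht h
      have : t = 0 := le_antisymm (by simpa using h) ht.1
      rw [this, h0]
    | succ n ih =>
      intro i t ht h
      by_cases hn : t ≤ n * (1 / (4 * C))
      · exact ih i t ht hn
      · push Not at hn
        have ha0 : 0 ≤ (n:ℝ) * (1 / (4 * C)) := by positivity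
        have sub : Icc ((n:ℝ) * (1 / (4 * C))) t ⊆ Icc 0 T := Icc_subset_Icc ha0 ht.2
        have sub' : Ico ((n:ℝ) * (1 / (4 * C))) t ⊆ Ico 0 T := Ico_subset_Ico ha0 ht.2
        refine osgood_step (a := n * (1 / (4 * C))) (b := t) hC hB0 ?_ (fun j => ?_)
          (fun j => (hc j).mono sub) (fun j s hs => hd j s (sub' hs))
          (fun j s hs => hB j s (sub hs))
          (fun s hs => hbd s (sub' hs)) i t ⟨hn.le, le_rfl⟩
        · push_cast at h; linarith
        · exact ih j _ ⟨ha0, hn.le.trans ht.2⟩ le_rfl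
  intro i t ht
  obtain ⟨n, hn⟩ := exists_nat_ge (t / (1 / (4 * C)))
  exact step n i t ht (by rwa [div_le_iff₀ (by positivity)] at hn)

/-! ### Transported vorticity and uniqueness of the flow -/

lemma ae_of_ae_comp {ρ : ℝ × ℝ → ℝ × ℝ} (hρ : MeasurePreserving ρ axiMeasure axiMeasure)
    {s : Set (ℝ × ℝ)} (hs : NullMeasurableSet s axiMeasure) (h : ∀ᵐ q ∂axiMeasure, ρ q ∈ s) :
    ∀ᵐ q ∂axiMeasure, q ∈ s := by
  rw [ae_iff] at h ⊢
  have : {a | a ∉ s} = sᶜ := rfl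
  rw [this, ← hρ.measure_preimage hs.compl]
  exact h

lemma integral_comp_axi {ρ : ℝ × ℝ → ℝ × ℝ} (hρ : MeasurePreserving ρ axiMeasure axiMeasure)
    {f : ℝ × ℝ → ℝ} (hf : AEStronglyMeasurable f axiMeasure) :
    ∫ q, f (ρ q) ∂axiMeasure = ∫ q, f q ∂axiMeasure := by
  have := integral_map hρ.measurable.aemeasurable (μ := axiMeasure) (f := f) (by rwa [hρ.map_eq])
  rw [hρ.map_eq] at this
  exact this.symm

/-- Density bounds pass through a volume preserving change of variables. -/
lemma IsDensity.of_comp {ρ : ℝ × ℝ → ℝ × ℝ} (hρ : MeasurePreserving ρ axiMeasure axiMeasure)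
    {f g : ℝ × ℝ → ℝ} {M N : ℝ} (hf : Integrable f axiMeasure) (hg : IsDensity g M N)
    (h : ∀ᵐ q ∂axiMeasure, |f (ρ q)| ≤ |g q|) : IsDensity f M N where
  integrable := hf
  nonneg := hg.nonneg
  ae_le := by
    refine ae_of_ae_comp hρ (s := {q | |f q| ≤ M}) ?_ ?_
    · exact nullMeasurableSet_le hf.abs.aestronglyMeasurable.aemeasurable aemeasurable_const
    · filter_upwards [h, hg.ae_le] with q h1 h2 using h1.trans h2
  integral_le := by
    rw [← integral_comp_axi hρ hf.abs.aestronglyMeasurable]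
    refine le_trans (integral_mono_ae ?_ hg.integrable.abs h) hg.integral_le
    exact hρ.integrable_comp_of_integrable hf.abs

lemma IsDensity.mono {f g : ℝ × ℝ → ℝ} {M N : ℝ} (hg : IsDensity g M N)
    (hf : AEStronglyMeasurable f axiMeasure) (h : ∀ᵐ q ∂axiMeasure, |f q| ≤ |g q|) :
    IsDensity f M N :=
  IsDensity.of_comp (MeasurePreserving.id _) (hg.integrable.mono hf h) hg h

lemma IsDensity.const_mul {g : ℝ × ℝ → ℝ} {M N c : ℝ} (hg : IsDensity g M N) (hc : 0 ≤ c) :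
    IsDensity (fun q => c * g q) (c * M) (c * N) where
  integrable := hg.integrable.const_mul c
  nonneg := mul_nonneg hc hg.nonneg
  ae_le := by
    filter_upwards [hg.ae_le] with q hq
    rw [abs_mul, abs_of_nonneg hc]; gcongr
  integral_le := by
    simp only [abs_mul, abs_of_nonneg hc, integral_const_mul]
    exact mul_le_mul_of_nonneg_left hg.integral_le hc

lemma IsDensity.weaken {g : ℝ × ℝ → ℝ} {M N M' N' : ℝ} (hg : IsDensity g M N) (hM : M ≤ M')
    (hN : N ≤ N') : IsDensity g M' N' :=
  ⟨hg.integrable, hg.nonneg.trans hM, hg.ae_le.mono fun _ h => h.trans hM, hg.integral_le.trans hN⟩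

lemma isDensity_of_memLp {f : ℝ × ℝ → ℝ} (h1 : MemLp f 1 axiMeasure) (h2 : MemLp f ⊤ axiMeasure) :
    IsDensity f (eLpNorm f ⊤ axiMeasure).toReal (∫ q, |f q| ∂axiMeasure) where
  integrable := memLp_one_iff_integrable.1 h1
  nonneg := ENNReal.toReal_nonneg
  ae_le := by
    have h := ae_le_eLpNormEssSup (f := f) (μ := axiMeasure)
    rw [← eLpNorm_exponent_top] at h
    filter_upwards [h] with q hq
    rw [← Real.norm_eq_abs, ← toReal_enorm]
    exact ENNReal.toReal_mono h2.2.ne hq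
  integral_le := le_rfl

/-- A solution together with a chosen flow: `IsSolution ω` says that this holds for some `Φ`. -/
structure IsTransported (ω : ℝ → ℝ × ℝ → ℝ) (Φ : ℝ → ℝ × ℝ → ℝ × ℝ) : Prop where
  inClass : ∀ t, 0 ≤ t → InClass (ω t)
  flow : IsFlow (fun t => velR (ω t)) (fun t => velZ (ω t)) Φ
  transported : ∀ t, 0 ≤ t → ∀ᵐ p ∂axiMeasure, ω t (Φ t p) / (Φ t p).1 = ω 0 p / p.1

lemma ae_mem_halfPlane : ∀ᵐ q ∂axiMeasure, q ∈ halfPlane := ae_axi_pos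

section
variable {ω : ℝ → ℝ × ℝ → ℝ} {Φ : ℝ → ℝ × ℝ → ℝ × ℝ}

lemma InClass.isDensity {w : ℝ × ℝ → ℝ} (h : InClass w) :
    IsDensity w (eLpNorm w ⊤ axiMeasure).toReal (∫ q, |w q| ∂axiMeasure) :=
  isDensity_of_memLp h.memLp_one h.memLp_top

lemma InClass.isDensity_div {w : ℝ × ℝ → ℝ} (h : InClass w) :
    IsDensity (fun q => w q / q.1) (relSup w) (∫ q, |w q / q.1| ∂axiMeasure) :=
  isDensity_of_memLp h.memLp_div_one h.memLp_div_top

lemma IsTransported.isDensity_div (h : IsTransported ω Φ) {t : ℝ} (ht : 0 ≤ t) :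
    IsDensity (fun q => ω t q / q.1) (relSup (ω 0)) (∫ q, |ω 0 q / q.1| ∂axiMeasure) := by
  refine IsDensity.of_comp (h.flow.volume_preserving t ht)
    (memLp_one_iff_integrable.1 (h.inClass t ht).memLp_div_one)
    (h.inClass 0 le_rfl).isDensity_div ?_
  filter_upwards [h.transported t ht] with q hq
  rw [hq]

/-- The exponential rate at which trajectories can move away from the axis. -/
def growthRate (w : ℝ × ℝ → ℝ) : ℝ :=
  2 * Real.pi ^ 2 * relSup w + 2 * Real.pi * ∫ q, |w q / q.1| ∂axiMeasure

lemma IsTransported.continuousOn (h : IsTransported ω Φ) {p : ℝ × ℝ} (hp : p ∈ halfPlane) :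
    ContinuousOn (fun t => Φ t p) (Ici 0) :=
  fun t ht => (h.flow.ode t ht p hp).continuousWithinAt

/-- Grönwall's inequality for the distance to the axis, from `|u_r| ≤ C r`. -/
lemma IsTransported.fst_le (h : IsTransported ω Φ) {t : ℝ} (ht : 0 ≤ t) {p : ℝ × ℝ}
    (hp : p ∈ halfPlane) : (Φ t p).1 ≤ Real.exp (growthRate (ω 0) * t) * p.1 := by
  have hg := norm_le_gronwallBound_of_norm_deriv_right_le (f := fun s => (Φ s p).1)
    (f' := fun s => velR (ω s) (Φ s p)) (δ := p.1) (K := growthRate (ω 0)) (ε := 0) (a := 0)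
    (b := t)
    ?_ ?_ ?_ ?_ t ⟨ht, le_rfl⟩
  · rw [gronwallBound_ε0, sub_zero, Real.norm_eq_abs] at hg
    rw [mul_comm]
    exact (le_abs_self _).trans hg
  · exact ((h.continuousOn hp).mono Icc_subset_Ici_self).fst
  · intro s hs
    have := (h.flow.ode s hs.1 p hp).mono (Ici_subset_Ici.2 hs.1)
    exact this.fst
  · rw [h.flow.initial p hp, Real.norm_eq_abs, abs_of_pos hp]
  · intro s hs
    have hpos : 0 < (Φ s p).1 := h.flow.maps_to s hs.1 p hp
    rw [add_zero, Real.norm_eq_abs, Real.norm_eq_abs, abs_of_pos hpos,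
      velR_eq_vel (h.inClass s hs.1).isDensity]
    exact abs_vel_numR_le' (h.inClass s hs.1).isDensity (h.isDensity_div hs.1) hpos.le 0

lemma growthRate_nonneg (w : ℝ × ℝ → ℝ) : 0 ≤ growthRate w := by
  unfold growthRate relSup
  have : 0 ≤ ∫ q, |w q / q.1| ∂axiMeasure := integral_nonneg fun _ => abs_nonneg _
  positivity

/-- Bounds that are uniform on compact time intervals, for the vorticity and for its pull-back
under the flow. Since `ω / r` is transported, the vorticity grows at most like the distance to the
axis. -/
lemma IsTransported.isDensity_lagrangian (h : IsTransported ω Φ) (T : ℝ) :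
    ∃ M N : ℝ, ∀ t, 0 ≤ t → t ≤ T → IsDensity (ω t) M N ∧
      IsDensity (fun q => (Φ t q).1 * (ω 0 q / q.1)) M N := by
  have h0 := (h.inClass 0 le_rfl).isDensity.const_mul (Real.exp_pos (growthRate (ω 0) * T)).le
  refine ⟨Real.exp (growthRate (ω 0) * T) * (eLpNorm (ω 0) ⊤ axiMeasure).toReal,
    Real.exp (growthRate (ω 0) * T) * ∫ q, |ω 0 q| ∂axiMeasure, fun t ht htT => ?_⟩
  have hle : ∀ᵐ q ∂axiMeasure, |(Φ t q).1 * (ω 0 q / q.1)| ≤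
      |Real.exp (growthRate (ω 0) * T) * ω 0 q| := by
    filter_upwards [ae_mem_halfPlane] with q hq
    have hq' : 0 < q.1 := hq
    have h1 : 0 < (Φ t q).1 := h.flow.maps_to t ht q hq
    have h2 := h.fst_le ht hq
    have h3 : Real.exp (growthRate (ω 0) * t) ≤ Real.exp (growthRate (ω 0) * T) := by
      have := growthRate_nonneg (ω 0)
      gcongr
    have h4 : (Φ t q).1 ≤ Real.exp (growthRate (ω 0) * T) * q.1 := h2.trans (by gcongr)
    rw [abs_mul, abs_mul, abs_of_pos h1, abs_of_pos (Real.exp_pos _), abs_div, abs_of_pos hq']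
    calc _ ≤ Real.exp (growthRate (ω 0) * T) * q.1 * (|ω 0 q| / q.1) := by gcongr
      _ = _ := by field_simp
  constructor
  · refine IsDensity.of_comp (h.flow.volume_preserving t ht)
      (memLp_one_iff_integrable.1 (h.inClass t ht).memLp_one) h0 ?_
    filter_upwards [hle, h.transported t ht, ae_mem_halfPlane] with q hq h1 hq'
    rw [← h1] at hq
    have h1 : 0 < (Φ t q).1 := h.flow.maps_to t ht q hq'
    rwa [mul_div_cancel₀ _ h1.ne'] at hq
  · refine h0.mono ?_ hle
    exact ((h.flow.volume_preserving t ht).measurable.fst.aestronglyMeasurable).mul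
      (memLp_one_iff_integrable.1 (h.inClass 0 le_rfl).memLp_div_one).aestronglyMeasurable

/-- The velocity in Lagrangian variables. -/
lemma IsTransported.vel_eq (h : IsTransported ω Φ) {ν : ℝ × ℝ → ℝ × ℝ → ℝ → ℝ} (hν : IsNumerator ν)
    {t : ℝ} (ht : 0 ≤ t) (p : ℝ × ℝ) :
    vel ν 0 (ω t) p = (1 / (4 * Real.pi)) *
      ∫ x, kern ν 0 p (Φ t x.1) x.2 * ((Φ t x.1).1 * (ω 0 x.1 / x.1.1)) ∂angMeasure := by
  unfold vel
  have hmp := measurePreserving_ang (h.flow.volume_preserving t ht)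
  have hi := integrable_kern hν (h.inClass t ht).isDensity 0 p
  have := integral_map hmp.measurable.aemeasurable (μ := angMeasure)
    (f := fun x : (ℝ × ℝ) × ℝ => kern ν 0 p x.1 x.2 * ω t x.1) (by
      rw [hmp.map_eq]; exact hi.aestronglyMeasurable)
  rw [hmp.map_eq] at this
  rw [this]
  congr 1
  refine integral_congr_ae ?_
  filter_upwards [ae_ang_fst (h.transported t ht), ae_ang_fst ae_mem_halfPlane] with x h1 hq
  have h2 : 0 < (Φ t x.1).1 := h.flow.maps_to t ht _ hq
  rw [← h1, mul_div_cancel₀ _ h2.ne']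

end

lemma dist_le_of_norm {p q : ℝ × ℝ} {δ : ℝ} (h : ‖p - q‖ ≤ δ) : dist p q ≤ δ := by
  rwa [dist_eq_norm]

/-- Two solutions with the same initial vorticity have the same flow. The difference of the flows is
controlled through its supremum over all starting points, because the velocities are integrals over
all trajectories. -/
theorem IsTransported.flow_unique {ω₁ ω₂ : ℝ → ℝ × ℝ → ℝ} {Φ₁ Φ₂ : ℝ → ℝ × ℝ → ℝ × ℝ}
    (h₁ : IsTransported ω₁ Φ₁) (h₂ : IsTransported ω₂ Φ₂) (h : ω₁ 0 =ᵐ[axiMeasure] ω₂ 0)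
    {t : ℝ} (ht : 0 ≤ t) {p : ℝ × ℝ} (hp : p ∈ halfPlane) : Φ₁ t p = Φ₂ t p := by
  obtain ⟨M₁, N₁, hM₁⟩ := h₁.isDensity_lagrangian t
  obtain ⟨M₂, N₂, hM₂⟩ := h₂.isDensity_lagrangian t
  set M' := max M₁ M₂
  set N' := max N₁ N₂
  have hw1 : ∀ s, 0 ≤ s → s ≤ t → IsDensity (ω₁ s) M' N' ∧
      IsDensity (fun q => (Φ₁ s q).1 * (ω₁ 0 q / q.1)) M' N' := fun s hs hst =>
    ⟨(hM₁ s hs hst).1.weaken (le_max_left _ _) (le_max_left _ _),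
      (hM₁ s hs hst).2.weaken (le_max_left _ _) (le_max_left _ _)⟩
  have hw2 : ∀ s, 0 ≤ s → s ≤ t → IsDensity (ω₂ s) M' N' ∧
      IsDensity (fun q => (Φ₂ s q).1 * (ω₂ 0 q / q.1)) M' N' := fun s hs hst =>
    ⟨(hM₂ s hs hst).1.weaken (le_max_right _ _) (le_max_right _ _),
      (hM₂ s hs hst).2.weaken (le_max_right _ _) (le_max_right _ _)⟩
  have hf := (h₁.inClass 0 le_rfl).isDensity_div
  set M := relSup (ω₁ 0)
  set N := ∫ q, |ω₁ 0 q / q.1| ∂axiMeasure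
  have hN : 0 ≤ N := le_trans (integral_nonneg fun _ => abs_nonneg _) hf.integral_le
  have hM0 := hf.nonneg
  have hM'0 : 0 ≤ M' := (hw1 0 le_rfl ht).1.nonneg
  have hN'0 : 0 ≤ N' := le_trans (integral_nonneg fun _ => abs_nonneg _)
      (hw1 0 le_rfl ht).1.integral_le
  have hpi := Real.pi_pos
  set C := 12 * Real.pi ^ 2 * M' + 32 * (32 * Real.pi * M' + 2 * Real.pi * N') +
    (2 * Real.pi ^ 2 * M + 2 * Real.pi * N) + 1 with hC
  have hC0 : 0 < C := by positivity
  set V := Real.pi * M' + N' with hV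
  have hV0 : 0 ≤ V := by positivity
  -- the velocities, taken along the two flows, differ by the log-Lipschitz modulus of the distance
  -- of the flows
  have key : ∀ ν, IsNumerator ν → ∀ s, 0 ≤ s → s ≤ t → ∀ δ, 0 ≤ δ →
      (∀ q ∈ halfPlane, ‖Φ₁ s q - Φ₂ s q‖ ≤ δ) →
      ∀ η, 0 < η → η < 1 → ∀ q ∈ halfPlane,
      |vel ν 0 (ω₁ s) (Φ₁ s q) - vel ν 0 (ω₂ s) (Φ₂ s q)| ≤ C * ((1 - Real.log η) * δ + η) := by
    intro ν hν s hs hst δ hδ hle η hη hη1 q hq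
    rw [h₁.vel_eq hν hs, h₂.vel_eq hν hs, ← mul_sub, abs_mul, abs_of_pos (by positivity)]
    have e1 : 1 / (4 * Real.pi) ≤ 1 := by
      rw [div_le_one (by positivity)]; linarith [Real.pi_gt_three]
    refine (mul_le_of_le_one_left (abs_nonneg _) e1).trans ?_
    refine (abs_integral_kern_sub_le hν hf (hw1 s hs hst).2 (hw2 s hs hst).2
      (h₁.flow.volume_preserving s hs) (h₂.flow.volume_preserving s hs) (δ := δ) ?_ ?_
      (dist_le_of_norm (hle q hq)) hη hη1).trans ?_
    · filter_upwards [h, ae_mem_halfPlane] with x hx hxp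
      rw [← hx, ← sub_mul, abs_mul]
      gcongr
      exact (norm_fst_le (Φ₁ s x - Φ₂ s x)).trans (hle x hxp)
    · filter_upwards [ae_mem_halfPlane] with x hxp
      exact dist_le_of_norm (hle x hxp)
    · have hL : 0 < 1 - Real.log η := by linarith [Real.log_neg hη hη1]
      exact mul_le_mul_of_nonneg_right (by linarith) (by positivity)
  have hder : ∀ q : halfPlane, ∀ s, 0 ≤ s → HasDerivWithinAt (fun s => Φ₁ s q - Φ₂ s q)
      ((velR (ω₁ s) (Φ₁ s q), velZ (ω₁ s) (Φ₁ s q)) - (velR (ω₂ s) (Φ₂ s q), velZ (ω₂ s) (Φ₂ s q)))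
      (Ici 0) s :=
    fun q s hs => (h₁.flow.ode s hs q q.2).sub (h₂.flow.ode s hs q q.2)
  have hcont : ∀ q : halfPlane, ContinuousOn (fun s => Φ₁ s q - Φ₂ s q) (Icc 0 t) := fun q =>
    ((h₁.continuousOn q.2).sub (h₂.continuousOn q.2)).mono Icc_subset_Ici_self
  have hnorm : ∀ a b c d e : ℝ, |a - c| ≤ e → |b - d| ≤ e → ‖((a, b) : ℝ × ℝ) - (c, d)‖ ≤ e := by
    intro a b c d e h1 h2
    exact max_le h1 h2
  have hzero : ∀ q : halfPlane, Φ₁ 0 (q : ℝ × ℝ) - Φ₂ 0 q = 0 := fun q => by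
    rw [h₁.flow.initial q q.2, h₂.flow.initial q q.2, sub_self]
  have hv : ∀ (w : ℝ × ℝ → ℝ), IsDensity w M' N' → ∀ p, |velR w p| ≤ V ∧ |velZ w p| ≤ V :=
      fun w hw p => by
    rw [velR_eq_vel hw, velZ_eq_vel hw]
    exact ⟨abs_vel_le isNumerator_numR hw 0 p, abs_vel_le isNumerator_numZ hw 0 p⟩
  have hB : ∀ q : halfPlane, ∀ s ∈ Icc 0 t, ‖Φ₁ s q - Φ₂ s q‖ ≤ 2 * V * t := by
    intro q s hs
    have := norm_image_sub_le_of_norm_deriv_right_le_segment (f := fun s => Φ₁ s q - Φ₂ s q)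
        (C := 2 * V)
      (hcont q) (fun r hr => (hder q r hr.1).mono (Ici_subset_Ici.2 hr.1)) (fun r hr => by
        have a1 := hv _ (hw1 r hr.1 hr.2.le).1 (Φ₁ r q)
        have a2 := hv _ (hw2 r hr.1 hr.2.le).1 (Φ₂ r q)
        apply hnorm
        · exact (abs_sub _ _).trans (by linarith)
        · exact (abs_sub _ _).trans (by linarith)) s hs
    rw [hzero, sub_zero, sub_zero] at this
    exact this.trans (mul_le_mul_of_nonneg_left hs.2 (by positivity))
  have := osgood (ι := halfPlane) (γ := fun q s => Φ₁ s q - Φ₂ s q) (T := t) hC0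
      (by positivity) hzero hcont
    (fun q s hs => (hder q s hs.1).mono (Ici_subset_Ici.2 hs.1)) hB
    (fun s hs δ hδ hle η hη hη1 q => by
      have hle' : ∀ q ∈ halfPlane, ‖Φ₁ s q - Φ₂ s q‖ ≤ δ := fun q hq => hle ⟨q, hq⟩
      have a1 := (hw1 s hs.1 hs.2.le).1
      have a2 := (hw2 s hs.1 hs.2.le).1
      apply hnorm
      · rw [velR_eq_vel a1, velR_eq_vel a2]
        exact key _ isNumerator_numR s hs.1 hs.2.le δ hδ hle' η hη hη1 q q.2
      · rw [velZ_eq_vel a1, velZ_eq_vel a2]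
        exact key _ isNumerator_numZ s hs.1 hs.2.le δ hδ hle' η hη hη1 q q.2)
    ⟨p, hp⟩ t ⟨ht, le_rfl⟩
  exact sub_eq_zero.1 this

/-! ### Reflection symmetry -/

/-- Reflection in the plane `z = 0`. -/
def reflect (p : ℝ × ℝ) : ℝ × ℝ := (p.1, -p.2)

@[simp] lemma reflect_reflect (p : ℝ × ℝ) : reflect (reflect p) = p := by simp [reflect]
@[simp] lemma reflect_fst (p : ℝ × ℝ) : (reflect p).1 = p.1 := rfl
@[simp] lemma reflect_snd (p : ℝ × ℝ) : (reflect p).2 = -p.2 := rfl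

lemma measurable_reflect : Measurable reflect := by unfold reflect; fun_prop

lemma measurePreserving_reflect : MeasurePreserving reflect axiMeasure axiMeasure := by
  have hv : MeasurePreserving reflect (volume : Measure (ℝ × ℝ)) volume :=
    (MeasurePreserving.id (volume : Measure ℝ)).prod (Measure.measurePreserving_neg volume)
  refine ⟨measurable_reflect, Measure.ext_of_lintegral _ fun f hf => ?_⟩
  have hf' : Measurable fun q => f (reflect q) := hf.comp measurable_reflect
  rw [lintegral_map hf measurable_reflect, lintegral_axi hf', lintegral_axi hf]
  have h := hv.setLIntegral_comp_preimage measurableSet_halfPlane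
    (f := fun q => ENNReal.ofReal q.1 * f q) (by fun_prop)
  exact h

lemma kern_numR_reflect (ε : ℝ) (p q : ℝ × ℝ) (θ : ℝ) :
    kern numR ε (reflect p) (reflect q) θ = -kern numR ε p q θ := by
  simp only [kern, numR, distSq, reflect]
  rw [← neg_div]
  congr 1
  · ring
  · congr 2; ring

lemma kern_numZ_reflect (ε : ℝ) (p q : ℝ × ℝ) (θ : ℝ) :
    kern numZ ε (reflect p) (reflect q) θ = kern numZ ε p q θ := by
  simp only [kern, numZ, distSq, reflect]
  congr 3; ring

lemma vel_reflect (ν : ℝ × ℝ → ℝ × ℝ → ℝ → ℝ) (ε : ℝ) (w : ℝ × ℝ → ℝ) (p : ℝ × ℝ) :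
    vel ν ε w (reflect p) = (1 / (4 * Real.pi)) *
      ∫ x, kern ν ε (reflect p) (reflect x.1) x.2 * w (reflect x.1) ∂angMeasure := by
  unfold vel
  congr 1
  have hm := measurePreserving_ang measurePreserving_reflect
  have he : MeasurableEmbedding (fun x : (ℝ × ℝ) × ℝ => (reflect x.1, x.2)) := by
    have : Function.Involutive (fun x : (ℝ × ℝ) × ℝ => (reflect x.1, x.2)) := fun x => by simp
    exact (MeasurableEquiv.ofInvolutive _ this hm.measurable).measurableEmbedding
  exact (hm.integral_comp he (fun x : (ℝ × ℝ) × ℝ => kern ν ε (reflect p) x.1 x.2 * w x.1)).symm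

/-- The vorticity of the reflected flow; the sign comes from the vorticity being a pseudo-vector. -/
def reflectVort (w : ℝ × ℝ → ℝ) (p : ℝ × ℝ) : ℝ := -w (reflect p)

lemma vel_numR_reflectVort (ε : ℝ) (w : ℝ × ℝ → ℝ) (p : ℝ × ℝ) :
    vel numR ε (reflectVort w) p = vel numR ε w (reflect p) := by
  rw [vel_reflect]
  simp only [vel, kern_numR_reflect, reflectVort, neg_mul, mul_neg]

lemma vel_numZ_reflectVort (ε : ℝ) (w : ℝ × ℝ → ℝ) (p : ℝ × ℝ) :
    vel numZ ε (reflectVort w) p = -vel numZ ε w (reflect p) := by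
  rw [vel_reflect]
  simp only [vel, kern_numZ_reflect, reflectVort, mul_neg, integral_neg]

lemma vel_congr (ν : ℝ × ℝ → ℝ × ℝ → ℝ → ℝ) (ε : ℝ) {w w' : ℝ × ℝ → ℝ} (h : w =ᵐ[axiMeasure] w') :
    vel ν ε w = vel ν ε w' := by
  ext p
  unfold vel
  congr 1
  refine integral_congr_ae ?_
  filter_upwards [ae_ang_fst h] with x hx
  rw [hx]

/-- For odd vorticity the vertical velocity vanishes on the plane of symmetry. -/
lemma vel_numZ_axis_of_odd {w : ℝ × ℝ → ℝ} (h : ∀ᵐ p ∂axiMeasure, w (p.1, -p.2) = -w p) (ε r : ℝ) :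
    vel numZ ε w (r, 0) = 0 := by
  have h1 : reflectVort w =ᵐ[axiMeasure] w := by
    filter_upwards [h] with p hp
    simp [reflectVort, reflect, hp]
  have h2 := vel_numZ_reflectVort ε w (r, 0)
  rw [vel_congr numZ ε h1] at h2
  have : reflect (r, 0) = (r, 0) := by simp [reflect]
  rw [this] at h2
  linarith

lemma InClass.reflectVort {w : ℝ × ℝ → ℝ} (h : InClass w) : InClass (reflectVort w) := by
  have h1 : MemLp (AxiEuler.reflectVort w) 1 axiMeasure :=
      (h.memLp_one.comp_measurePreserving measurePreserving_reflect).neg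
  have h2 : MemLp (AxiEuler.reflectVort w) ⊤ axiMeasure :=
      (h.memLp_top.comp_measurePreserving measurePreserving_reflect).neg
  have hd := isDensity_of_memLp h1 h2
  have e1 : velR (AxiEuler.reflectVort w) = velR w ∘ reflect := by
    ext p
    rw [velR_eq_vel hd, vel_numR_reflectVort, Function.comp, velR_eq_vel h.isDensity]
  have e2 : velZ (AxiEuler.reflectVort w) = -(velZ w ∘ reflect) := by
    ext p
    rw [velZ_eq_vel hd, vel_numZ_reflectVort, Pi.neg_apply, Function.comp, velZ_eq_vel h.isDensity]
  have e3 : (fun p => AxiEuler.reflectVort w p / p.1) = -((fun p => w p / p.1) ∘ reflect) := by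
    ext p
    simp [AxiEuler.reflectVort, neg_div]
  refine ⟨?_, ?_, h1, h2, ?_, ?_⟩
  · rw [e1]; exact h.memLp_velR.comp_measurePreserving measurePreserving_reflect
  · rw [e2]; exact (h.memLp_velZ.comp_measurePreserving measurePreserving_reflect).neg
  · rw [e3]; exact (h.memLp_div_one.comp_measurePreserving measurePreserving_reflect).neg
  · rw [e3]; exact (h.memLp_div_top.comp_measurePreserving measurePreserving_reflect).neg

lemma reflect_mem {p : ℝ × ℝ} (hp : p ∈ halfPlane) : reflect p ∈ halfPlane := hp

section
variable {ω : ℝ → ℝ × ℝ → ℝ} {Φ : ℝ → ℝ × ℝ → ℝ × ℝ}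

lemma hasDerivWithinAt_snd {g : ℝ → ℝ × ℝ} {g' : ℝ × ℝ} {s : Set ℝ} {t : ℝ}
    (h : HasDerivWithinAt g g' s t) : HasDerivWithinAt (fun t => (g t).2) g'.2 s t := h.snd

lemma hasDerivWithinAt_fst {g : ℝ → ℝ × ℝ} {g' : ℝ × ℝ} {s : Set ℝ} {t : ℝ}
    (h : HasDerivWithinAt g g' s t) : HasDerivWithinAt (fun t => (g t).1) g'.1 s t := h.fst

/-- The reflection of a solution is a solution. -/
lemma IsTransported.reflect (h : IsTransported ω Φ) :
    IsTransported (fun t => reflectVort (ω t)) (fun t p => reflect (Φ t (reflect p))) where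
  inClass t ht := (h.inClass t ht).reflectVort
  flow :=
    { initial := fun p hp => by rw [h.flow.initial _ (reflect_mem hp), reflect_reflect]
      maps_to := fun t ht p hp => reflect_mem (h.flow.maps_to t ht _ (reflect_mem hp))
      ode := fun t ht p hp => by
        have h1 := h.flow.ode t ht _ (reflect_mem hp)
        have h2 := (hasDerivWithinAt_fst h1).prodMk (hasDerivWithinAt_snd h1).neg
        rw [velR_eq_vel (h.inClass t ht).reflectVort.isDensity,
          velZ_eq_vel (h.inClass t ht).reflectVort.isDensity,
          vel_numR_reflectVort, vel_numZ_reflectVort, reflect_reflect,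
            ← velR_eq_vel (h.inClass t ht).isDensity,
          ← velZ_eq_vel (h.inClass t ht).isDensity]
        exact h2
      volume_preserving := fun t ht =>
        (measurePreserving_reflect.comp (h.flow.volume_preserving t ht)).comp
        measurePreserving_reflect }
  transported t ht := by
    filter_upwards [measurePreserving_reflect.quasiMeasurePreserving.ae
      (h.transported t ht)] with p hp
    simp only [reflectVort, reflect_reflect, reflect_fst, neg_div]
    rw [hp, reflect_fst]

/-- By uniqueness, the flow of an odd vorticity commutes with the reflection. -/
lemma IsTransported.flow_reflect (h : IsTransported ω Φ) (hodd : IsOddNonneg (ω 0)) {t : ℝ}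
    (ht : 0 ≤ t)
    {p : ℝ × ℝ} (hp : p ∈ halfPlane) : Φ t (AxiEuler.reflect p) = AxiEuler.reflect (Φ t p) := by
  have h1 : ω 0 =ᵐ[axiMeasure] reflectVort (ω 0) := by
    filter_upwards [hodd.odd] with q hq
    simp [reflectVort, AxiEuler.reflect, hq]
  have := h.flow_unique h.reflect h1 ht hp
  rw [this, reflect_reflect]

lemma IsTransported.odd (h : IsTransported ω Φ) (hodd : IsOddNonneg (ω 0)) {t : ℝ} (ht : 0 ≤ t) :
    ∀ᵐ p ∂axiMeasure, ω t (p.1, -p.2) = -ω t p := by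
  have hm : AEMeasurable (ω t) axiMeasure :=
      (h.inClass t ht).memLp_one.aestronglyMeasurable.aemeasurable
  refine ae_of_ae_comp (h.flow.volume_preserving t ht) (s := {p | ω t (p.1, -p.2) = -ω t p}) ?_ ?_
  · exact nullMeasurableSet_eq_fun
      (hm.comp_quasiMeasurePreserving measurePreserving_reflect.quasiMeasurePreserving) hm.neg
  · filter_upwards [h.transported t ht, measurePreserving_reflect.quasiMeasurePreserving.ae
      (h.transported t ht),
      hodd.odd, ae_mem_halfPlane] with p h1 h2 h3 hp
    have hpos : 0 < (Φ t p).1 := h.flow.maps_to t ht p hp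
    rw [h.flow_reflect hodd ht hp] at h2
    simp only [reflect_fst] at h2
    have h4 : ω 0 (AxiEuler.reflect p) = -ω 0 p := h3
    rw [h4, neg_div, ← h1, ← neg_div] at h2
    have := (div_left_inj' hpos.ne').1 h2
    exact this

/-- A trajectory that starts above the plane of symmetry stays above it. If it reached the plane,
Osgood's lemma run backwards in time would keep it there, because `u_z` vanishes on the plane and is
log-Lipschitz. -/
lemma IsTransported.snd_pos (h : IsTransported ω Φ) (hodd : IsOddNonneg (ω 0)) {t : ℝ} (ht : 0 ≤ t)
    {p : ℝ × ℝ} (hp : p ∈ halfPlane) (hz : 0 < p.2) : 0 < (Φ t p).2 := by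
  by_contra hcon
  push Not at hcon
  have hcont : ContinuousOn (fun s => (Φ s p).2) (Icc 0 t) :=
    ((h.continuousOn hp).mono Icc_subset_Ici_self).snd
  obtain ⟨t₀, ht₀, hzero⟩ := intermediate_value_Icc' ht hcont ⟨hcon, by
    rw [h.flow.initial p hp]; exact hz.le⟩
  simp only at hzero
  obtain ⟨M, N, hMN⟩ := h.isDensity_lagrangian t
  have hM := (hMN 0 le_rfl ht).1.nonneg
  have hN : 0 ≤ N := le_trans (integral_nonneg fun _ => abs_nonneg _)
      (hMN 0 le_rfl ht).1.integral_le
  have hpi := Real.pi_pos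
  set C := 12 * Real.pi ^ 2 * M + 32 * (32 * Real.pi * M + 2 * Real.pi * N) +
    (2 * Real.pi ^ 2 * M + 2 * Real.pi * N) + 1 with hC
  have hC0 : 0 < C := by positivity
  have hsub : ContinuousOn (fun s => (Φ (t₀ - s) p).2) (Icc 0 t₀) := by
    refine hcont.comp (by fun_prop) fun s hs => ⟨by linarith [hs.2], by linarith [hs.1, ht₀.2]⟩
  obtain ⟨B, hB⟩ := isCompact_Icc.exists_bound_of_continuousOn hsub
  have hB0 : 0 ≤ B := (norm_nonneg _).trans (hB 0 ⟨le_rfl, ht₀.1⟩)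
  have := osgood (ι := Unit) (γ := fun _ s => (Φ (t₀ - s) p).2)
    (γ' := fun _ s => -velZ (ω (t₀ - s)) (Φ (t₀ - s) p)) (T := t₀) hC0 hB0
    (fun _ => by rw [sub_zero]; exact hzero) (fun _ => hsub) (fun _ s hs => ?_)
    (fun _ s hs => hB s hs)
    (fun s hs δ hδ hle η hη hη1 _ => ?_) () t₀ ⟨ht₀.1, le_rfl⟩
  · simp only [sub_self] at this
    rw [h.flow.initial p hp] at this
    exact hz.ne' this
  · have hpos : 0 < t₀ - s := by linarith [hs.2]
    have h1 := (hasDerivWithinAt_snd (h.flow.ode (t₀ - s) hpos.le p hp)).hasDerivAt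
        (Ici_mem_nhds hpos)
    have h2 : HasDerivAt (fun s => t₀ - s) (-1) s := by simpa using (hasDerivAt_id s).const_sub t₀
    have := h1.comp s h2
    rw [mul_neg_one] at this
    exact this.hasDerivWithinAt
  · have hpos : 0 ≤ t₀ - s := by linarith [hs.2]
    have hd := (hMN (t₀ - s) hpos (by linarith [hs.1, ht₀.2])).1
    have h1 := abs_vel_sub_le isNumerator_numZ hd (x := Φ (t₀ - s) p)
        (y := ((Φ (t₀ - s) p).1, 0)) hη hη1
    rw [vel_numZ_axis_of_odd (h.odd hodd hpos), sub_zero, ← velZ_eq_vel hd] at h1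
    rw [norm_neg, Real.norm_eq_abs]
    refine h1.trans ?_
    have hL : 0 < 1 - Real.log η := by linarith [Real.log_neg hη hη1]
    have h3 : dist (Φ (t₀ - s) p) ((Φ (t₀ - s) p).1, 0) ≤ δ := by
      rw [Prod.dist_eq, dist_self, Real.dist_eq, sub_zero]
      exact max_le hδ (hle ())
    calc _ ≤ C * ((1 - Real.log η) * dist (Φ (t₀ - s) p) ((Φ (t₀ - s) p).1, 0) + η) :=
          mul_le_mul_of_nonneg_right (by linarith) (by positivity)
      _ ≤ _ := by gcongr

lemma IsTransported.snd_neg (h : IsTransported ω Φ) (hodd : IsOddNonneg (ω 0)) {t : ℝ} (ht : 0 ≤ t)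
    {p : ℝ × ℝ} (hp : p ∈ halfPlane) (hz : p.2 < 0) : (Φ t p).2 < 0 := by
  have := h.snd_pos hodd ht (reflect_mem hp) (by simpa using hz)
  rw [h.flow_reflect hodd ht hp] at this
  simpa using this

lemma ae_snd_ne_zero : ∀ᵐ p ∂axiMeasure, p.2 ≠ 0 := by
  rw [ae_axi_iff]
  refine ae_restrict_of_ae ?_
  have : ∀ᵐ z : ℝ, z ≠ 0 := compl_mem_ae_iff.2 (measure_singleton 0)
  exact (Measure.quasiMeasurePreserving_snd (μ := (volume : Measure ℝ))
    (ν := (volume : Measure ℝ))).ae this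

lemma IsTransported.isOddNonneg (h : IsTransported ω Φ) (hodd : IsOddNonneg (ω 0)) {t : ℝ}
    (ht : 0 ≤ t) :
    IsOddNonneg (ω t) where
  odd := h.odd hodd ht
  nonneg := by
    have hm : AEMeasurable (ω t) axiMeasure :=
        (h.inClass t ht).memLp_one.aestronglyMeasurable.aemeasurable
    refine ae_of_ae_comp (h.flow.volume_preserving t ht) (s := {p | 0 ≤ p.2 → 0 ≤ ω t p}) ?_ ?_
    · have : {p : ℝ × ℝ | 0 ≤ p.2 → 0 ≤ ω t p} = {p | p.2 < 0} ∪ {p | 0 ≤ ω t p} := by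
        ext p; simp [imp_iff_not_or]
      rw [this]
      exact (measurableSet_lt measurable_snd measurable_const).nullMeasurableSet.union
        (nullMeasurableSet_le aemeasurable_const hm)
    · filter_upwards [h.transported t ht, hodd.nonneg, ae_mem_halfPlane,
        ae_snd_ne_zero] with p h1 h2 hp hz
      intro hpos
      have hp1 : 0 < p.1 := hp
      have hpos1 : 0 < (Φ t p).1 := h.flow.maps_to t ht p hp
      rcases lt_or_gt_of_ne hz with hz | hz
      · exact absurd (h.snd_neg hodd ht hp hz) (not_lt.2 hpos)
      · rw [div_eq_iff hpos1.ne'] at h1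
        rw [h1]
        have := h2 hz.le
        positivity

/-! ### The vertical moment -/

lemma axi_restrict_quadrant : axiMeasure.restrict quadrant =
    (volume.restrict quadrant).withDensity fun p => ENNReal.ofReal p.1 := by
  unfold axiMeasure
  rw [restrict_withDensity measurableSet_quadrant, Measure.restrict_restrict measurableSet_quadrant]
  congr 2
  rw [inter_eq_left]
  exact fun p hp => hp.1

lemma setIntegral_axi_quadrant (f : ℝ × ℝ → ℝ) :
    ∫ q in quadrant, f q / q.1 ∂axiMeasure = ∫ q in quadrant, f q := by
  rw [axi_restrict_quadrant, integral_withDensity_eq_integral_toReal_smul (by fun_prop) (by simp)]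
  refine setIntegral_congr_fun measurableSet_quadrant fun q hq => ?_
  have : 0 < q.1 := hq.1
  simp only [ENNReal.toReal_ofReal this.le, smul_eq_mul]
  field_simp

lemma integrableOn_axi_quadrant (f : ℝ × ℝ → ℝ) :
    IntegrableOn (fun q => f q / q.1) quadrant axiMeasure ↔ IntegrableOn f quadrant := by
  unfold IntegrableOn
  rw [axi_restrict_quadrant, integrable_withDensity_iff_integrable_smul' (by fun_prop) (by simp)]
  refine integrableOn_congr_fun (fun q hq => ?_) measurableSet_quadrant
  have : 0 < q.1 := hq.1
  simp only [ENNReal.toReal_ofReal this.le, smul_eq_mul]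
  field_simp

/-- Since the flow preserves the quadrant, integrals over it can be pulled back to time zero. -/
lemma IsTransported.indicator_comp (h : IsTransported ω Φ) (hodd : IsOddNonneg (ω 0)) {t : ℝ}
    (ht : 0 ≤ t)
    (F : ℝ × ℝ → ℝ) :
    (fun p => quadrant.indicator (fun q => F q * ω t q / q.1) (Φ t p)) =ᵐ[axiMeasure]
      quadrant.indicator (fun p => F (Φ t p) * (ω 0 p / p.1)) := by
  filter_upwards [h.transported t ht, ae_mem_halfPlane, ae_snd_ne_zero] with p h1 hp hz
  have hpos1 : 0 < (Φ t p).1 := h.flow.maps_to t ht p hp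
  rcases lt_or_gt_of_ne hz with hz | hz
  · have h2 := h.snd_neg hodd ht hp hz
    rw [indicator_of_notMem, indicator_of_notMem]
    · exact fun hq => lt_asymm hq.2 hz
    · exact fun hq => lt_asymm hq.2 h2
  · have h2 := h.snd_pos hodd ht hp hz
    rw [indicator_of_mem (show Φ t p ∈ quadrant from ⟨hpos1, h2⟩),
      indicator_of_mem (show p ∈ quadrant from ⟨hp, hz⟩),
      ← h1, mul_div_assoc]

lemma IsTransported.aesm (h : IsTransported ω Φ) {t : ℝ} (ht : 0 ≤ t) {F : ℝ × ℝ → ℝ}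
    (hF : Measurable F) :
    AEStronglyMeasurable (quadrant.indicator (fun q => F q * ω t q / q.1)) axiMeasure := by
  refine AEStronglyMeasurable.indicator ?_ measurableSet_quadrant
  have := (h.inClass t ht).memLp_div_one.aestronglyMeasurable
  simp only [mul_div_assoc]
  exact hF.aestronglyMeasurable.mul this

lemma IsTransported.setIntegral_quadrant (h : IsTransported ω Φ) (hodd : IsOddNonneg (ω 0)) {t : ℝ}
    (ht : 0 ≤ t)
    {F : ℝ × ℝ → ℝ} (hF : Measurable F) :
    ∫ q in quadrant, F q * ω t q = ∫ p in quadrant, F (Φ t p) * (ω 0 p / p.1) ∂axiMeasure := by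
  rw [← setIntegral_axi_quadrant, ← integral_indicator measurableSet_quadrant,
    ← integral_indicator measurableSet_quadrant,
    ← integral_comp_axi (h.flow.volume_preserving t ht) (h.aesm ht hF)]
  exact integral_congr_ae (h.indicator_comp hodd ht F)

lemma IsTransported.integrableOn_quadrant (h : IsTransported ω Φ) (hodd : IsOddNonneg (ω 0)) {t : ℝ}
    (ht : 0 ≤ t)
    {F : ℝ × ℝ → ℝ} (hF : Measurable F) :
    IntegrableOn (fun q => F q * ω t q) quadrant ↔
      IntegrableOn (fun p => F (Φ t p) * (ω 0 p / p.1)) quadrant axiMeasure := by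
  rw [← integrableOn_axi_quadrant, ← integrable_indicator_iff measurableSet_quadrant,
    ← integrable_indicator_iff measurableSet_quadrant,
    ← integrable_congr (h.indicator_comp hodd ht F)]
  have hmp := h.flow.volume_preserving t ht
  have := integrable_map_measure (μ := axiMeasure) (f := Φ t) (g :=
      quadrant.indicator (fun q => F q * ω t q / q.1))
    (by rw [hmp.map_eq]; exact h.aesm ht hF) hmp.measurable.aemeasurable
  rw [hmp.map_eq] at this
  exact this

/-- Heights are Lipschitz in time along trajectories, uniformly in the starting point. -/
lemma IsTransported.lipschitz (h : IsTransported ω Φ) (T : ℝ) : ∃ V, 0 ≤ V ∧ ∀ p ∈ halfPlane,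
    ∀ s ∈ Icc 0 T, ∀ t ∈ Icc 0 T,
    |(Φ s p).2 - (Φ t p).2| ≤ V * |s - t| := by
  obtain ⟨M, N, hMN⟩ := h.isDensity_lagrangian T
  by_cases hT : 0 ≤ T
  · have hM := (hMN 0 le_rfl hT).1.nonneg
    have hN : 0 ≤ N := le_trans (integral_nonneg fun _ => abs_nonneg _)
        (hMN 0 le_rfl hT).1.integral_le
    have hpi := Real.pi_pos
    refine ⟨Real.pi * M + N, by positivity, fun p hp s hs t ht => ?_⟩
    refine (convex_Icc 0 T).norm_image_sub_le_of_norm_hasDerivWithin_le (f := fun s => (Φ s p).2)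
      (f' := fun s => velZ (ω s) (Φ s p))
      (fun r hr => ((h.flow.ode r hr.1 p hp).mono Icc_subset_Ici_self).snd) (fun r hr => ?_) ht hs
    have hd := (hMN r hr.1 hr.2).1
    rw [velZ_eq_vel hd]
    exact abs_vel_le isNumerator_numZ hd 0 _
  · exact ⟨0, le_rfl, fun p _ s hs => absurd (hs.1.trans hs.2) hT⟩

lemma IsTransported.integrableOn_snd (h : IsTransported ω Φ)
    (hZ : IntegrableOn (fun p : ℝ × ℝ => p.2 * ω 0 p) quadrant) {t : ℝ} (ht : 0 ≤ t) :
    IntegrableOn (fun p => (Φ t p).2 * (ω 0 p / p.1)) quadrant axiMeasure := by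
  obtain ⟨V, hV, hlip⟩ := h.lipschitz t
  have hξ := (h.inClass 0 le_rfl).isDensity_div.integrable
  rw [← integrableOn_axi_quadrant] at hZ
  have h1 : IntegrableOn (fun p => ((Φ t p).2 - p.2) * (ω 0 p / p.1)) quadrant axiMeasure := by
    refine Integrable.integrableOn ?_
    refine hξ.bdd_mul (c := V * t) ?_ ?_
    · exact ((h.flow.volume_preserving t ht).measurable.snd.sub measurable_snd).aestronglyMeasurable
    · filter_upwards [ae_mem_halfPlane] with p hp
      have := hlip p hp t ⟨ht, le_rfl⟩ 0 ⟨le_rfl, ht⟩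
      rwa [h.flow.initial p hp, sub_zero, abs_of_nonneg ht] at this
  refine (h1.add hZ).congr (Filter.Eventually.of_forall fun p => ?_)
  simp only [Pi.add_apply]; ring

/-- The vertical moment, written as `∫ (Φ t p).2 * (ω 0 p / p.1)` over the quadrant, is
differentiated under the integral sign along the trajectories. -/
theorem IsTransported.hasDerivWithinAt_vertMoment (h : IsTransported ω Φ) (hodd : IsOddNonneg (ω 0))
    (hZ : IntegrableOn (fun p : ℝ × ℝ => p.2 * ω 0 p) quadrant) {t : ℝ} (ht : 0 ≤ t) :
    HasDerivWithinAt (fun s => vertMoment (ω s)) (∫ p in quadrant, velZ (ω t) p * ω t p)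
      (Ici 0) t := by
  have hmeas : Measurable (velZ (ω t)) := by
    have : velZ (ω t) = vel numZ 0 (ω t) := funext fun p => velZ_eq_vel (h.inClass t ht).isDensity p
    rw [this]
    exact (continuous_vel isNumerator_numZ (h.inClass t ht).isDensity).measurable
  rw [h.setIntegral_quadrant hodd ht hmeas]
  obtain ⟨V, hV, hlip⟩ := h.lipschitz (t + 1)
  have hξ := (h.inClass 0 le_rfl).isDensity_div.integrable
  rw [hasDerivWithinAt_iff_tendsto_slope]
  have hdom : Filter.Tendsto (fun s => ∫ p in quadrant, (slope (fun s => (Φ s p).2) t s) *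
      (ω 0 p / p.1) ∂axiMeasure)
      (nhdsWithin t (Ici 0 \ {t})) (nhds (∫ p in quadrant,
      velZ (ω t) (Φ t p) * (ω 0 p / p.1) ∂axiMeasure)) := by
    have hev : ∀ᶠ s in nhdsWithin t (Ici 0 \ {t}), s ∈ Icc 0 (t + 1) ∧ s ≠ t := by
      filter_upwards [self_mem_nhdsWithin, nhdsWithin_le_nhds
        (Iic_mem_nhds (show t < t + 1 by linarith))] with s hs hs2
      exact ⟨⟨hs.1, hs2⟩, hs.2⟩
    refine tendsto_integral_filter_of_dominated_convergence (fun p => V * |ω 0 p / p.1|) ?_ ?_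
      (hξ.abs.const_mul V).integrableOn ?_
    · filter_upwards [hev] with s hs
      refine AEStronglyMeasurable.mul ?_ hξ.aestronglyMeasurable.restrict
      simp only [slope_def_field]
      have m1 := (h.flow.volume_preserving s hs.1.1).measurable
      have m2 := (h.flow.volume_preserving t ht).measurable
      exact ((m1.snd.sub m2.snd).div_const _).aestronglyMeasurable
    · filter_upwards [hev] with s hs
      filter_upwards [ae_restrict_mem measurableSet_quadrant] with p hp
      rw [norm_mul, Real.norm_eq_abs, Real.norm_eq_abs, slope_def_field, abs_div]
      gcongr
      rw [div_le_iff₀ (abs_pos.2 (sub_ne_zero.2 hs.2))]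
      exact hlip p hp.1 s hs.1 t ⟨ht, by linarith⟩
    · filter_upwards [ae_restrict_mem measurableSet_quadrant] with p hp
      refine Filter.Tendsto.mul_const _ ?_
      exact hasDerivWithinAt_iff_tendsto_slope.1 (hasDerivWithinAt_snd (h.flow.ode t ht p hp.1))
  refine hdom.congr' ?_
  filter_upwards [self_mem_nhdsWithin] with s hs
  have hs0 : 0 ≤ s := hs.1
  rw [slope_def_field, vertMoment, vertMoment, h.setIntegral_quadrant hodd hs0 measurable_snd,
    h.setIntegral_quadrant hodd ht measurable_snd, ← integral_sub (h.integrableOn_snd hZ hs0)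
      (h.integrableOn_snd hZ ht),
    ← integral_div]
  refine integral_congr_ae (Filter.Eventually.of_forall fun p => ?_)
  simp only [slope_def_field]
  ring

end

/-! ### The regularised velocity -/

/-- A partial derivative, in the variable `p`, of `kern ν ε p q θ`: here `c` is the corresponding
partial derivative of `ν`, and `e` is half that of `distSq`. -/
def dkern (ν : ℝ × ℝ → ℝ × ℝ → ℝ → ℝ) (c : ℝ → ℝ) (e : ℝ × ℝ → ℝ × ℝ → ℝ → ℝ) (ε : ℝ) (p q : ℝ × ℝ)
    (θ : ℝ) : ℝ :=
  c θ / √(distSq p q θ + ε ^ 2) ^ 3 - 3 * ν p q θ * e p q θ / √(distSq p q θ + ε ^ 2) ^ 5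

/-- Half the derivative of `distSq p q θ` in `p.1`. -/
def radOff (p q : ℝ × ℝ) (θ : ℝ) : ℝ := p.1 - q.1 * Real.cos θ

/-- Half the derivative of `distSq p q θ` in `p.2`. -/
def vertOff (p q : ℝ × ℝ) (_ : ℝ) : ℝ := p.2 - q.2

lemma sqrt_pos_of_pos {ε : ℝ} (hε : 0 < ε) (p q : ℝ × ℝ) (θ : ℝ) : 0 < √(distSq p q θ + ε ^ 2) :=
  Real.sqrt_pos.2 (by have := distSq_nonneg p q θ; positivity)

lemma le_sqrt_reg {ε : ℝ} (p q : ℝ × ℝ) (θ : ℝ) : ε ≤ √(distSq p q θ + ε ^ 2) :=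
  Real.le_sqrt_of_sq_le (by linarith [distSq_nonneg p q θ])

lemma sqrt_le_sqrt_reg (ε : ℝ) (p q : ℝ × ℝ) (θ : ℝ) : √(distSq p q θ) ≤ √(distSq p q θ + ε ^ 2) :=
  Real.sqrt_le_sqrt (by nlinarith)

lemma abs_radOff_le (p q : ℝ × ℝ) (θ : ℝ) : |radOff p q θ| ≤ √(distSq p q θ) := by
  refine Real.abs_le_sqrt ?_
  rw [distSq_comm, distSq_eq_add, radOff]
  nlinarith [sq_nonneg (q.2 - p.2), sq_nonneg (q.1 * Real.sin θ)]

lemma abs_vertOff_le (p q : ℝ × ℝ) (θ : ℝ) : |vertOff p q θ| ≤ √(distSq p q θ) := by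
  refine Real.abs_le_sqrt ?_
  rw [distSq_eq_add, vertOff]
  nlinarith [sq_nonneg (p.1 * Real.cos θ - q.1), sq_nonneg (p.1 * Real.sin θ)]

lemma hasFDerivAt_reg (q : ℝ × ℝ) (θ ε : ℝ) (p : ℝ × ℝ) :
    HasFDerivAt (fun p => distSq p q θ + ε ^ 2)
      ((2 * radOff p q θ) • ContinuousLinearMap.fst ℝ ℝ ℝ +
      (2 * vertOff p q θ) • ContinuousLinearMap.snd ℝ ℝ ℝ) p := by
  simp only [distSq, radOff, vertOff, sq]
  have h1 : HasFDerivAt (fun p : ℝ × ℝ => p.1) (ContinuousLinearMap.fst ℝ ℝ ℝ) p := hasFDerivAt_fst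
  have h2 : HasFDerivAt (fun p : ℝ × ℝ => p.2) (ContinuousLinearMap.snd ℝ ℝ ℝ) p := hasFDerivAt_snd
  have h := ((((h1.fun_mul h1).add_const (q.1 * q.1)).fun_sub
      ((h1.const_mul 2).mul_const q.1 |>.mul_const (Real.cos θ))).fun_add
    ((h2.sub_const q.2).fun_mul (h2.sub_const q.2))).add_const (ε * ε)
  refine h.congr_fderiv ?_
  ext <;> simp <;> ring

lemma hasFDerivAt_kern {ν : ℝ × ℝ → ℝ × ℝ → ℝ → ℝ} {c₁ c₂ : ℝ → ℝ} {ε : ℝ} (hε : 0 < ε)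
    (p q : ℝ × ℝ) (θ : ℝ)
    (hν : HasFDerivAt (fun p => ν p q θ) (c₁ θ • ContinuousLinearMap.fst ℝ ℝ ℝ +
    c₂ θ • ContinuousLinearMap.snd ℝ ℝ ℝ) p) :
    HasFDerivAt (fun p => kern ν ε p q θ)
      (dkern ν c₁ radOff ε p q θ • ContinuousLinearMap.fst ℝ ℝ ℝ +
      dkern ν c₂ vertOff ε p q θ • ContinuousLinearMap.snd ℝ ℝ ℝ) p := by
  have hn := sqrt_pos_of_pos hε p q θ
  have hpos : distSq p q θ + ε ^ 2 ≠ 0 := by have := distSq_nonneg p q θ; positivity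
  have h1 := ((hasFDerivAt_reg q θ ε p).sqrt hpos)
  have h2 : HasDerivAt (fun x : ℝ => (x ^ 3)⁻¹) (-(3 * √(distSq p q θ + ε ^ 2) ^ 2) /
      (√(distSq p q θ + ε ^ 2) ^ 3) ^ 2) (√(distSq p q θ + ε ^ 2)) := by
    have := (hasDerivAt_pow 3 (√(distSq p q θ + ε ^ 2))).fun_inv (pow_pos hn 3).ne'
    simpa using this
  have h3 := hν.fun_mul (h2.comp_hasFDerivAt p h1)
  simp only [Function.comp_def, ← div_eq_mul_inv] at h3
  refine h3.congr_fderiv ?_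
  unfold dkern
  ext <;> simp <;> field_simp <;> ring

lemma abs_dkern_le {ν : ℝ × ℝ → ℝ × ℝ → ℝ → ℝ} (hν : IsNumerator ν) {c : ℝ → ℝ}
    (hc : ∀ θ, |c θ| ≤ 1)
    {e : ℝ × ℝ → ℝ × ℝ → ℝ → ℝ} (he : ∀ p q θ, |e p q θ| ≤ √(distSq p q θ)) {ε : ℝ} (hε : 0 < ε)
    (p q : ℝ × ℝ) (θ : ℝ) :
    |dkern ν c e ε p q θ| ≤ 4 / ε ^ 3 := by
  have hn := sqrt_pos_of_pos hε p q θ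
  have h1 := (hν.abs_le p q θ).trans (sqrt_le_sqrt_reg ε p q θ)
  have h2 := (he p q θ).trans (sqrt_le_sqrt_reg ε p q θ)
  have h3 : ε ≤ √(distSq p q θ + ε ^ 2) := le_sqrt_reg p q θ
  unfold dkern
  generalize √(distSq p q θ + ε ^ 2) = n at *
  refine (abs_sub _ _).trans ?_
  rw [abs_div, abs_div, abs_mul, abs_mul, abs_of_pos (pow_pos hn 3), abs_of_pos (pow_pos hn 5),
    abs_of_pos (by norm_num : (0:ℝ) < 3)]
  calc _ ≤ 1 / n ^ 3 + 3 * n * n / n ^ 5 := by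
        gcongr; exact hc θ
    _ = 4 / n ^ 3 := by field_simp; norm_num
    _ ≤ _ := by gcongr

lemma measurable_dkern {ν : ℝ × ℝ → ℝ × ℝ → ℝ → ℝ} (hν : IsNumerator ν) {c : ℝ → ℝ}
    (hc : Continuous c)
    {e : ℝ × ℝ → ℝ × ℝ → ℝ → ℝ} (he : Continuous fun x : (ℝ × ℝ) × (ℝ × ℝ) × ℝ => e x.1 x.2.1 x.2.2)
    (ε : ℝ) (p : ℝ × ℝ) :
    Measurable fun x : (ℝ × ℝ) × ℝ => dkern ν c e ε p x.1 x.2 := by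
  unfold dkern
  have h1 : Measurable fun x : (ℝ × ℝ) × ℝ => ν p x.1 x.2 :=
    (hν.continuous.comp (show Continuous fun x : (ℝ × ℝ) × ℝ =>
    (p, x.1, x.2) by fun_prop)).measurable
  have h2 : Measurable fun x : (ℝ × ℝ) × ℝ => e p x.1 x.2 :=
    (he.comp (show Continuous fun x : (ℝ × ℝ) × ℝ => (p, x.1, x.2) by fun_prop)).measurable
  have h3 := hc.measurable
  exact ((h3.comp measurable_snd).div (by fun_prop)).sub
    (((h1.const_mul 3).mul h2).div (by fun_prop))

lemma integrable_dkern {ν : ℝ × ℝ → ℝ × ℝ → ℝ → ℝ} (hν : IsNumerator ν) {c : ℝ → ℝ}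
    (hc : Continuous c) (hc1 : ∀ θ, |c θ| ≤ 1)
    {e : ℝ × ℝ → ℝ × ℝ → ℝ → ℝ} (hec : Continuous fun x : (ℝ × ℝ) × (ℝ × ℝ) × ℝ =>
    e x.1 x.2.1 x.2.2)
    (he : ∀ p q θ, |e p q θ| ≤ √(distSq p q θ)) {ε : ℝ} (hε : 0 < ε) (p : ℝ × ℝ)
    {w : ℝ × ℝ → ℝ} (hw : Integrable w axiMeasure) :
    Integrable (fun x : (ℝ × ℝ) × ℝ => dkern ν c e ε p x.1 x.2 * w x.1) angMeasure :=
  (integrable_ang_fst hw).bdd_mul (c := 4 / ε ^ 3)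
  (measurable_dkern hν hc hec ε p).aestronglyMeasurable
    (Filter.Eventually.of_forall fun x => abs_dkern_le hν hc1 he hε p x.1 x.2)

lemma continuous_radOff : Continuous fun x : (ℝ × ℝ) × (ℝ × ℝ) × ℝ => radOff x.1 x.2.1 x.2.2 := by
  unfold radOff; fun_prop

lemma continuous_vertOff : Continuous fun x : (ℝ × ℝ) × (ℝ × ℝ) × ℝ => vertOff x.1 x.2.1 x.2.2 := by
  unfold vertOff; fun_prop

/-- The partial derivative of `vel ν ε w` with the kernel `dkern ν c e ε`. -/
def dvel (ν : ℝ × ℝ → ℝ × ℝ → ℝ → ℝ) (c : ℝ → ℝ) (e : ℝ × ℝ → ℝ × ℝ → ℝ → ℝ) (ε : ℝ) (w : ℝ × ℝ → ℝ)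
    (p : ℝ × ℝ) : ℝ :=
  (1 / (4 * Real.pi)) * ∫ x, dkern ν c e ε p x.1 x.2 * w x.1 ∂angMeasure

lemma hasFDerivAt_vel {ν : ℝ × ℝ → ℝ × ℝ → ℝ → ℝ} (hν : IsNumerator ν) {c₁ c₂ : ℝ → ℝ}
    (hc₁ : Continuous c₁) (hc₂ : Continuous c₂) (h₁ : ∀ θ, |c₁ θ| ≤ 1) (h₂ : ∀ θ, |c₂ θ| ≤ 1)
    (hd : ∀ p q θ, HasFDerivAt (fun p => ν p q θ)
      (c₁ θ • ContinuousLinearMap.fst ℝ ℝ ℝ + c₂ θ • ContinuousLinearMap.snd ℝ ℝ ℝ) p)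
    {w : ℝ × ℝ → ℝ} {M N : ℝ} (hw : IsDensity w M N) {ε : ℝ} (hε : 0 < ε) (p : ℝ × ℝ) :
    HasFDerivAt (vel ν ε w) (dvel ν c₁ radOff ε w p • ContinuousLinearMap.fst ℝ ℝ ℝ +
      dvel ν c₂ vertOff ε w p • ContinuousLinearMap.snd ℝ ℝ ℝ) p := by
  have i1 := integrable_dkern hν hc₁ h₁ continuous_radOff abs_radOff_le hε p hw.integrable
  have i2 := integrable_dkern hν hc₂ h₂ continuous_vertOff abs_vertOff_le hε p hw.integrable
  have key := hasFDerivAt_integral_of_dominated_of_fderiv_le (𝕜 := ℝ) (μ := angMeasure) (s := univ)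
      (x₀ := p)
    (F := fun p x => kern ν ε p x.1 x.2 * w x.1)
    (F' := fun p x => (dkern ν c₁ radOff ε p x.1 x.2 * w x.1) • ContinuousLinearMap.fst ℝ ℝ ℝ +
      (dkern ν c₂ vertOff ε p x.1 x.2 * w x.1) • ContinuousLinearMap.snd ℝ ℝ ℝ)
    (bound := fun x => (8 / ε ^ 3) * |w x.1|) Filter.univ_mem
    (Filter.Eventually.of_forall fun p' => (integrable_kern hν hw ε p').aestronglyMeasurable)
    (integrable_kern hν hw ε p)
    ((i1.aestronglyMeasurable.smul_const _).add (i2.aestronglyMeasurable.smul_const _))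
    (Filter.Eventually.of_forall fun x p' _ => ?_)
    ((integrable_ang_fst hw.integrable).abs.const_mul _)
    (Filter.Eventually.of_forall fun x p' _ => ?_)
  · refine (key.const_mul (1 / (4 * Real.pi))).congr_fderiv ?_
    rw [integral_add (i1.smul_const _) (i2.smul_const _), integral_smul_const, integral_smul_const,
      dvel, dvel,
      smul_add, smul_smul, smul_smul]
  · have b1 := abs_dkern_le hν h₁ abs_radOff_le hε p' x.1 x.2
    have b2 := abs_dkern_le hν h₂ abs_vertOff_le hε p' x.1 x.2
    refine (norm_add_le _ _).trans ?_
    rw [norm_smul, norm_smul, norm_mul, norm_mul, Real.norm_eq_abs, Real.norm_eq_abs,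
      Real.norm_eq_abs]
    have n1 := ContinuousLinearMap.norm_fst_le (𝕜 := ℝ) ℝ ℝ
    have n2 := ContinuousLinearMap.norm_snd_le (𝕜 := ℝ) ℝ ℝ
    calc _ ≤ 4 / ε ^ 3 * |w x.1| * 1 + 4 / ε ^ 3 * |w x.1| * 1 := by gcongr
      _ = _ := by ring
  · refine ((hasFDerivAt_kern hε p' x.1 x.2 (hd p' x.1 x.2)).mul_const (w x.1)).congr_fderiv ?_
    rw [smul_add, smul_smul, smul_smul, mul_comm (w x.1), mul_comm (w x.1)]

lemma hasFDerivAt_numR (p q : ℝ × ℝ) (θ : ℝ) : HasFDerivAt (fun p => numR p q θ)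
    ((fun _ : ℝ => (0:ℝ)) θ • ContinuousLinearMap.fst ℝ ℝ ℝ +
    (fun θ => -Real.cos θ) θ • ContinuousLinearMap.snd ℝ ℝ ℝ) p := by
  unfold numR
  have h2 : HasFDerivAt (fun p : ℝ × ℝ => p.2) (ContinuousLinearMap.snd ℝ ℝ ℝ) p := hasFDerivAt_snd
  refine ((h2.sub_const q.2).mul_const (Real.cos θ)).fun_neg.congr_fderiv ?_
  ext <;> simp

lemma hasFDerivAt_numZ (p q : ℝ × ℝ) (θ : ℝ) : HasFDerivAt (fun p => numZ p q θ)
    (Real.cos θ • ContinuousLinearMap.fst ℝ ℝ ℝ +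
    (fun _ : ℝ => (0:ℝ)) θ • ContinuousLinearMap.snd ℝ ℝ ℝ) p := by
  unfold numZ
  have h1 : HasFDerivAt (fun p : ℝ × ℝ => p.1) (ContinuousLinearMap.fst ℝ ℝ ℝ) p := hasFDerivAt_fst
  refine ((h1.mul_const (Real.cos θ)).sub_const q.1).congr_fderiv ?_
  ext <;> simp

section
variable {w : ℝ × ℝ → ℝ} {M N : ℝ} {ε : ℝ}

/-- The derivative `∂_r u_r` of the regularised velocity. -/
def dRR (ε : ℝ) (w : ℝ × ℝ → ℝ) : ℝ × ℝ → ℝ := dvel numR (fun _ => 0) radOff ε w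

/-- The derivative `∂_z u_r` of the regularised velocity. -/
def dRZ (ε : ℝ) (w : ℝ × ℝ → ℝ) : ℝ × ℝ → ℝ := dvel numR (fun θ => -Real.cos θ) vertOff ε w

/-- The derivative `∂_r u_z` of the regularised velocity. -/
def dZR (ε : ℝ) (w : ℝ × ℝ → ℝ) : ℝ × ℝ → ℝ := dvel numZ Real.cos radOff ε w

/-- The derivative `∂_z u_z` of the regularised velocity. -/
def dZZ (ε : ℝ) (w : ℝ × ℝ → ℝ) : ℝ × ℝ → ℝ := dvel numZ (fun _ => 0) vertOff ε w

lemma hasFDerivAt_vel_numR (hw : IsDensity w M N) (hε : 0 < ε) (p : ℝ × ℝ) :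
    HasFDerivAt (vel numR ε w) (dRR ε w p • ContinuousLinearMap.fst ℝ ℝ ℝ +
      dRZ ε w p • ContinuousLinearMap.snd ℝ ℝ ℝ) p :=
  hasFDerivAt_vel isNumerator_numR continuous_const (by fun_prop) (by simp)
    (fun θ => by rw [abs_neg]; exact Real.abs_cos_le_one θ) hasFDerivAt_numR hw hε p

lemma hasFDerivAt_vel_numZ (hw : IsDensity w M N) (hε : 0 < ε) (p : ℝ × ℝ) :
    HasFDerivAt (vel numZ ε w) (dZR ε w p • ContinuousLinearMap.fst ℝ ℝ ℝ +
      dZZ ε w p • ContinuousLinearMap.snd ℝ ℝ ℝ) p :=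
  hasFDerivAt_vel isNumerator_numZ (by fun_prop) continuous_const Real.abs_cos_le_one (by simp)
    hasFDerivAt_numZ hw hε p

/-- The kernel produced by integration by parts in the angle has zero angular mean, and so vanishes
against every function independent of the angle. -/
lemma integral_angle_null (hε : 0 < ε) (p : ℝ × ℝ) (a : ℝ × ℝ → ℝ)
    (hi : Integrable (fun x : (ℝ × ℝ) × ℝ =>
    a x.1 * (Real.cos x.2 / √(distSq p x.1 x.2 + ε ^ 2) ^ 3 -
        3 * p.1 * x.1.1 * Real.sin x.2 ^ 2 / √(distSq p x.1 x.2 + ε ^ 2) ^ 5)) angMeasure) :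
    ∫ x, a x.1 * (Real.cos x.2 / √(distSq p x.1 x.2 + ε ^ 2) ^ 3 -
        3 * p.1 * x.1.1 * Real.sin x.2 ^ 2 / √(distSq p x.1 x.2 + ε ^ 2) ^ 5) ∂angMeasure = 0 := by
  unfold angMeasure at hi ⊢
  rw [integral_prod _ hi]
  refine integral_eq_zero_of_ae (Filter.Eventually.of_forall fun q => ?_)
  simp only [integral_const_mul]
  rw [← intervalIntegral.integral_of_le Real.two_pi_pos.le, integral_angle_eq_zero, mul_zero]
  · rfl
  · intro θ
    have := distSq_nonneg p q θ
    positivity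

/-- The regularised velocity is divergence free: `r ∂_r u_r + u_r + r ∂_z u_z = 0`. Up to the factor
`-(p.2 - q.2) w q`, the integrand is the kernel with zero angular mean. -/
lemma div_free (hw : IsDensity w M N) (hε : 0 < ε) (p : ℝ × ℝ) :
    p.1 * dRR ε w p + vel numR ε w p + p.1 * dZZ ε w p = 0 := by
  have i1 := (integrable_dkern isNumerator_numR (c := fun _ => 0) continuous_const
      (by simp) continuous_radOff abs_radOff_le hε p hw.integrable).const_mul p.1
  have i2 := integrable_kern isNumerator_numR hw ε p
  have i3 := (integrable_dkern isNumerator_numZ (c := fun _ => 0) continuous_const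
      (by simp) continuous_vertOff abs_vertOff_le hε p hw.integrable).const_mul p.1
  have e : p.1 * dRR ε w p + vel numR ε w p + p.1 * dZZ ε w p = (1 / (4 * Real.pi)) *
      ∫ x, (p.1 * (dkern numR (fun _ => 0) radOff ε p x.1 x.2 * w x.1) +
        kern numR ε p x.1 x.2 * w x.1 +
        p.1 * (dkern numZ (fun _ => 0) vertOff ε p x.1 x.2 * w x.1)) ∂angMeasure := by
    have i12 : Integrable (fun x : (ℝ × ℝ) × ℝ =>
        p.1 * (dkern numR (fun _ => 0) radOff ε p x.1 x.2 * w x.1) +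
        kern numR ε p x.1 x.2 * w x.1) angMeasure := i1.add i2
    rw [integral_add i12 i3, integral_add i1 i2, integral_const_mul, integral_const_mul]
    unfold dRR dZZ dvel vel
    ring
  have e2 : ∀ x : (ℝ × ℝ) × ℝ, p.1 * (dkern numR (fun _ => 0) radOff ε p x.1 x.2 * w x.1) +
      kern numR ε p x.1 x.2 * w x.1 +
        p.1 * (dkern numZ (fun _ => 0) vertOff ε p x.1 x.2 * w x.1) =
      (-(p.2 - x.1.2) * w x.1) * (Real.cos x.2 / √(distSq p x.1 x.2 + ε ^ 2) ^ 3 -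
        3 * p.1 * x.1.1 * Real.sin x.2 ^ 2 / √(distSq p x.1 x.2 + ε ^ 2) ^ 5) := by
    intro x
    simp only [dkern, kern, numR, numZ, radOff, vertOff]
    have hn := sqrt_pos_of_pos hε p x.1 x.2
    generalize √(distSq p x.1 x.2 + ε ^ 2) = n at *
    have h := Real.sin_sq_add_cos_sq x.2
    field_simp
    linear_combination (-(3 * w x.1 * p.1 * x.1.1 * (p.2 - x.1.2))) * h
  rw [e]
  simp only [e2]
  rw [integral_angle_null hε p (fun q => -(p.2 - q.2) * w q), mul_zero]
  refine ((i1.add i2).add i3).congr (Filter.Eventually.of_forall fun x => ?_)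
  simp only [Pi.add_apply, e2]

/-- The regularised vorticity: the angular component of the convolution of `w e_θ` in three-space
with the mollifier `3 ε² / (4π (|y|² + ε²) ^ (5 / 2))`. -/
def vortReg (ε : ℝ) (w : ℝ × ℝ → ℝ) (p : ℝ × ℝ) : ℝ :=
  (1 / (4 * Real.pi)) * ∫ x, Real.cos x.2 * (3 * ε ^ 2 / √(distSq p x.1 x.2 + ε ^ 2) ^ 5) *
  w x.1 ∂angMeasure

lemma abs_bump_le (hε : 0 < ε) (p q : ℝ × ℝ) (θ : ℝ) :
    |Real.cos θ * (3 * ε ^ 2 / √(distSq p q θ + ε ^ 2) ^ 5)| ≤ 3 * ε ^ 2 / ε ^ 5 := by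
  have h3 : ε ≤ √(distSq p q θ + ε ^ 2) := le_sqrt_reg p q θ
  rw [abs_mul, abs_of_nonneg (by positivity : 0 ≤ 3 * ε ^ 2 / √(distSq p q θ + ε ^ 2) ^ 5)]
  calc _ ≤ 1 * (3 * ε ^ 2 / √(distSq p q θ + ε ^ 2) ^ 5) := by gcongr; exact Real.abs_cos_le_one θ
    _ ≤ _ := by rw [one_mul]; gcongr

lemma integrable_bump (hw : IsDensity w M N) (hε : 0 < ε) (p : ℝ × ℝ) :
    Integrable (fun x : (ℝ × ℝ) × ℝ => Real.cos x.2 *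
      (3 * ε ^ 2 / √(distSq p x.1 x.2 + ε ^ 2) ^ 5) * w x.1) angMeasure :=
  (integrable_ang_fst hw.integrable).bdd_mul (c := 3 * ε ^ 2 / ε ^ 5)
    (Measurable.aestronglyMeasurable (by fun_prop))
    (Filter.Eventually.of_forall fun x => abs_bump_le hε p x.1 x.2)

/-- The curl of the regularised velocity is the regularised vorticity. -/
lemma curl_eq (hw : IsDensity w M N) (hε : 0 < ε) (p : ℝ × ℝ) :
    dZR ε w p - dRZ ε w p = vortReg ε w p := by
  have i1 := integrable_dkern isNumerator_numZ (c := Real.cos)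
      (by fun_prop) Real.abs_cos_le_one continuous_radOff abs_radOff_le hε p hw.integrable
  have i2 := integrable_dkern isNumerator_numR (c := fun θ => -Real.cos θ) (by fun_prop)
      (fun θ => by rw [abs_neg]; exact Real.abs_cos_le_one θ) continuous_vertOff abs_vertOff_le hε p
      hw.integrable
  have i3 := integrable_bump hw hε p
  have e2 : ∀ x : (ℝ × ℝ) × ℝ, dkern numZ Real.cos radOff ε p x.1 x.2 * w x.1 -
      dkern numR (fun θ => -Real.cos θ) vertOff ε p x.1 x.2 * w x.1 -
      Real.cos x.2 * (3 * ε ^ 2 / √(distSq p x.1 x.2 + ε ^ 2) ^ 5) * w x.1 =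
      (-w x.1) * (Real.cos x.2 / √(distSq p x.1 x.2 + ε ^ 2) ^ 3 -
        3 * p.1 * x.1.1 * Real.sin x.2 ^ 2 / √(distSq p x.1 x.2 + ε ^ 2) ^ 5) := by
    intro x
    simp only [dkern, numR, numZ, radOff, vertOff]
    have hn := sqrt_pos_of_pos hε p x.1 x.2
    have hn2 := Real.sq_sqrt
        (by have := distSq_nonneg p x.1 x.2; positivity : 0 ≤ distSq p x.1 x.2 + ε ^ 2)
    generalize √(distSq p x.1 x.2 + ε ^ 2) = n at *
    have h := Real.sin_sq_add_cos_sq x.2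
    have hε2 : ε ^ 2 = n ^ 2 - distSq p x.1 x.2 := by linarith
    rw [hε2, distSq]
    field_simp
    linear_combination (-(3 * w x.1 * p.1 * x.1.1)) * h
  have e3 : ∫ x, (dkern numZ Real.cos radOff ε p x.1 x.2 * w x.1 -
      dkern numR (fun θ => -Real.cos θ) vertOff ε p x.1 x.2 * w x.1 -
      Real.cos x.2 * (3 * ε ^ 2 / √(distSq p x.1 x.2 + ε ^ 2) ^ 5) * w x.1) ∂angMeasure = 0 := by
    simp only [e2]
    refine integral_angle_null hε p (fun q => -w q) ?_
    refine ((i1.sub i2).sub i3).congr (Filter.Eventually.of_forall fun x => ?_)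
    simp only [Pi.sub_apply, e2]
  have i12 : Integrable (fun x : (ℝ × ℝ) × ℝ => dkern numZ Real.cos radOff ε p x.1 x.2 * w x.1 -
      dkern numR (fun θ => -Real.cos θ) vertOff ε p x.1 x.2 * w x.1) angMeasure := i1.sub i2
  rw [integral_sub i12 i3, integral_sub i1 i2] at e3
  unfold dZR dRZ dvel vortReg
  linear_combination (1 / (4 * Real.pi)) * e3

lemma continuous_vortReg (hw : IsDensity w M N) (hε : 0 < ε) : Continuous (vortReg ε w) := by
  unfold vortReg
  refine continuous_const.mul ?_
  refine continuous_of_dominated (bound := fun x => 3 * ε ^ 2 / ε ^ 5 * |w x.1|)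
    (fun p => (integrable_bump hw hε p).aestronglyMeasurable) (fun p =>
    Filter.Eventually.of_forall fun x => ?_)
    ((integrable_ang_fst hw.integrable).abs.const_mul _) (Filter.Eventually.of_forall fun x => ?_)
  · rw [norm_mul, Real.norm_eq_abs, Real.norm_eq_abs]
    have := abs_bump_le hε p x.1 x.2
    gcongr
  · refine Continuous.mul (continuous_const.mul (Continuous.div (by fun_prop) (by fun_prop) fun p =>
      ?_)) continuous_const
    exact pow_ne_zero _ (sqrt_pos_of_pos hε p x.1 x.2).ne'

end

/-! ### Convergence of the regularised vorticity -/

/-- The measure `dr dz dθ` on pairs of a meridional point and an angle. Compared with `angMeasure`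
it lacks the weight `r`, since the identities below are tested in `dr dz`. -/
def merMeasure : Measure ((ℝ × ℝ) × ℝ) :=
  (volume.restrict halfPlane).prod (volume.restrict (Ioc 0 (2 * Real.pi)))

instance : SFinite merMeasure := by unfold merMeasure; infer_instance

lemma angMeasure_eq : angMeasure = merMeasure.withDensity fun x => ENNReal.ofReal x.1.1 := by
  unfold angMeasure merMeasure axiMeasure
  rw [prod_withDensity_left (by fun_prop)]

lemma ae_mer_pos : ∀ᵐ x ∂merMeasure, 0 < x.1.1 :=
  Measure.quasiMeasurePreserving_fst.ae (ae_restrict_mem measurableSet_halfPlane)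

lemma integral_ang (f : (ℝ × ℝ) × ℝ → ℝ) : ∫ x, f x ∂angMeasure = ∫ x, x.1.1 * f x ∂merMeasure := by
  rw [angMeasure_eq, integral_withDensity_eq_integral_toReal_smul (by fun_prop) (by simp)]
  refine integral_congr_ae ?_
  filter_upwards [ae_mer_pos] with x hx
  simp [ENNReal.toReal_ofReal hx.le]

lemma integrable_ang (f : (ℝ × ℝ) × ℝ → ℝ) :
    Integrable f angMeasure ↔ Integrable (fun x => x.1.1 * f x) merMeasure := by
  rw [angMeasure_eq, integrable_withDensity_iff_integrable_smul' (by fun_prop) (by simp)]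
  refine integrable_congr ?_
  filter_upwards [ae_mer_pos] with x hx
  simp [ENNReal.toReal_ofReal hx.le]

lemma cauchy_eq {ε : ℝ} (hε : 0 < ε) (x : ℝ) : ε / (x ^ 2 + ε ^ 2) =
    ε⁻¹ * (1 + (ε⁻¹ * x) ^ 2)⁻¹ := by
  field_simp; ring

lemma integrable_cauchy {ε : ℝ} (hε : 0 < ε) (s : ℝ) : Integrable fun x : ℝ =>
    ε / ((x - s) ^ 2 + ε ^ 2) := by
  have h : Integrable fun x : ℝ => ε / (x ^ 2 + ε ^ 2) := by
    simp only [cauchy_eq hε]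
    exact (integrable_inv_one_add_sq.comp_mul_left' (inv_ne_zero hε.ne')).const_mul _
  exact h.comp_sub_right s

lemma integral_cauchy {ε : ℝ} (hε : 0 < ε) (s : ℝ) : ∫ x : ℝ, ε / ((x - s) ^ 2 + ε ^ 2) =
    Real.pi := by
  rw [integral_sub_right_eq_self (fun x => ε / (x ^ 2 + ε ^ 2)) s]
  simp only [cauchy_eq hε]
  rw [integral_const_mul, Measure.integral_comp_mul_left (fun x => (1 + x ^ 2)⁻¹) ε⁻¹,
    integral_univ_inv_one_add_sq,
    inv_inv, abs_of_pos hε, smul_eq_mul]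
  field_simp

/-- The kernel is dominated by a product of two Cauchy densities, of total mass `π ^ 2`. -/
lemma mer_le {ε : ℝ} (hε : 0 < ε) (p q : ℝ × ℝ) (θ : ℝ) :
    ε ^ 2 / (distSq p q θ + ε ^ 2) ^ 2 ≤
      (ε / ((p.1 - q.1 * Real.cos θ) ^ 2 + ε ^ 2)) * (ε / ((p.2 - q.2) ^ 2 + ε ^ 2)) := by
  rw [div_mul_div_comm, ← sq]
  have h : distSq p q θ = (q.1 * Real.cos θ - p.1) ^ 2 + (q.1 * Real.sin θ) ^ 2 +
      (q.2 - p.2) ^ 2 := by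
    rw [distSq_comm, distSq_eq_add]
  have h1 : (p.1 - q.1 * Real.cos θ) ^ 2 ≤ distSq p q θ := by
    rw [h]; nlinarith [sq_nonneg (q.1 * Real.sin θ), sq_nonneg (q.2 - p.2)]
  have h2 : (p.2 - q.2) ^ 2 ≤ distSq p q θ := by
    rw [h]; nlinarith [sq_nonneg (q.1 * Real.sin θ), sq_nonneg (q.1 * Real.cos θ - p.1)]
  rw [sq (distSq p q θ + ε ^ 2)]
  have h3 := distSq_nonneg p q θ
  gcongr

lemma integrable_mer_fixed {ε : ℝ} (hε : 0 < ε) (q : ℝ × ℝ) (θ : ℝ) :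
    IntegrableOn (fun p => ε ^ 2 / (distSq p q θ + ε ^ 2) ^ 2) halfPlane := by
  have h := (integrable_cauchy hε (q.1 * Real.cos θ)).mul_prod (integrable_cauchy hε q.2)
  refine Integrable.integrableOn (h.mono' (Measurable.aestronglyMeasurable (by fun_prop))
    (Eventually.of_forall fun p => ?_))
  rw [Real.norm_of_nonneg (by positivity)]
  exact mer_le hε p q θ

lemma integral_mer_fixed_le {ε : ℝ} (hε : 0 < ε) (q : ℝ × ℝ) (θ : ℝ) :
    ∫ p in halfPlane, ε ^ 2 / (distSq p q θ + ε ^ 2) ^ 2 ≤ Real.pi ^ 2 := by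
  have h := (integrable_cauchy hε (q.1 * Real.cos θ)).mul_prod (integrable_cauchy hε q.2)
  have h2 := integral_prod_mul (μ := (volume : Measure ℝ)) (ν := (volume : Measure ℝ))
      (fun x : ℝ => ε / ((x - q.1 * Real.cos θ) ^ 2 + ε ^ 2)) (fun x : ℝ =>
      ε / ((x - q.2) ^ 2 + ε ^ 2))
  rw [integral_cauchy hε, integral_cauchy hε, ← sq] at h2
  rw [← h2]
  calc _ ≤ ∫ p in halfPlane, (ε / ((p.1 - q.1 * Real.cos θ) ^ 2 + ε ^ 2)) *
          (ε / ((p.2 - q.2) ^ 2 + ε ^ 2)) :=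
        setIntegral_mono (integrable_mer_fixed hε q θ) h.integrableOn (fun p => mer_le hε p q θ)
    _ ≤ _ := setIntegral_le_integral h
      (Eventually.of_forall fun p => by simp only [Pi.zero_apply]; positivity)

lemma integrable_mer {ε : ℝ} (hε : 0 < ε) (q : ℝ × ℝ) :
    Integrable (fun x : (ℝ × ℝ) × ℝ => ε ^ 2 / (distSq q x.1 x.2 + ε ^ 2) ^ 2) merMeasure := by
  simp only [distSq_comm q]
  unfold merMeasure
  have hm : AEStronglyMeasurable (fun x : (ℝ × ℝ) × ℝ => ε ^ 2 / (distSq x.1 q x.2 + ε ^ 2) ^ 2)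
    ((volume.restrict halfPlane).prod (volume.restrict (Ioc 0 (2 * Real.pi)))) :=
    Measurable.aestronglyMeasurable (by fun_prop)
  rw [integrable_prod_iff' hm]
  refine ⟨Eventually.of_forall fun θ => integrable_mer_fixed hε q θ, ?_⟩
  refine Integrable.of_bound hm.norm.prod_swap.integral_prod_right' (Real.pi ^ 2)
    (Eventually.of_forall fun θ => ?_)
  rw [Real.norm_of_nonneg (integral_nonneg fun _ => norm_nonneg _)]
  refine le_trans (le_of_eq ?_) (integral_mer_fixed_le hε q θ)
  refine integral_congr_ae (Eventually.of_forall fun p => ?_)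
  simp only
  rw [Real.norm_of_nonneg (by positivity)]

lemma integral_mer_le {ε : ℝ} (hε : 0 < ε) (q : ℝ × ℝ) :
    ∫ x, ε ^ 2 / (distSq q x.1 x.2 + ε ^ 2) ^ 2 ∂merMeasure ≤ 2 * Real.pi ^ 3 := by
  have hi := integrable_mer hε q
  unfold merMeasure at hi ⊢
  rw [integral_prod_symm _ hi]
  have h1 : ∀ θ, ∫ p in halfPlane, ε ^ 2 / (distSq q p θ + ε ^ 2) ^ 2 ≤ Real.pi ^ 2 := fun θ => by
    simp only [distSq_comm q]; exact integral_mer_fixed_le hε q θ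
  calc _ ≤ ∫ θ in Ioc 0 (2 * Real.pi), Real.pi ^ 2 := by
        refine integral_mono hi.integral_prod_right (integrable_const _) h1
    _ = _ := by
        rw [integral_const, smul_eq_mul, measureReal_ang]; ring

/-- With the weight `r` the same kernel has mass `O(ε)`. -/
lemma integral_ang_quad_le {ε : ℝ} (hε : 0 < ε) {q : ℝ × ℝ} (hq : q ∈ halfPlane) :
    Integrable (fun x : (ℝ × ℝ) × ℝ => ε ^ 2 / (distSq q x.1 x.2 + ε ^ 2) ^ 2) angMeasure ∧
    ∫ x, ε ^ 2 / (distSq q x.1 x.2 + ε ^ 2) ^ 2 ∂angMeasure ≤ 2 * Real.pi ^ 2 * ε := by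
  have h1 := integrable_radial_two q hε
  have hle : ∀ᵐ x ∂angMeasure, ε ^ 2 / (distSq q x.1 x.2 + ε ^ 2) ^ 2 ≤
      ε ^ 2 / (distSq q x.1 x.2 * (distSq q x.1 x.2 + ε ^ 2)) := by
    filter_upwards [ae_ang_fst ae_axi_pos, ae_ang_fst (ae_axi_ne q)] with x hx hne
    have hd := distSq_pos (le_of_lt hq) hx.le hne x.2
    rw [sq (distSq q x.1 x.2 + ε ^ 2)]
    gcongr
    nlinarith
  have hi : Integrable (fun x : (ℝ × ℝ) × ℝ => ε ^ 2 / (distSq q x.1 x.2 +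
      ε ^ 2) ^ 2) angMeasure := by
    refine h1.mono' (Measurable.aestronglyMeasurable (by fun_prop)) ?_
    filter_upwards [hle] with x hx
    rwa [Real.norm_of_nonneg (by positivity)]
  refine ⟨hi, ?_⟩
  rw [← integral_radial_two q hε]
  exact integral_mono_ae hi h1 hle

lemma dist_sq_le_distSq {p q : ℝ × ℝ} (hp : 0 ≤ p.1) (hq : 0 ≤ q.1) (θ : ℝ) :
    (p.1 - q.1) ^ 2 + (p.2 - q.2) ^ 2 ≤ distSq p q θ := by
  unfold distSq
  nlinarith [mul_nonneg (mul_nonneg hp hq) (sub_nonneg.2 (Real.cos_le_one θ))]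

/-- Without the weight the mass still tends to zero: for `r ≥ q.1 / 2` the weight can be inserted,
and for `r < q.1 / 2` the kernel is `O(ε ^ 2)`. -/
lemma tendsto_integral_mer {q : ℝ × ℝ} (hq : q ∈ halfPlane) :
    Tendsto (fun ε => ∫ x, ε ^ 2 / (distSq q x.1 x.2 + ε ^ 2) ^ 2 ∂merMeasure) (𝓝[>] 0) (𝓝 0) := by
  have hq0 : 0 < q.1 := hq
  set g : (ℝ × ℝ) × ℝ → ℝ := fun x => (Ioo 0 (q.1 / 2)).indicator (fun _ => 4 / q.1 ^ 2) x.1.1 *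
    ((2 / q.1) * ((q.1 / 2) / ((x.1.2 - q.2) ^ 2 + (q.1 / 2) ^ 2))) with hg
  have hgi : Integrable g merMeasure := by
    have h1 : Integrable (fun r : ℝ => (Ioo 0 (q.1 / 2)).indicator (fun _ => 4 / q.1 ^ 2) r) :=
      (integrable_indicator_iff measurableSet_Ioo).2 (integrableOn_const (by simp))
    have h2 := h1.mul_prod ((integrable_cauchy (half_pos hq0) q.2).const_mul (2 / q.1))
    have h3 : Integrable _ (volume.restrict halfPlane) := h2.integrableOn (s := halfPlane)
    exact h3.comp_fst (volume.restrict (Ioc 0 (2 * Real.pi)))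
  have bound : ∀ ε, 0 < ε → ∫ x, ε ^ 2 / (distSq q x.1 x.2 + ε ^ 2) ^ 2 ∂merMeasure ≤
      (2 / q.1) * (2 * Real.pi ^ 2 * ε) + ε ^ 2 * ∫ x, g x ∂merMeasure := by
    intro ε hε
    obtain ⟨i1, b1⟩ := integral_ang_quad_le hε hq
    rw [integral_ang] at b1
    rw [integrable_ang] at i1
    have := integral_mono_ae (integrable_mer hε q) ((i1.const_mul (2 / q.1)).add
        (hgi.const_mul (ε ^ 2))) (by
      filter_upwards [ae_mer_pos] with x hx
      simp only [Pi.add_apply]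
      have hd := dist_sq_le_distSq hq0.le hx.le x.2
      by_cases h : x.1.1 < q.1 / 2
      · have e1 : 0 ≤ (2 / q.1) * (x.1.1 * (ε ^ 2 / (distSq q x.1 x.2 + ε ^ 2) ^ 2)) := by
          positivity
        have e2 : ε ^ 2 / (distSq q x.1 x.2 + ε ^ 2) ^ 2 ≤ ε ^ 2 * g x := by
          simp only [hg]
          rw [indicator_of_mem (show x.1.1 ∈ Ioo 0 (q.1 / 2) from ⟨hx, h⟩), div_eq_mul_inv]
          gcongr
          have e3 : 4 / q.1 ^ 2 * (2 / q.1 * (q.1 / 2 / ((x.1.2 - q.2) ^ 2 + (q.1 / 2) ^ 2))) =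
            ((q.1 / 2) ^ 2 * ((x.1.2 - q.2) ^ 2 + (q.1 / 2) ^ 2))⁻¹ := by
            have : 0 < (x.1.2 - q.2) ^ 2 + (q.1 / 2) ^ 2 := by positivity
            field_simp; norm_num
          rw [e3]
          apply inv_anti₀ (by positivity)
          rw [sq (distSq q x.1 x.2 + ε ^ 2)]
          have e4 : (q.1 / 2) ^ 2 ≤ (q.1 - x.1.1) ^ 2 := by
            have : q.1 / 2 ≤ q.1 - x.1.1 := by linarith
            gcongr
          have e5 : (q.2 - x.1.2) ^ 2 = (x.1.2 - q.2) ^ 2 := by ring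
          have e6 := sq_nonneg (x.1.2 - q.2)
          have e7 := sq_nonneg ε
          apply mul_le_mul
          · nlinarith
          · nlinarith
          · positivity
          · have := distSq_nonneg q x.1 x.2; positivity
        linarith
      · push Not at h
        have e1 : 0 ≤ ε ^ 2 * g x := by
          apply mul_nonneg (by positivity)
          simp only [hg]
          apply mul_nonneg
          · exact indicator_nonneg (fun _ _ => by positivity) _
          · positivity
        have e2 : ε ^ 2 / (distSq q x.1 x.2 + ε ^ 2) ^ 2 ≤
            (2 / q.1) * (x.1.1 * (ε ^ 2 / (distSq q x.1 x.2 + ε ^ 2) ^ 2)) := by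
          rw [← mul_assoc]
          apply le_mul_of_one_le_left (by positivity)
          rw [div_mul_eq_mul_div, one_le_div hq0]; linarith
        linarith)
    rw [integral_add' (i1.const_mul _) (hgi.const_mul _), integral_const_mul,
      integral_const_mul] at this
    refine this.trans ?_
    gcongr
  have lim : Tendsto (fun ε : ℝ => (2 / q.1) * (2 * Real.pi ^ 2 * ε) + ε ^ 2 * ∫ x, g x ∂merMeasure)
      (𝓝[>] 0) (𝓝 0) := by
    have : Continuous fun ε : ℝ => (2 / q.1) * (2 * Real.pi ^ 2 * ε) + ε ^ 2 * ∫ x,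
        g x ∂merMeasure := by fun_prop
    have h := this.tendsto 0
    simp only [mul_zero, ne_eq, OfNat.ofNat_ne_zero, not_false_eq_true, zero_pow, zero_mul,
      add_zero] at h
    exact h.mono_left nhdsWithin_le_nhds
  refine squeeze_zero' ?_ ?_ lim
  · exact Eventually.of_forall fun ε => integral_nonneg fun x => by
      simp only [Pi.zero_apply]; positivity
  · filter_upwards [self_mem_nhdsWithin] with ε hε using bound ε hε

/-- The operator on test functions dual to `vortReg`: see `integral_mul_vortReg`. -/
def dualSmooth (ε : ℝ) (F : ℝ × ℝ → ℝ) (q : ℝ × ℝ) : ℝ :=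
  (1 / (4 * Real.pi)) * ∫ x, F x.1 * (q.1 * Real.cos x.2) *
  (3 * ε ^ 2 / √(distSq q x.1 x.2 + ε ^ 2) ^ 5) ∂merMeasure

section
variable {F : ℝ × ℝ → ℝ} {K ε : ℝ}

lemma bump_mul_le (hε : 0 < ε) {q p : ℝ × ℝ} {θ a : ℝ} (ha : |a| ≤ √(distSq q p θ)) :
    |a| * (3 * ε ^ 2 / √(distSq q p θ + ε ^ 2) ^ 5) ≤ 3 * (ε ^ 2 / (distSq q p θ + ε ^ 2) ^ 2) := by
  have hn := sqrt_pos_of_pos hε q p θ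
  have hn2 := Real.sq_sqrt (by have := distSq_nonneg q p θ; positivity : 0 ≤ distSq q p θ + ε ^ 2)
  have h1 := ha.trans (sqrt_le_sqrt_reg ε q p θ)
  rw [show (distSq q p θ + ε ^ 2) ^ 2 = √(distSq q p θ + ε ^ 2) ^ 4 by
    rw [show (4 : ℕ) = 2 * 2 from rfl, pow_mul, hn2]]
  generalize √(distSq q p θ + ε ^ 2) = n at *
  calc _ ≤ n * (3 * ε ^ 2 / n ^ 5) := by gcongr
    _ = _ := by field_simp

lemma integrable_main (hF : Measurable F) (hK : ∀ p, |F p| ≤ K) (hε : 0 < ε) (q : ℝ × ℝ) :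
    Integrable (fun x : (ℝ × ℝ) × ℝ => F x.1 * (3 * ε ^ 2 / √(distSq q x.1 x.2 + ε ^ 2) ^ 5))
      angMeasure :=
  (integrable_radial_bump q hε).bdd_mul (c := K) (hF.comp measurable_fst).aestronglyMeasurable
    (Eventually.of_forall fun x => hK x.1)

lemma integrable_rem (hF : Measurable F) (hK : ∀ p, |F p| ≤ K) (hε : 0 < ε) (q : ℝ × ℝ) :
    Integrable (fun x : (ℝ × ℝ) × ℝ =>
      F x.1 * (numZ q x.1 x.2 * (3 * ε ^ 2 / √(distSq q x.1 x.2 + ε ^ 2) ^ 5))) merMeasure := by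
  refine Integrable.bdd_mul (c := K) ?_ (hF.comp measurable_fst).aestronglyMeasurable
    (Eventually.of_forall fun x => hK x.1)
  refine ((integrable_mer hε q).const_mul 3).mono' (Measurable.aestronglyMeasurable
    (by unfold numZ; fun_prop))
    (Eventually.of_forall fun x => ?_)
  rw [norm_mul, Real.norm_eq_abs, Real.norm_of_nonneg (by positivity)]
  exact bump_mul_le hε (isNumerator_numZ.abs_le q x.1 x.2)

/-- Writing `q.1 cos θ = p.1 + numZ q p θ` splits the dual operator into a convolution in
three-space with a mollifier of mass one, and a remainder whose kernel carries a factor of the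
distance. -/
lemma dualSmooth_eq (hF : Measurable F) (hK : ∀ p, |F p| ≤ K) (hε : 0 < ε) (q : ℝ × ℝ) :
    dualSmooth ε F q = (1 / (4 * Real.pi)) * ∫ x,
      F x.1 * (3 * ε ^ 2 / √(distSq q x.1 x.2 + ε ^ 2) ^ 5) ∂angMeasure
      + (1 / (4 * Real.pi)) * ∫ x,
        F x.1 * (numZ q x.1 x.2 * (3 * ε ^ 2 / √(distSq q x.1 x.2 + ε ^ 2) ^ 5)) ∂merMeasure := by
  have i1 := integrable_main hF hK hε q
  rw [integrable_ang] at i1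
  rw [integral_ang, ← mul_add, ← integral_add i1 (integrable_rem hF hK hε q), dualSmooth]
  congr 1
  refine integral_congr_ae (Eventually.of_forall fun x => ?_)
  simp only [numZ]
  ring

lemma abs_rem_le (hK : ∀ p, |F p| ≤ K) (hε : 0 < ε) (q : ℝ × ℝ) :
    |(1 / (4 * Real.pi)) * ∫ x,
      F x.1 * (numZ q x.1 x.2 * (3 * ε ^ 2 / √(distSq q x.1 x.2 + ε ^ 2) ^ 5)) ∂merMeasure|
      ≤ K * ∫ x, ε ^ 2 / (distSq q x.1 x.2 + ε ^ 2) ^ 2 ∂merMeasure := by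
  have hK0 : 0 ≤ K := (abs_nonneg _).trans (hK 0)
  have h : |∫ x, F x.1 * (numZ q x.1 x.2 * (3 * ε ^ 2 / √(distSq q x.1 x.2 +
      ε ^ 2) ^ 5)) ∂merMeasure| ≤
      ∫ x, (K * 3) * (ε ^ 2 / (distSq q x.1 x.2 + ε ^ 2) ^ 2) ∂merMeasure := by
    rw [← Real.norm_eq_abs]
    refine norm_integral_le_of_norm_le ((integrable_mer hε q).const_mul _)
      (Eventually.of_forall fun x => ?_)
    rw [norm_mul, norm_mul, Real.norm_eq_abs, Real.norm_eq_abs, Real.norm_of_nonneg (by positivity),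
      mul_assoc]
    exact mul_le_mul (hK _) (bump_mul_le hε (isNumerator_numZ.abs_le q x.1 x.2)) (by positivity) hK0
  rw [integral_const_mul] at h
  have h0 : 0 ≤ K * ∫ x, ε ^ 2 / (distSq q x.1 x.2 + ε ^ 2) ^ 2 ∂merMeasure :=
    mul_nonneg hK0 (integral_nonneg fun x => by simp only [Pi.zero_apply]; positivity)
  rw [abs_mul, abs_of_pos (by positivity), one_div_mul_eq_div, div_le_iff₀ (by positivity)]
  nlinarith [Real.pi_gt_three]

lemma abs_dualSmooth_le (hF : Measurable F) (hK : ∀ p, |F p| ≤ K) (hε : 0 < ε) (q : ℝ × ℝ) :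
    |dualSmooth ε F q| ≤ K * (1 + 2 * Real.pi ^ 3) := by
  have hK0 : 0 ≤ K := (abs_nonneg _).trans (hK 0)
  rw [dualSmooth_eq hF hK hε]
  refine (abs_add_le _ _).trans ?_
  have h1 := abs_rem_le hK hε q
  have h2 := mul_le_mul_of_nonneg_left (integral_mer_le hε q) hK0
  have h3 : |∫ x, F x.1 * (3 * ε ^ 2 / √(distSq q x.1 x.2 + ε ^ 2) ^ 5) ∂angMeasure| ≤
      ∫ x, K * (3 * ε ^ 2 / √(distSq q x.1 x.2 + ε ^ 2) ^ 5) ∂angMeasure := by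
    rw [← Real.norm_eq_abs]
    refine norm_integral_le_of_norm_le ((integrable_radial_bump q hε).const_mul _)
      (Eventually.of_forall fun x => ?_)
    rw [norm_mul, Real.norm_eq_abs, Real.norm_of_nonneg (by positivity)]
    have := hK x.1
    gcongr
  rw [integral_const_mul, integral_radial_bump q hε] at h3
  have h4 : |(1 / (4 * Real.pi)) * ∫ x, F x.1 * (3 * ε ^ 2 / √(distSq q x.1 x.2 +
      ε ^ 2) ^ 5) ∂angMeasure| ≤ K := by
    rw [abs_mul, abs_of_pos (by positivity), one_div_mul_eq_div, div_le_iff₀ (by positivity)]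
    exact h3
  linarith

lemma tendsto_dualSmooth (hF : Measurable F) (hK : ∀ p, |F p| ≤ K) {q : ℝ × ℝ} (hq : q ∈ halfPlane)
    (hc : ContinuousAt F q) : Tendsto (fun ε => dualSmooth ε F q) (𝓝[>] 0) (𝓝 (F q)) := by
  have hq0 : 0 < q.1 := hq
  have hK0 : 0 ≤ K := (abs_nonneg _).trans (hK 0)
  rw [Metric.tendsto_nhds]
  intro e he
  obtain ⟨δ, hδ, hcont⟩ := Metric.continuousAt_iff.1 hc (e / 4) (by positivity)
  have lim1 := (tendsto_integral_mer hq).const_mul K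
  rw [mul_zero] at lim1
  have lim2 : Tendsto (fun ε : ℝ => (2 * K / δ) * (3 * (2 * Real.pi ^ 2 * ε))) (𝓝[>] 0) (𝓝 0) := by
    have : Continuous fun ε : ℝ => (2 * K / δ) * (3 * (2 * Real.pi ^ 2 * ε)) := by fun_prop
    have h := this.tendsto 0
    simp only [mul_zero] at h
    exact h.mono_left nhdsWithin_le_nhds
  filter_upwards [self_mem_nhdsWithin, lim1.eventually (gt_mem_nhds (show 0 < e / 4 by positivity)),
    lim2.eventually (gt_mem_nhds (show 0 < e / 4 by positivity))] with ε hε b1 b2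
  have hε : 0 < ε := hε
  rw [Real.dist_eq, dualSmooth_eq hF hK hε, add_sub_right_comm]
  refine (abs_add_le _ _).trans_lt ?_
  have r1 := abs_rem_le hK hε q
  obtain ⟨i2, b3⟩ := integral_ang_quad_le hε hq
  have e1 : (1 / (4 * Real.pi)) * ∫ x, F x.1 * (3 * ε ^ 2 / √(distSq q x.1 x.2 +
      ε ^ 2) ^ 5) ∂angMeasure - F q =
      (1 / (4 * Real.pi)) * ∫ x, (F x.1 - F q) * (3 * ε ^ 2 / √(distSq q x.1 x.2 +
      ε ^ 2) ^ 5) ∂angMeasure := by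
    simp only [sub_mul]
    rw [integral_sub (integrable_main hF hK hε q) ((integrable_radial_bump q hε).const_mul _),
      integral_const_mul, integral_radial_bump q hε, mul_sub]
    congr 1
    field_simp
  have r2 : |∫ x, (F x.1 - F q) * (3 * ε ^ 2 / √(distSq q x.1 x.2 + ε ^ 2) ^ 5) ∂angMeasure| ≤
      ∫ x, (e / 4 * (3 * ε ^ 2 / √(distSq q x.1 x.2 + ε ^ 2) ^ 5) +
        (2 * K / δ * 3) * (ε ^ 2 / (distSq q x.1 x.2 + ε ^ 2) ^ 2)) ∂angMeasure := by
    rw [← Real.norm_eq_abs]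
    refine norm_integral_le_of_norm_le (((integrable_radial_bump q hε).const_mul _).add
      (i2.const_mul _)) ?_
    filter_upwards [ae_ang_fst ae_axi_pos] with x hx
    rw [norm_mul, Real.norm_eq_abs, Real.norm_of_nonneg (by positivity)]
    by_cases h : dist x.1 q < δ
    · have h1 := (hcont h).le
      rw [Real.dist_eq] at h1
      have h2 : 0 ≤ (2 * K / δ * 3) * (ε ^ 2 / (distSq q x.1 x.2 + ε ^ 2) ^ 2) := by positivity
      have h3 : |F x.1 - F q| * (3 * ε ^ 2 / √(distSq q x.1 x.2 + ε ^ 2) ^ 5) ≤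
          e / 4 * (3 * ε ^ 2 / √(distSq q x.1 x.2 + ε ^ 2) ^ 5) := by gcongr
      linarith
    · push Not at h
      have hd : δ ≤ √(distSq q x.1 x.2) := by
        refine h.trans ?_
        rw [dist_comm, Prod.dist_eq]
        have hd := dist_sq_le_distSq hq0.le hx.le x.2
        refine max_le ?_ ?_
        · rw [Real.dist_eq]; apply Real.abs_le_sqrt; nlinarith [sq_nonneg (q.2 - x.1.2)]
        · rw [Real.dist_eq]; apply Real.abs_le_sqrt; nlinarith [sq_nonneg (q.1 - x.1.1)]
      have h1 : |F x.1 - F q| ≤ 2 * K / δ * √(distSq q x.1 x.2) := by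
        calc |F x.1 - F q| ≤ |F x.1| + |F q| := abs_sub _ _
          _ ≤ 2 * K := by linarith [hK x.1, hK q]
          _ = 2 * K / δ * δ := by field_simp
          _ ≤ _ := by gcongr
      have h2 := bump_mul_le hε (a := √(distSq q x.1 x.2)) (q := q) (p := x.1) (θ := x.2)
          (by rw [abs_of_nonneg (Real.sqrt_nonneg _)])
      rw [abs_of_nonneg (Real.sqrt_nonneg _)] at h2
      have h3 : 0 ≤ e / 4 * (3 * ε ^ 2 / √(distSq q x.1 x.2 + ε ^ 2) ^ 5) := by positivity
      calc _ ≤ 2 * K / δ * √(distSq q x.1 x.2) * (3 * ε ^ 2 / √(distSq q x.1 x.2 + ε ^ 2) ^ 5) := by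
            gcongr
        _ = 2 * K / δ * (√(distSq q x.1 x.2) * (3 * ε ^ 2 / √(distSq q x.1 x.2 + ε ^ 2) ^ 5)) := by
          ring
        _ ≤ 2 * K / δ * (3 * (ε ^ 2 / (distSq q x.1 x.2 + ε ^ 2) ^ 2)) := by gcongr
        _ ≤ _ := by linarith
  rw [integral_add ((integrable_radial_bump q hε).const_mul _) (i2.const_mul _), integral_const_mul,
    integral_const_mul, integral_radial_bump q hε] at r2
  have r3 : 2 * K / δ * 3 * ∫ x, ε ^ 2 / (distSq q x.1 x.2 + ε ^ 2) ^ 2 ∂angMeasure ≤ e / 4 := by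
    calc _ ≤ 2 * K / δ * 3 * (2 * Real.pi ^ 2 * ε) := by gcongr
      _ = 2 * K / δ * (3 * (2 * Real.pi ^ 2 * ε)) := by ring
      _ ≤ _ := b2.le
  have r4 : |(1 / (4 * Real.pi)) * ∫ x, F x.1 * (3 * ε ^ 2 / √(distSq q x.1 x.2 +
      ε ^ 2) ^ 5) ∂angMeasure - F q| ≤ e / 4 + e / 4 := by
    rw [e1, abs_mul, abs_of_pos (by positivity), one_div_mul_eq_div, div_le_iff₀ (by positivity)]
    nlinarith [Real.pi_gt_three]
  linarith

variable {w : ℝ × ℝ → ℝ} {M N : ℝ}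

lemma integrable_prod_bump (hw : IsDensity w M N) (hF : Measurable F) (hK : ∀ p, |F p| ≤ K)
    (hε : 0 < ε) :
    Integrable (fun y : (ℝ × ℝ) × ((ℝ × ℝ) × ℝ) =>
      F y.1 * (Real.cos y.2.2 * (3 * ε ^ 2 / √(distSq y.1 y.2.1 y.2.2 + ε ^ 2) ^ 5) * w y.2.1))
      ((volume.restrict halfPlane).prod angMeasure) := by
  have hK0 : 0 ≤ K := (abs_nonneg _).trans (hK 0)
  have hw' : AEStronglyMeasurable (fun y : (ℝ × ℝ) × ((ℝ × ℝ) × ℝ) => w y.2.1)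
      ((volume.restrict halfPlane).prod angMeasure) :=
    (integrable_ang_fst hw.integrable).aestronglyMeasurable.comp_snd
  have hm : AEStronglyMeasurable (fun y : (ℝ × ℝ) × ((ℝ × ℝ) × ℝ) =>
      F y.1 * (Real.cos y.2.2 * (3 * ε ^ 2 / √(distSq y.1 y.2.1 y.2.2 + ε ^ 2) ^ 5) * w y.2.1))
      ((volume.restrict halfPlane).prod angMeasure) := by
    refine (hF.comp measurable_fst).aestronglyMeasurable.mul
      (AEStronglyMeasurable.mul (Measurable.aestronglyMeasurable ?_) hw')
    fun_prop
  have hpt : ∀ (p : ℝ × ℝ) (x : (ℝ × ℝ) × ℝ),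
      ‖F p * (Real.cos x.2 * (3 * ε ^ 2 / √(distSq p x.1 x.2 + ε ^ 2) ^ 5) * w x.1)‖ ≤
      (K * (3 / ε) * |w x.1|) * (ε ^ 2 / (distSq p x.1 x.2 + ε ^ 2) ^ 2) := by
    intro p x
    rw [norm_mul, norm_mul, norm_mul, Real.norm_eq_abs, Real.norm_eq_abs, Real.norm_eq_abs (w x.1),
      Real.norm_of_nonneg (by positivity)]
    have h1 : 3 * ε ^ 2 / √(distSq p x.1 x.2 + ε ^ 2) ^ 5 ≤
        (3 / ε) * (ε ^ 2 / (distSq p x.1 x.2 + ε ^ 2) ^ 2) := by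
      have hn := sqrt_pos_of_pos hε p x.1 x.2
      have hn2 := Real.sq_sqrt
          (by have := distSq_nonneg p x.1 x.2; positivity : 0 ≤ distSq p x.1 x.2 + ε ^ 2)
      have h3 : ε ≤ √(distSq p x.1 x.2 + ε ^ 2) := le_sqrt_reg p x.1 x.2
      rw [show (distSq p x.1 x.2 + ε ^ 2) ^ 2 = √(distSq p x.1 x.2 + ε ^ 2) ^ 4 by
        rw [show (4 : ℕ) = 2 * 2 from rfl, pow_mul, hn2]]
      generalize √(distSq p x.1 x.2 + ε ^ 2) = n at *
      calc 3 * ε ^ 2 / n ^ 5 = 3 * ε ^ 2 / (n * n ^ 4) := by ring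
        _ ≤ 3 * ε ^ 2 / (ε * n ^ 4) := by gcongr
        _ = _ := by field_simp
    calc _ ≤ K * (1 * ((3 / ε) * (ε ^ 2 / (distSq p x.1 x.2 + ε ^ 2) ^ 2)) * |w x.1|) := by
          gcongr
          · exact hK p
          · exact Real.abs_cos_le_one _
      _ = _ := by ring
  rw [integrable_prod_iff' hm]
  have hsec : ∀ᵐ x ∂angMeasure, Integrable (fun p =>
      F p * (Real.cos x.2 * (3 * ε ^ 2 / √(distSq p x.1 x.2 + ε ^ 2) ^ 5) * w x.1))
      (volume.restrict halfPlane) := by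
    refine Eventually.of_forall fun x => ?_
    refine ((integrable_mer_fixed hε x.1 x.2).const_mul (K * (3 / ε) * |w x.1|)).mono' ?_
      (Eventually.of_forall fun p => hpt p x)
    exact Measurable.aestronglyMeasurable (by fun_prop)
  refine ⟨hsec, ?_⟩
  refine (((integrable_ang_fst hw.integrable).abs.const_mul (K * (3 / ε) * Real.pi ^ 2))).mono'
    hm.norm.prod_swap.integral_prod_right' ?_
  filter_upwards [hsec] with x hx
  rw [Real.norm_of_nonneg (integral_nonneg fun _ => norm_nonneg _)]
  calc _ ≤ ∫ p in halfPlane, (K * (3 / ε) * |w x.1|) * (ε ^ 2 / (distSq p x.1 x.2 + ε ^ 2) ^ 2) :=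
        integral_mono hx.norm ((integrable_mer_fixed hε x.1 x.2).const_mul _) (fun p => hpt p x)
    _ ≤ (K * (3 / ε) * |w x.1|) * Real.pi ^ 2 := by
        rw [integral_const_mul]
        have := integral_mer_fixed_le hε x.1 x.2
        gcongr
    _ = _ := by ring

lemma integrableOn_mul_vortReg (hw : IsDensity w M N) (hF : Measurable F) (hK : ∀ p, |F p| ≤ K)
    (hε : 0 < ε) :
    IntegrableOn (fun p => F p * vortReg ε w p) halfPlane := by
  have h := (integrable_prod_bump hw hF hK hε).integral_prod_left
  simp only [integral_const_mul] at h
  refine (h.const_mul (1 / (4 * Real.pi))).congr (Eventually.of_forall fun p => ?_)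
  simp only [vortReg]; ring

lemma integral_mul_vortReg (hw : IsDensity w M N) (hF : Measurable F) (hK : ∀ p, |F p| ≤ K)
    (hε : 0 < ε) :
    ∫ p in halfPlane, F p * vortReg ε w p = ∫ q, (w q / q.1) * dualSmooth ε F q ∂axiMeasure := by
  have hi := integrable_prod_bump hw hF hK hε
  have h1 := integral_integral_swap (f := fun (p : ℝ × ℝ) (x : (ℝ × ℝ) × ℝ) =>
      F p * (Real.cos x.2 * (3 * ε ^ 2 / √(distSq p x.1 x.2 + ε ^ 2) ^ 5) * w x.1)) hi
  have h2 : ∫ p in halfPlane, F p * vortReg ε w p = (1 / (4 * Real.pi)) * ∫ p in halfPlane, ∫ x,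
      F p * (Real.cos x.2 * (3 * ε ^ 2 / √(distSq p x.1 x.2 + ε ^ 2) ^ 5) * w x.1) ∂angMeasure := by
    rw [← integral_const_mul]
    refine integral_congr_ae (Eventually.of_forall fun p => ?_)
    simp only [vortReg, integral_const_mul]
    ring
  rw [h2, h1]
  have h3 := hi.integral_prod_right
  simp only at h3
  unfold angMeasure at h3 ⊢
  rw [integral_prod _ h3, ← integral_const_mul]
  refine integral_congr_ae ?_
  filter_upwards [ae_axi_pos] with q hq
  have i1 := integrable_main hF hK hε q
  rw [integrable_ang] at i1
  have i2 := integrable_rem hF hK hε q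
  have i3 : Integrable (fun x : (ℝ × ℝ) × ℝ =>
      F x.1 * (Real.cos x.2 * (3 * ε ^ 2 / √(distSq x.1 q x.2 + ε ^ 2) ^ 5) * w q)) merMeasure := by
    refine ((i1.add i2).const_mul (w q / q.1)).congr (Eventually.of_forall fun x => ?_)
    simp only [Pi.add_apply, numZ, distSq_comm q x.1]
    field_simp
    ring
  unfold dualSmooth
  unfold merMeasure at i3 ⊢
  have e := integral_prod_symm _ i3
  rw [← e, ← integral_const_mul, ← integral_const_mul, ← integral_const_mul]
  refine integral_congr_ae (Eventually.of_forall fun x => ?_)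
  simp only [distSq_comm q x.1]
  field_simp

/-- The regularised vorticity converges weakly to `w` as measures `w dr dz`, also against bounded
test functions that are discontinuous on a null set. -/
lemma tendsto_integral_vortReg (hw : IsDensity w M N) {M' N' : ℝ}
    (hξ : IsDensity (fun q => w q / q.1) M' N')
    (hF : Measurable F) (hK : ∀ p, |F p| ≤ K) (hc : ∀ᵐ q ∂axiMeasure, ContinuousAt F q) :
    Tendsto (fun ε => ∫ p in halfPlane, F p * vortReg ε w p) (𝓝[>] 0)
      (𝓝 (∫ p in halfPlane, F p * w p)) := by
  have e : ∫ p in halfPlane, F p * w p = ∫ q, (w q / q.1) * F q ∂axiMeasure := by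
    rw [integral_axi]
    refine setIntegral_congr_fun measurableSet_halfPlane fun q hq => ?_
    have : 0 < q.1 := hq
    field_simp
  rw [e]
  have h1 : Tendsto (fun ε => ∫ q, (w q / q.1) * dualSmooth ε F q ∂axiMeasure) (𝓝[>] 0)
      (𝓝 (∫ q, (w q / q.1) * F q ∂axiMeasure)) := by
    refine tendsto_integral_filter_of_dominated_convergence (fun q =>
      |w q / q.1| * (K * (1 + 2 * Real.pi ^ 3))) ?_ ?_
      (hξ.integrable.abs.mul_const _) ?_
    · filter_upwards [self_mem_nhdsWithin] with ε hε
      refine hξ.integrable.aestronglyMeasurable.mul ?_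
      unfold dualSmooth
      refine (StronglyMeasurable.aestronglyMeasurable ?_).const_mul _
      apply StronglyMeasurable.integral_prod_right
      apply Measurable.stronglyMeasurable
      simp only [Function.uncurry_def]
      fun_prop
    · filter_upwards [self_mem_nhdsWithin] with ε hε
      refine Eventually.of_forall fun q => ?_
      rw [norm_mul, Real.norm_eq_abs, Real.norm_eq_abs]
      have := abs_dualSmooth_le hF hK hε q
      gcongr
    · filter_upwards [hc, ae_mem_halfPlane] with q hq hqh
      exact (tendsto_dualSmooth hF hK hqh hq).const_mul _
  refine h1.congr' ?_
  filter_upwards [self_mem_nhdsWithin] with ε hε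
  exact (integral_mul_vortReg hw hF hK hε).symm

lemma integral_abs_vortReg_le (hw : IsDensity w M N) {M' N' : ℝ}
    (hξ : IsDensity (fun q => w q / q.1) M' N') (hε : 0 < ε) :
    IntegrableOn (vortReg ε w) halfPlane ∧ ∫ p in halfPlane, |vortReg ε w p| ≤
      (1 + 2 * Real.pi ^ 3) * N' := by
  have hcont := continuous_vortReg hw hε
  constructor
  · have := integrableOn_mul_vortReg hw (F := fun _ => 1) (K := 1) measurable_const (by simp) hε
    simpa using this
  -- duality with the sign of the regularised vorticity as test function
  · set F : ℝ × ℝ → ℝ := fun p => if 0 ≤ vortReg ε w p then 1 else -1 with hFdef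
    have hF : Measurable F := Measurable.ite (measurableSet_le measurable_const hcont.measurable)
        measurable_const measurable_const
    have hK : ∀ p, |F p| ≤ 1 := fun p => by
      simp only [hFdef]; split_ifs <;> simp
    have e : ∫ p in halfPlane, |vortReg ε w p| = ∫ p in halfPlane, F p * vortReg ε w p := by
      refine integral_congr_ae (Eventually.of_forall fun p => ?_)
      simp only [hFdef]
      split_ifs with h
      · rw [abs_of_nonneg h, one_mul]
      · rw [abs_of_neg (not_le.1 h)]; ring
    rw [e, integral_mul_vortReg hw hF hK hε]
    calc _ ≤ |∫ q, (w q / q.1) * dualSmooth ε F q ∂axiMeasure| := le_abs_self _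
      _ ≤ ∫ q, (1 + 2 * Real.pi ^ 3) * |w q / q.1| ∂axiMeasure := by
          rw [← Real.norm_eq_abs]
          refine norm_integral_le_of_norm_le (hξ.integrable.abs.const_mul _)
            (Eventually.of_forall fun q => ?_)
          rw [norm_mul, Real.norm_eq_abs, Real.norm_eq_abs, mul_comm]
          have := abs_dualSmooth_le hF hK hε q
          rw [one_mul] at this
          gcongr
      _ ≤ _ := by
          rw [integral_const_mul]
          have := hξ.integral_le
          gcongr

end

/-! ### The divergence theorem on squares -/

/-- The open square `(0, B) × (0, B)` of the meridional plane. -/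
def box (B : ℝ) : Set (ℝ × ℝ) := Ioo 0 B ×ˢ Ioo 0 B

lemma measurableSet_box (B : ℝ) : MeasurableSet (box B) := measurableSet_Ioo.prod measurableSet_Ioo

lemma volume_box_ne_top (B : ℝ) : volume (box B) ≠ ⊤ := by
  rw [box, Measure.volume_eq_prod, Measure.prod_prod]
  exact ENNReal.mul_ne_top (by simp) (by simp)

lemma box_subset_quadrant (B : ℝ) : box B ⊆ quadrant := fun _ hp => ⟨hp.1.1, hp.2.1⟩

lemma box_subset_halfPlane (B : ℝ) : box B ⊆ halfPlane := fun _ hp => hp.1.1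

lemma box_ae_eq_Icc (B : ℝ) : box B =ᵐ[volume] Icc ((0 : ℝ), (0 : ℝ)) (B, B) := by
  rw [box, ← Icc_prod_Icc, Measure.volume_eq_prod]
  exact Measure.set_prod_ae_eq Ioo_ae_eq_Icc Ioo_ae_eq_Icc

lemma _root_.Continuous.integrableOn_box {f : ℝ × ℝ → ℝ} (hf : Continuous f) (B : ℝ) :
    IntegrableOn f (box B) :=
  (hf.continuousOn.integrableOn_compact (isCompact_Icc (a := ((0 : ℝ), (0 : ℝ)))
  (b := (B, B)))).congr_set_ae
    (box_ae_eq_Icc B)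

lemma integrableOn_box_of_bound {f : ℝ × ℝ → ℝ} (hf : Measurable f) {B C : ℝ}
    (h : ∀ p ∈ box B, |f p| ≤ C) : IntegrableOn f (box B) :=
  Measure.integrableOn_of_bounded (volume_box_ne_top B) hf.aestronglyMeasurable (M := C)
    ((ae_restrict_mem (measurableSet_box B)).mono h)

/-- The divergence theorem on `box B` for a field `(F, G)` whose normal component vanishes on every
side except the one on the axis. -/
lemma integral_div_box {B : ℝ} (hB : 0 ≤ B) {F G D : ℝ × ℝ → ℝ} (hF : Continuous F)
    (hG : Continuous G)
    (hD : ∀ p ∈ box B, ∃ F' G' : ℝ × ℝ →L[ℝ] ℝ, HasFDerivAt F F' p ∧ HasFDerivAt G G' p ∧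
      F' (1, 0) + G' (0, 1) = D p)
    (hi : IntegrableOn D (box B)) (h1 : ∀ z, F (B, z) = 0) (h2 : ∀ r, G (r, B) = 0)
    (h3 : ∀ r, G (r, 0) = 0) : ∫ p in box B, D p = -∫ z in (0 : ℝ)..B, F (0, z) := by
  have hD' : ∀ p, ∃ F' G' : ℝ × ℝ →L[ℝ] ℝ, p ∈ box B → HasFDerivAt F F' p ∧ HasFDerivAt G G' p ∧
      F' (1, 0) + G' (0, 1) = D p := by
    intro p
    by_cases hp : p ∈ box B
    · obtain ⟨F', G', h⟩ := hD p hp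
      exact ⟨F', G', fun _ => h⟩
    · exact ⟨0, 0, fun h => (hp h).elim⟩
  choose F' G' hFG using hD'
  have hle : ((0 : ℝ), (0 : ℝ)) ≤ (B, B) := ⟨hB, hB⟩
  have hi' : IntegrableOn (fun x => F' x (1, 0) + G' x (0, 1)) (box B) :=
    hi.congr_fun (fun p hp => (hFG p hp).2.2.symm) (measurableSet_box B)
  have key := integral_divergence_prod_Icc_of_hasFDerivAt_of_le F G F' G' (0, 0) (B, B) hle
    hF.continuousOn hG.continuousOn (fun p hp => (hFG p hp).1) (fun p hp => (hFG p hp).2.1)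
    (hi'.congr_set_ae (box_ae_eq_Icc B).symm)
  simp only [h1, h2, h3, intervalIntegral.integral_zero, sub_zero, add_zero, zero_sub] at key
  rw [← key, ← setIntegral_congr_set (box_ae_eq_Icc B)]
  exact setIntegral_congr_fun (measurableSet_box B) fun p hp => (hFG p hp).2.2.symm

lemma tendsto_setIntegral_of_bound {α : Type*} [MeasurableSpace α] {μ : Measure α} {s : Set α}
    (hs : MeasurableSet s) (hμ : μ s ≠ ⊤) {G : ℝ → α → ℝ} {g : α → ℝ} {C : ℝ}
    (hm : ∀ ε, 0 < ε → Measurable (G ε)) (hb : ∀ ε, 0 < ε → ∀ p ∈ s, |G ε p| ≤ C)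
    (hl : ∀ p ∈ s, Tendsto (fun ε => G ε p) (𝓝[>] 0) (𝓝 (g p))) :
    Tendsto (fun ε => ∫ p in s, G ε p ∂μ) (𝓝[>] 0) (𝓝 (∫ p in s, g p ∂μ)) := by
  refine tendsto_integral_filter_of_dominated_convergence (fun _ => C) ?_ ?_
    (integrableOn_const hμ) ?_
  · filter_upwards [self_mem_nhdsWithin] with ε hε using (hm ε hε).aestronglyMeasurable
  · filter_upwards [self_mem_nhdsWithin] with ε hε
    filter_upwards [ae_restrict_mem hs] with p hp using hb ε hε p hp
  · filter_upwards [ae_restrict_mem hs] with p hp using hl p hp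

section
variable {w : ℝ × ℝ → ℝ} {M N M' N' ε B : ℝ}

lemma continuous_vel_numR (hw : IsDensity w M N) (hε : 0 < ε) : Continuous (vel numR ε w) :=
  continuous_iff_continuousAt.2 fun p => (hasFDerivAt_vel_numR hw hε p).continuousAt

lemma continuous_vel_numZ (hw : IsDensity w M N) (hε : 0 < ε) : Continuous (vel numZ ε w) :=
  continuous_iff_continuousAt.2 fun p => (hasFDerivAt_vel_numZ hw hε p).continuousAt

lemma tendsto_vel {ν : ℝ × ℝ → ℝ × ℝ → ℝ → ℝ} (hν : IsNumerator ν) (hw : IsDensity w M N)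
    (p : ℝ × ℝ) :
    Tendsto (fun ε => vel ν ε w p) (𝓝[>] 0) (𝓝 (vel ν 0 w p)) := by
  have lim : Tendsto (fun ε : ℝ => 6 * Real.pi * M * ε) (𝓝[>] 0) (𝓝 0) := by
    have h : Continuous fun ε : ℝ => 6 * Real.pi * M * ε := by fun_prop
    simpa using (h.tendsto 0).mono_left nhdsWithin_le_nhds
  rw [tendsto_iff_dist_tendsto_zero]
  refine squeeze_zero' (Eventually.of_forall fun _ => dist_nonneg) ?_ lim
  filter_upwards [self_mem_nhdsWithin] with ε hε
  rw [dist_comm, Real.dist_eq]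
  exact abs_vel_sub_reg_le hν hw hε p

lemma vel_numR_axis (hw : IsDensity w M N) (hξ : IsDensity (fun q => w q / q.1) M' N') (ε z : ℝ) :
    vel numR ε w (0, z) = 0 := by
  have h := abs_vel_numR_le' hw hξ (p := (0, z)) le_rfl ε
  rw [mul_zero] at h
  exact abs_nonpos_iff.1 h

/-- Convergence of the integrals of the regularised vorticity over a square, against coefficients
converging uniformly at rate `ε`. -/
lemma tendsto_integral_box_vortReg (hw : IsDensity w M N)
    (hξ : IsDensity (fun q => w q / q.1) M' N')
    {c : ℝ → ℝ × ℝ → ℝ} {K L : ℝ} (hc : ∀ ε, 0 ≤ ε → Continuous (c ε))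
    (hK : ∀ p ∈ box B, |c 0 p| ≤ K)
    (hL : ∀ ε, 0 < ε → ∀ p ∈ box B, |c ε p - c 0 p| ≤ L * ε) :
    Tendsto (fun ε => ∫ p in box B, c ε p * vortReg ε w p) (𝓝[>] 0)
      (𝓝 (∫ p in box B, c 0 p * w p)) := by
  have hmul : ∀ v : ℝ × ℝ → ℝ, ∫ p in halfPlane, (box B).indicator (c 0) p * v p = ∫ p in box B,
      c 0 p * v p := by
    intro v
    have : (fun p => (box B).indicator (c 0) p * v p) = (box B).indicator fun p => c 0 p * v p := by
      funext p; by_cases hp : p ∈ box B <;> simp [hp]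
    rw [this, setIntegral_indicator (measurableSet_box B),
      inter_eq_self_of_subset_right (box_subset_halfPlane B)]
  have hcont : ∀ᵐ q ∂axiMeasure, ContinuousAt ((box B).indicator (c 0)) q := by
    rw [ae_axi_iff]
    refine ae_restrict_of_ae ?_
    have h0 : volume (frontier (box B)) = 0 :=
      ((convex_Ioo 0 B).prod (convex_Ioo 0 B)).addHaar_frontier volume
    filter_upwards [compl_mem_ae_iff.2 h0] with q hq
    exact (hc 0 le_rfl).continuousOn.continuousAt_indicator hq
  have hbd : ∀ p, |(box B).indicator (c 0) p| ≤ |K| := by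
    intro p
    by_cases hp : p ∈ box B
    · simpa [hp] using (hK p hp).trans (le_abs_self K)
    · simp [hp]
  have main := tendsto_integral_vortReg hw hξ ((hc 0 le_rfl).measurable.indicator
      (measurableSet_box B)) hbd hcont
  simp only [hmul] at main
  have lim : Tendsto (fun ε : ℝ => |L| * ε * ((1 + 2 * Real.pi ^ 3) * N')) (𝓝[>] 0) (𝓝 0) := by
    have h : Continuous fun ε : ℝ => |L| * ε * ((1 + 2 * Real.pi ^ 3) * N') := by fun_prop
    simpa using (h.tendsto 0).mono_left nhdsWithin_le_nhds
  have rem : Tendsto (fun ε => ∫ p in box B, (c ε p - c 0 p) * vortReg ε w p) (𝓝[>] 0) (𝓝 0) := by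
    refine squeeze_zero_norm' ?_ lim
    filter_upwards [self_mem_nhdsWithin] with ε hε
    obtain ⟨i1, b1⟩ := integral_abs_vortReg_le hw hξ hε
    have i2 : IntegrableOn (fun p => |L| * ε * |vortReg ε w p|) halfPlane := i1.abs.const_mul _
    calc _ ≤ ∫ p in box B, |L| * ε * |vortReg ε w p| := by
          refine norm_integral_le_of_norm_le (i2.mono_set (box_subset_halfPlane B)) ?_
          filter_upwards [ae_restrict_mem (measurableSet_box B)] with p hp
          rw [norm_mul, Real.norm_eq_abs, Real.norm_eq_abs]
          have hε' : 0 < ε := hε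
          have := (hL ε hε p hp).trans (mul_le_mul_of_nonneg_right (le_abs_self L) hε'.le)
          gcongr
      _ ≤ ∫ p in halfPlane, |L| * ε * |vortReg ε w p| := by
          have hε' : 0 < ε := hε
          exact setIntegral_mono_set i2
            (Eventually.of_forall fun p => by simp only [Pi.zero_apply]; positivity)
            (box_subset_halfPlane B).eventuallyLE
      _ ≤ _ := by
          have hε' : 0 < ε := hε
          rw [integral_const_mul]
          gcongr
  have sum := main.add rem
  rw [add_zero] at sum
  refine sum.congr' ?_
  filter_upwards [self_mem_nhdsWithin] with ε hε
  have hε' : 0 < ε := hε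
  have hW := continuous_vortReg hw hε
  have i1 : IntegrableOn (fun p => c 0 p * vortReg ε w p) (box B) :=
      ((hc 0 le_rfl).mul hW).integrableOn_box B
  have i2 : IntegrableOn (fun p => (c ε p - c 0 p) * vortReg ε w p) (box B) :=
    (((hc ε hε'.le).sub (hc 0 le_rfl)).mul hW).integrableOn_box B
  rw [← integral_add i1 i2]
  refine integral_congr_ae (Eventually.of_forall fun p => ?_)
  simp only
  ring

end

/-! ### A linear and a quadratic identity for the velocity -/

section
variable {w : ℝ × ℝ → ℝ} {M N M' N' B : ℝ}

lemma abs_le_of_continuous_box {f : ℝ × ℝ → ℝ} (hf : Continuous f) (B : ℝ) :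
    ∃ C, 0 ≤ C ∧ ∀ p ∈ box B, |f p| ≤ C := by
  obtain ⟨C, hC⟩ := (isCompact_Icc (a := ((0 : ℝ), (0 : ℝ))) (b :=
      (B, B))).exists_bound_of_continuousOn hf.continuousOn
  refine ⟨|C|, abs_nonneg _, fun p hp => ((Real.norm_eq_abs _).symm.le.trans (hC p ?_)).trans
    (le_abs_self C)⟩
  exact ⟨⟨hp.1.1.le, hp.2.1.le⟩, ⟨hp.1.2.le, hp.2.2.le⟩⟩

/-- The profiles entering the linear identity: a vertical weight `f` with antiderivative `-Φ`, and a
radial weight `g` whose derivative is `r h`; all of them vanish at `B`. -/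
structure IsWeight (f f' Φ g h h' : ℝ → ℝ) (B : ℝ) : Prop where
  pos : 0 < B
  hasDerivAt_f : ∀ z, 0 < z → HasDerivAt f (f' z) z
  hasDerivAt_Φ : ∀ z, HasDerivAt Φ (-f z) z
  hasDerivAt_g : ∀ r, HasDerivAt g (r * h r) r
  hasDerivAt_h : ∀ r, HasDerivAt h (h' r) r
  continuous_f : Continuous f
  continuous_f' : Continuous f'
  continuous_h' : Continuous h'
  f_zero : f 0 = 0
  f_end : f B = 0
  Φ_end : Φ B = 0
  g_end : g B = 0
  h_end : h B = 0

variable {f f' Φ g h h' : ℝ → ℝ}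

lemma IsWeight.continuous_Φ (H : IsWeight f f' Φ g h h' B) : Continuous Φ :=
  continuous_iff_continuousAt.2 fun z => (H.hasDerivAt_Φ z).continuousAt

lemma IsWeight.continuous_g (H : IsWeight f f' Φ g h h' B) : Continuous g :=
  continuous_iff_continuousAt.2 fun z => (H.hasDerivAt_g z).continuousAt

lemma IsWeight.continuous_h (H : IsWeight f f' Φ g h h' B) : Continuous h :=
  continuous_iff_continuousAt.2 fun z => (H.hasDerivAt_h z).continuousAt

lemma hasFDerivAt_comp_fst {g : ℝ → ℝ} {a : ℝ} {p : ℝ × ℝ} (h : HasDerivAt g a p.1) :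
    HasFDerivAt (fun p : ℝ × ℝ => g p.1) (a • ContinuousLinearMap.fst ℝ ℝ ℝ) p :=
  h.comp_hasFDerivAt p hasFDerivAt_fst

lemma hasFDerivAt_comp_snd {g : ℝ → ℝ} {a : ℝ} {p : ℝ × ℝ} (h : HasDerivAt g a p.2) :
    HasFDerivAt (fun p : ℝ × ℝ => g p.2) (a • ContinuousLinearMap.snd ℝ ℝ ℝ) p :=
  h.comp_hasFDerivAt p hasFDerivAt_snd

/-- The linear identity for the regularised velocity: the divergence theorem for the field
`(f g u_z + r h Φ u_r, -f g u_r + r h Φ u_z)`. Its first part has divergence `f g ω` up to terms in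
`f'` and `g'`; the second part is divergence free up to such terms and turns the term in
`g' = r h`, which contains `u_z`, into one that contains only `u_r`. -/
lemma linear_identity_reg (H : IsWeight f f' Φ g h h' B) (hw : IsDensity w M N)
    (hξ : IsDensity (fun q => w q / q.1) M' N') (hodd : ∀ᵐ p ∂axiMeasure, w (p.1, -p.2) = -w p)
    {ε : ℝ} (hε : 0 < ε) :
    (∫ p in box B, f p.2 * g p.1 * vortReg ε w p) -
      ∫ p in box B, (f' p.2 * g p.1 - p.1 * h' p.1 * Φ p.2) * vel numR ε w p =
    -∫ z in (0 : ℝ)..B, f z * g 0 * vel numZ ε w (0, z) := by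
  have cU := continuous_vel_numR hw hε
  have cV := continuous_vel_numZ hw hε
  have cW := continuous_vortReg hw hε
  have cf := H.continuous_f
  have cf' := H.continuous_f'
  have cΦ := H.continuous_Φ
  have cg := H.continuous_g
  have ch := H.continuous_h
  have ch' := H.continuous_h'
  have i1 : IntegrableOn (fun p => f p.2 * g p.1 * vortReg ε w p) (box B) :=
    Continuous.integrableOn_box (by fun_prop) B
  have i2 : IntegrableOn (fun p => (f' p.2 * g p.1 - p.1 * h' p.1 * Φ p.2) * vel numR ε w p)
      (box B) :=
    Continuous.integrableOn_box (by fun_prop) B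
  rw [← integral_sub i1 i2]
  refine (integral_div_box H.pos.le
    (F := fun p => f p.2 * g p.1 * vel numZ ε w p + vel numR ε w p * (p.1 * h p.1) * Φ p.2)
    (G := fun p => -(f p.2 * g p.1 * vel numR ε w p) + vel numZ ε w p * (p.1 * h p.1) * Φ p.2)
    (by fun_prop) (by fun_prop) ?_ (i1.sub i2) (by simp [H.g_end, H.h_end])
    (by simp [H.f_end, H.Φ_end])
    (by simp [H.f_zero, vel_numZ_axis_of_odd hodd])).trans ?_
  swap
  · simp [vel_numR_axis hw hξ]
  intro p hp
  have hr : p.1 ≠ 0 := hp.1.1.ne'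
  have dU := hasFDerivAt_vel_numR hw hε p
  have dV := hasFDerivAt_vel_numZ hw hε p
  have df := hasFDerivAt_comp_snd (H.hasDerivAt_f p.2 hp.2.1)
  have dΦ := hasFDerivAt_comp_snd (H.hasDerivAt_Φ p.2)
  have dg := hasFDerivAt_comp_fst (H.hasDerivAt_g p.1)
  have dh := hasFDerivAt_comp_fst (H.hasDerivAt_h p.1)
  have d1 : HasFDerivAt (fun p : ℝ × ℝ => p.1) (ContinuousLinearMap.fst ℝ ℝ ℝ) p := hasFDerivAt_fst
  refine ⟨_, _, ((df.fun_mul dg).fun_mul dV).fun_add ((dU.fun_mul (d1.fun_mul dh)).fun_mul dΦ),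
    ((df.fun_mul dg).fun_mul dU).fun_neg.fun_add ((dV.fun_mul (d1.fun_mul dh)).fun_mul dΦ), ?_⟩
  have hdiv := div_free hw hε p
  have hcurl := curl_eq hw hε p
  simp only [add_apply, neg_apply, smul_apply,
    ContinuousLinearMap.coe_fst', ContinuousLinearMap.coe_snd', smul_eq_mul, Pi.sub_apply]
  rw [← hcurl]
  linear_combination (h p.1 * Φ p.2) * hdiv

/-- The vorticity tested against `f(z) g(r)` is determined by the radial velocity and by the
vertical velocity on the axis, which are the quantities in the dissipation. -/
lemma linear_identity (H : IsWeight f f' Φ g h h' B) (hw : IsDensity w M N)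
    (hξ : IsDensity (fun q => w q / q.1) M' N') (hodd : ∀ᵐ p ∂axiMeasure, w (p.1, -p.2) = -w p) :
    (∫ p in box B, f p.2 * g p.1 * w p) -
      ∫ p in box B, (f' p.2 * g p.1 - p.1 * h' p.1 * Φ p.2) * vel numR 0 w p =
    -∫ z in (0 : ℝ)..B, f z * g 0 * vel numZ 0 w (0, z) := by
  have cf := H.continuous_f
  have cf' := H.continuous_f'
  have cΦ := H.continuous_Φ
  have cg := H.continuous_g
  have ch' := H.continuous_h'
  have l1 : Tendsto (fun ε => ∫ p in box B, f p.2 * g p.1 * vortReg ε w p) (𝓝[>] 0)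
      (𝓝 (∫ p in box B, f p.2 * g p.1 * w p)) := by
    have c1 : Continuous fun p : ℝ × ℝ => f p.2 * g p.1 := by fun_prop
    obtain ⟨C, hC0, hC⟩ := abs_le_of_continuous_box c1 B
    exact tendsto_integral_box_vortReg hw hξ (c := fun _ p => f p.2 * g p.1) (L := 0)
      (fun _ _ => c1) hC (by simp)
  have l2 : Tendsto (fun ε => ∫ p in box B, (f' p.2 * g p.1 - p.1 * h' p.1 * Φ p.2) *
      vel numR ε w p) (𝓝[>] 0)
      (𝓝 (∫ p in box B, (f' p.2 * g p.1 - p.1 * h' p.1 * Φ p.2) * vel numR 0 w p)) := by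
    have c2 : Continuous fun p : ℝ × ℝ => f' p.2 * g p.1 - p.1 * h' p.1 * Φ p.2 := by fun_prop
    obtain ⟨C, hC0, hC⟩ := abs_le_of_continuous_box c2 B
    refine tendsto_setIntegral_of_bound (measurableSet_box B) (volume_box_ne_top B)
      (C := C * (Real.pi * M + N)) ?_ ?_ ?_
    · exact fun ε hε => (c2.mul (continuous_vel_numR hw hε)).measurable
    · intro ε hε p hp
      rw [abs_mul]
      exact mul_le_mul (hC p hp) (abs_vel_le isNumerator_numR hw ε p) (abs_nonneg _) hC0
    · exact fun p _ => (tendsto_vel isNumerator_numR hw p).const_mul _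
  have l3 : Tendsto (fun ε => -∫ z in (0 : ℝ)..B, f z * g 0 * vel numZ ε w (0, z)) (𝓝[>] 0)
      (𝓝 (-∫ z in (0 : ℝ)..B, f z * g 0 * vel numZ 0 w (0, z))) := by
    simp only [intervalIntegral.integral_of_le H.pos.le]
    have c3 : Continuous fun z : ℝ => f z * g 0 := by fun_prop
    obtain ⟨C, hC⟩ := (isCompact_Icc (a := 0) (b := B)).exists_bound_of_continuousOn c3.continuousOn
    have hC0 : 0 ≤ C := (norm_nonneg _).trans (hC 0 ⟨le_rfl, H.pos.le⟩)
    refine (tendsto_setIntegral_of_bound measurableSet_Ioc (by simp)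
      (C := C * (Real.pi * M + N)) ?_ ?_ ?_).neg
    · intro ε hε
      have := continuous_vel_numZ hw hε
      exact Continuous.measurable (by fun_prop)
    · intro ε hε z hz
      rw [abs_mul]
      exact mul_le_mul (hC z ⟨hz.1.le, hz.2⟩) (abs_vel_le isNumerator_numZ hw ε _)
        (abs_nonneg _) hC0
    · exact fun z _ => (tendsto_vel isNumerator_numZ hw _).const_mul _
  refine tendsto_nhds_unique ((l1.sub l2).congr' ?_) l3
  filter_upwards [self_mem_nhdsWithin] with ε hε using linear_identity_reg H hw hξ hodd hε

variable {k k' : ℝ → ℝ}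

lemma measurable_quad {U V : ℝ × ℝ → ℝ} (hU : Measurable U) (hV : Measurable V) (hk : Measurable k)
    (hk' : Measurable k') : Measurable fun p : ℝ × ℝ => k p.1 * k p.2 * (U p ^ 2 / p.1) +
      k' p.1 * k p.2 * ((V p ^ 2 - U p ^ 2) / 2) - k p.1 * k' p.2 * (U p * V p) := by
  fun_prop

/-- The coefficients of the quadratic identity are bounded on squares; near the axis `u_r² / r` is
because `|u_r| ≤ C r`. -/
lemma abs_quad_le (ck : Continuous k) (ck' : Continuous k') (hw : IsDensity w M N)
    (hξ : IsDensity (fun q => w q / q.1) M' N') (B : ℝ) : ∃ C, ∀ ε, ∀ p ∈ box B,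
    |k p.1 * k p.2 * (vel numR ε w p ^ 2 / p.1) + k' p.1 * k p.2 *
      ((vel numZ ε w p ^ 2 - vel numR ε w p ^ 2) / 2)
      - k p.1 * k' p.2 * (vel numR ε w p * vel numZ ε w p)| ≤ C := by
  obtain ⟨C₁, h1, b1⟩ := abs_le_of_continuous_box (f := fun p => k p.1 * k p.2) (by fun_prop) B
  obtain ⟨C₂, h2, b2⟩ := abs_le_of_continuous_box (f := fun p => k' p.1 * k p.2) (by fun_prop) B
  obtain ⟨C₃, h3, b3⟩ := abs_le_of_continuous_box (f := fun p => k p.1 * k' p.2) (by fun_prop) B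
  set A := Real.pi * M + N with hA
  set A' := 2 * Real.pi ^ 2 * M' + 2 * Real.pi * N' with hA'
  refine ⟨C₁ * (A' ^ 2 * B) + C₂ * A ^ 2 + C₃ * (A * A), fun ε p hp => ?_⟩
  have bU := abs_vel_le isNumerator_numR hw ε p
  have bV := abs_vel_le isNumerator_numZ hw ε p
  have bU' := abs_vel_numR_le' hw hξ hp.1.1.le ε
  have hr : 0 < p.1 := hp.1.1
  have hA0 : 0 ≤ A := (abs_nonneg _).trans bU
  have e1 : |vel numR ε w p ^ 2 / p.1| ≤ A' ^ 2 * B := by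
    rw [abs_div, abs_pow, abs_of_pos hr, div_le_iff₀ hr]
    calc _ ≤ (A' * p.1) ^ 2 := by gcongr
      _ = A' ^ 2 * p.1 * p.1 := by ring
      _ ≤ _ := by have := hp.1.2.le; gcongr
  have sU : vel numR ε w p ^ 2 ≤ A ^ 2 := sq_le_sq' (abs_le.1 bU).1 (abs_le.1 bU).2
  have sV : vel numZ ε w p ^ 2 ≤ A ^ 2 := sq_le_sq' (abs_le.1 bV).1 (abs_le.1 bV).2
  have e2 : |(vel numZ ε w p ^ 2 - vel numR ε w p ^ 2) / 2| ≤ A ^ 2 := by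
    rw [abs_le]; constructor <;> nlinarith [sq_nonneg (vel numZ ε w p), sq_nonneg (vel numR ε w p)]
  have e3 : |vel numR ε w p * vel numZ ε w p| ≤ A * A := by
    rw [abs_mul]; exact mul_le_mul bU bV (abs_nonneg _) hA0
  refine (abs_sub _ _).trans (add_le_add ((abs_add_le _ _).trans (add_le_add ?_ ?_)) ?_)
  · rw [abs_mul]; exact mul_le_mul (b1 p hp) e1 (abs_nonneg _) h1
  · rw [abs_mul]; exact mul_le_mul (b2 p hp) e2 (abs_nonneg _) h2
  · rw [abs_mul]; exact mul_le_mul (b3 p hp) e3 (abs_nonneg _) h3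

/-- The quadratic identity for the regularised velocity: the divergence theorem for the field
`(κ (u_z² - u_r²) / 2, -κ u_r u_z)` with `κ = k(r) k(z)`. Where `κ` is constant its divergence is
`κ (u_z ω + u_r² / r)`, since the velocity is divergence free. -/
lemma quadratic_identity_reg (hB : 0 ≤ B) (hk : ∀ s, HasDerivAt k (k' s) s) (ck' : Continuous k')
    (hkB : k B = 0)
    (hw : IsDensity w M N) (hξ : IsDensity (fun q => w q / q.1) M' N')
    (hodd : ∀ᵐ p ∂axiMeasure, w (p.1, -p.2) = -w p) {ε : ℝ} (hε : 0 < ε) :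
    (∫ p in box B, k p.1 * k p.2 * vel numZ ε w p * vortReg ε w p) +
      ∫ p in box B, (k p.1 * k p.2 * (vel numR ε w p ^ 2 / p.1) +
        k' p.1 * k p.2 * ((vel numZ ε w p ^ 2 - vel numR ε w p ^ 2) / 2)
        - k p.1 * k' p.2 * (vel numR ε w p * vel numZ ε w p)) =
    -∫ z in (0 : ℝ)..B, k 0 * k z * (vel numZ ε w (0, z) ^ 2 / 2) := by
  have cU := continuous_vel_numR hw hε
  have cV := continuous_vel_numZ hw hε
  have cW := continuous_vortReg hw hε
  have ck : Continuous k := continuous_iff_continuousAt.2 fun z => (hk z).continuousAt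
  have i1 : IntegrableOn (fun p => k p.1 * k p.2 * vel numZ ε w p * vortReg ε w p) (box B) :=
    Continuous.integrableOn_box (by fun_prop) B
  obtain ⟨C, hC⟩ := abs_quad_le ck ck' hw hξ B
  have i2 := integrableOn_box_of_bound
      (measurable_quad cU.measurable cV.measurable ck.measurable ck'.measurable) (hC ε)
  rw [← integral_add i1 i2]
  refine (integral_div_box hB
    (F := fun p => k p.1 * k p.2 *
    ((vel numZ ε w p * vel numZ ε w p - vel numR ε w p * vel numR ε w p) * (1 / 2)))
    (G := fun p => -(k p.1 * k p.2 * (vel numR ε w p * vel numZ ε w p)))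
    (by fun_prop) (by fun_prop) ?_ (i1.add i2) (by simp [hkB]) (by simp [hkB])
    (by simp [vel_numZ_axis_of_odd hodd])).trans ?_
  swap
  · congr 1
    refine intervalIntegral.integral_congr fun z _ => ?_
    simp only [vel_numR_axis hw hξ]
    ring
  intro p hp
  have hr : p.1 ≠ 0 := hp.1.1.ne'
  have dU := hasFDerivAt_vel_numR hw hε p
  have dV := hasFDerivAt_vel_numZ hw hε p
  have d1 := hasFDerivAt_comp_fst (hk p.1)
  have d2 := hasFDerivAt_comp_snd (hk p.2)
  refine ⟨_, _, (d1.fun_mul d2).fun_mul (((dV.fun_mul dV).fun_sub (dU.fun_mul dU)).mul_const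
    (1 / 2)),
    ((d1.fun_mul d2).fun_mul (dU.fun_mul dV)).fun_neg, ?_⟩
  have hdiv : dRR ε w p + dZZ ε w p = -(vel numR ε w p / p.1) := by
    have := div_free hw hε p
    field_simp
    linarith
  have hcurl := curl_eq hw hε p
  simp only [add_apply, sub_apply, neg_apply, smul_apply,
    ContinuousLinearMap.coe_fst', ContinuousLinearMap.coe_snd', smul_eq_mul, Pi.add_apply]
  rw [← hcurl, div_eq_mul_inv]
  linear_combination (-(k p.1 * k p.2 * vel numR ε w p)) * hdiv

/-- The quadratic identity in the limit `ε → 0`. -/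
lemma quadratic_identity (hB : 0 ≤ B) (hk : ∀ s, HasDerivAt k (k' s) s) (ck' : Continuous k')
    (hkB : k B = 0)
    (hw : IsDensity w M N) (hξ : IsDensity (fun q => w q / q.1) M' N')
    (hodd : ∀ᵐ p ∂axiMeasure, w (p.1, -p.2) = -w p) :
    (∫ p in box B, k p.1 * k p.2 * vel numZ 0 w p * w p) +
      ∫ p in box B, (k p.1 * k p.2 * (vel numR 0 w p ^ 2 / p.1) +
        k' p.1 * k p.2 * ((vel numZ 0 w p ^ 2 - vel numR 0 w p ^ 2) / 2)
        - k p.1 * k' p.2 * (vel numR 0 w p * vel numZ 0 w p)) =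
    -∫ z in (0 : ℝ)..B, k 0 * k z * (vel numZ 0 w (0, z) ^ 2 / 2) := by
  have ck : Continuous k := continuous_iff_continuousAt.2 fun z => (hk z).continuousAt
  have l1 : Tendsto (fun ε => ∫ p in box B, k p.1 * k p.2 * vel numZ ε w p * vortReg ε w p) (𝓝[>] 0)
      (𝓝 (∫ p in box B, k p.1 * k p.2 * vel numZ 0 w p * w p)) := by
    have c1 : Continuous fun p : ℝ × ℝ => k p.1 * k p.2 := by fun_prop
    obtain ⟨C, hC0, hC⟩ := abs_le_of_continuous_box c1 B
    refine tendsto_integral_box_vortReg hw hξ (c := fun ε p => k p.1 * k p.2 * vel numZ ε w p)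
      (K := C * (Real.pi * M + N)) (L := C * (6 * Real.pi * M)) ?_ ?_ ?_
    · intro ε hε
      rcases hε.eq_or_lt with rfl | hε
      · exact c1.mul (continuous_vel isNumerator_numZ hw)
      · exact c1.mul (continuous_vel_numZ hw hε)
    · intro p hp
      rw [abs_mul]
      exact mul_le_mul (hC p hp) (abs_vel_le isNumerator_numZ hw 0 p) (abs_nonneg _) hC0
    · intro ε hε p hp
      rw [← mul_sub, abs_mul, mul_assoc C]
      refine mul_le_mul (hC p hp) ?_ (abs_nonneg _) hC0
      rw [abs_sub_comm]
      exact abs_vel_sub_reg_le isNumerator_numZ hw hε p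
  obtain ⟨C, hC⟩ := abs_quad_le ck ck' hw hξ B
  have l2 := tendsto_setIntegral_of_bound (measurableSet_box B) (volume_box_ne_top B)
    (fun ε hε => measurable_quad (continuous_vel_numR hw hε).measurable
    (continuous_vel_numZ hw hε).measurable
      ck.measurable ck'.measurable) (fun ε _ => hC ε) (fun p _ => by
      have tU := tendsto_vel isNumerator_numR hw p
      have tV := tendsto_vel isNumerator_numZ hw p
      exact ((((tU.pow 2).div_const p.1).const_mul (k p.1 * k p.2)).add
        ((((tV.pow 2).sub (tU.pow 2)).div_const 2).const_mul (k' p.1 * k p.2))).sub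
          ((tU.mul tV).const_mul (k p.1 * k' p.2)))
  have l3 : Tendsto (fun ε => -∫ z in (0 : ℝ)..B, k 0 * k z * (vel numZ ε w (0, z) ^ 2 / 2))
      (𝓝[>] 0)
      (𝓝 (-∫ z in (0 : ℝ)..B, k 0 * k z * (vel numZ 0 w (0, z) ^ 2 / 2))) := by
    simp only [intervalIntegral.integral_of_le hB]
    have c3 : Continuous fun z : ℝ => k 0 * k z := by fun_prop
    obtain ⟨C, hC⟩ := (isCompact_Icc (a := 0) (b := B)).exists_bound_of_continuousOn c3.continuousOn
    have hC0 : 0 ≤ C := (norm_nonneg _).trans (hC 0 ⟨le_rfl, hB⟩)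
    refine (tendsto_setIntegral_of_bound measurableSet_Ioc (by simp)
      (C := C * ((Real.pi * M + N) ^ 2 / 2)) ?_ ?_ ?_).neg
    · intro ε hε
      have := continuous_vel_numZ hw hε
      exact Continuous.measurable (by fun_prop)
    · intro ε hε z hz
      rw [abs_mul, abs_of_nonneg (by positivity : 0 ≤ vel numZ ε w (0, z) ^ 2 / 2)]
      have b := abs_vel_le isNumerator_numZ hw ε (0, z)
      have sV : vel numZ ε w (0, z) ^ 2 ≤ (Real.pi * M + N) ^ 2 :=
          sq_le_sq' (abs_le.1 b).1 (abs_le.1 b).2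
      exact mul_le_mul (hC z ⟨hz.1.le, hz.2⟩) (by linarith) (by positivity) hC0
    · exact fun z _ => (((tendsto_vel isNumerator_numZ hw _).pow 2).div_const 2).const_mul _
  refine tendsto_nhds_unique ((l1.add l2).congr' ?_) l3
  filter_upwards [self_mem_nhdsWithin] with ε hε using quadratic_identity_reg hB hk ck' hkB hw hξ
    hodd hε

end

/-! ### The dissipation identity -/

lemma tendsto_setIntegral_mul {α : Type*} [MeasurableSpace α] {μ : Measure α} {S : Set α}
    {s : ℝ → Set α}
    (hS : MeasurableSet S) (hs : ∀ B, MeasurableSet (s B)) (hsS : ∀ B, s B ⊆ S)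
    (hcov : ∀ p ∈ S, ∀ᶠ B in atTop, p ∈ s B) {c : ℝ → α → ℝ} {a : ℝ} {X : α → ℝ}
    (hX : IntegrableOn X S μ)
    (hc : ∀ B, Measurable (c B)) (hb : ∀ᶠ B in atTop, ∀ p ∈ s B, |c B p| ≤ 1)
    (hl : ∀ p ∈ S, Tendsto (fun B => c B p) atTop (𝓝 a)) :
    Tendsto (fun B => ∫ p in s B, c B p * X p ∂μ) atTop (𝓝 (a * ∫ p in S, X p ∂μ)) := by
  have e : ∀ B, ∫ p in s B, c B p * X p ∂μ = ∫ p in S, (s B).indicator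
      (fun p => c B p * X p) p ∂μ := fun B => by
    rw [setIntegral_indicator (hs B), inter_eq_self_of_subset_right (hsS B)]
  simp only [e]
  rw [← integral_const_mul]
  refine tendsto_integral_filter_of_dominated_convergence (fun p => |X p|) ?_ ?_ hX.abs ?_
  · exact Eventually.of_forall fun B =>
      ((hc B).aestronglyMeasurable.mul hX.aestronglyMeasurable).indicator (hs B)
  · filter_upwards [hb] with B hB
    refine Eventually.of_forall fun p => ?_
    by_cases hp : p ∈ s B
    · rw [indicator_of_mem hp, norm_mul, Real.norm_eq_abs, Real.norm_eq_abs]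
      exact mul_le_of_le_one_left (abs_nonneg _) (hB p hp)
    · rw [indicator_of_notMem hp, norm_zero]; exact abs_nonneg _
  · filter_upwards [ae_restrict_mem hS] with p hp
    refine ((hl p hp).mul_const (X p)).congr' ?_
    filter_upwards [hcov p hp] with B hB
    rw [indicator_of_mem hB]

lemma eventually_mem_box {p : ℝ × ℝ} (hp : p ∈ quadrant) : ∀ᶠ B in atTop, p ∈ box B := by
  filter_upwards [eventually_gt_atTop p.1, eventually_gt_atTop p.2] with B h1 h2
  exact ⟨⟨hp.1, h1⟩, ⟨hp.2, h2⟩⟩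

/-- The cutoff profile `(1 - (s / B)²)²`. -/
def cutoff (B s : ℝ) : ℝ := (1 - (s / B) ^ 2) ^ 2

/-- The derivative of `cutoff B`. -/
def cutoffDeriv (B s : ℝ) : ℝ := -(4 * s / B ^ 2) * (1 - (s / B) ^ 2)

lemma hasDerivAt_cutoff (B s : ℝ) : HasDerivAt (cutoff B) (cutoffDeriv B s) s := by
  have h := ((((hasDerivAt_id s).div_const B).fun_pow 2).const_sub 1).fun_pow 2
  refine h.congr_deriv ?_
  simp only [cutoffDeriv, id]
  rcases eq_or_ne B 0 with rfl | hB
  · simp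
  · norm_num
    field_simp
    ring

lemma continuous_cutoff (B : ℝ) : Continuous (cutoff B) := by unfold cutoff; fun_prop

lemma continuous_cutoffDeriv (B : ℝ) : Continuous (cutoffDeriv B) := by unfold cutoffDeriv; fun_prop

lemma cutoff_zero (B : ℝ) : cutoff B 0 = 1 := by simp [cutoff]

lemma cutoff_self {B : ℝ} (hB : 0 < B) : cutoff B B = 0 := by simp [cutoff, hB.ne']

lemma cutoff_nonneg (B s : ℝ) : 0 ≤ cutoff B s := sq_nonneg _

lemma div_sq_mem {B s : ℝ} (hs : s ∈ Ioo 0 B) : 0 ≤ 1 - (s / B) ^ 2 ∧ 1 - (s / B) ^ 2 ≤ 1 := by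
  have hB : 0 < B := hs.1.trans hs.2
  have h0 : 0 ≤ s / B := div_nonneg hs.1.le hB.le
  have h1 : s / B ≤ 1 := (div_le_one hB).2 hs.2.le
  constructor <;> nlinarith

lemma cutoff_le_one {B s : ℝ} (hs : s ∈ Ioo 0 B) : cutoff B s ≤ 1 :=
  pow_le_one₀ (div_sq_mem hs).1 (div_sq_mem hs).2

lemma abs_cutoffDeriv_le {B s : ℝ} (hs : s ∈ Ioo 0 B) : |cutoffDeriv B s| ≤ 4 * s / B ^ 2 := by
  have hB : 0 < B := hs.1.trans hs.2
  have h := div_sq_mem hs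
  have h0 : 0 ≤ 4 * s / B ^ 2 := by have := hs.1; positivity
  rw [cutoffDeriv, abs_mul, abs_neg, abs_of_nonneg h0, abs_of_nonneg h.1]
  exact mul_le_of_le_one_right h0 h.2

lemma cutoffDeriv_sq_le {B s : ℝ} (hs : s ∈ Ioo 0 B) : cutoffDeriv B s ^ 2 ≤
    16 / B ^ 2 * cutoff B s := by
  have hB : 0 < B := hs.1.trans hs.2
  rw [cutoffDeriv, cutoff, mul_pow]
  gcongr
  rw [neg_sq, div_pow, div_le_div_iff₀ (by positivity) (by positivity)]
  have : s ^ 2 ≤ B ^ 2 := by have := hs.1.le; have := hs.2.le; gcongr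
  nlinarith [sq_nonneg (B ^ 2), mul_le_mul_of_nonneg_right this (sq_nonneg B)]

lemma le_cutoff {B s : ℝ} (hB : 0 < B) (hs : s ∈ Ioc 0 B) : 1 / 2 ≤ cutoff (2 * B) s := by
  have h0 : 0 ≤ s / (2 * B) := by have := hs.1.le; positivity
  have h1 : s / (2 * B) ≤ 1 / 2 := by
    rw [div_le_div_iff₀ (by positivity) (by norm_num)]; linarith [hs.2]
  have h2 : (s / (2 * B)) ^ 2 ≤ 1 / 4 := by nlinarith
  unfold cutoff
  nlinarith

lemma tendsto_div_atTop_zero (s : ℝ) : Tendsto (fun B : ℝ => s / B) atTop (𝓝 0) :=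
  tendsto_const_nhds.div_atTop tendsto_id

lemma tendsto_cutoff (s : ℝ) : Tendsto (fun B => cutoff B s) atTop (𝓝 1) := by
  have h := (((tendsto_div_atTop_zero s).pow 2).const_sub 1).pow 2
  simpa [cutoff] using h

lemma tendsto_cutoffDeriv (s : ℝ) : Tendsto (fun B => cutoffDeriv B s) atTop (𝓝 0) := by
  have h1 : Tendsto (fun B : ℝ => 4 * s / B ^ 2) atTop (𝓝 0) :=
    tendsto_const_nhds.div_atTop (tendsto_pow_atTop two_ne_zero)
  have h := h1.neg.mul (((tendsto_div_atTop_zero s).pow 2).const_sub 1)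
  simpa [cutoffDeriv] using h

section
variable {w : ℝ × ℝ → ℝ} {M N M' N' B : ℝ}

lemma integrableOn_quadrant_of_density (hξ : IsDensity (fun q => w q / q.1) M' N') : IntegrableOn w
    quadrant := by
  have h := (integrable_axi _).1 hξ.integrable
  refine (h.mono_set fun p hp => hp.1).congr_fun (fun p hp => ?_) measurableSet_quadrant
  have : p.1 ≠ 0 := hp.1.ne'
  field_simp

lemma integrableOn_quadrant_sq {V : ℝ × ℝ → ℝ} (hV : MemLp V 2 axiMeasure) :
    IntegrableOn (fun p => p.1 * V p ^ 2) quadrant :=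
  ((integrable_axi _).1 hV.integrable_sq).mono_set fun _ hp => hp.1

lemma integrableOn_box_velR_sq (hw : IsDensity w M N) (hξ : IsDensity (fun q => w q / q.1) M' N')
    (B : ℝ) :
    IntegrableOn (fun p => vel numR 0 w p ^ 2 / p.1) (box B) := by
  have cU := continuous_vel isNumerator_numR hw
  refine integrableOn_box_of_bound (by fun_prop) (C := (2 * Real.pi ^ 2 * M' +
    2 * Real.pi * N') ^ 2 * B) fun p hp => ?_
  have hr : 0 < p.1 := hp.1.1
  rw [abs_div, abs_pow, abs_of_pos hr, div_le_iff₀ hr]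
  have h := abs_vel_numR_le' hw hξ hr.le 0
  calc _ ≤ ((2 * Real.pi ^ 2 * M' + 2 * Real.pi * N') * p.1) ^ 2 := by gcongr
    _ = (2 * Real.pi ^ 2 * M' + 2 * Real.pi * N') ^ 2 * p.1 * p.1 := by ring
    _ ≤ _ := by have := hp.1.2.le; gcongr

/-- A bound for the dissipation that is uniform in the scale of the cutoff. The terms with the
derivative of the cutoff in `r` are bounded by the energy, since `|k'(r)| ≤ 4 r`. The cross term
`k'(z) u_r u_z` lacks a factor `r`; because `k'² ≤ 16 k` it is bounded by half of `k(z) u_r² / r`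
plus the energy. -/
lemma exists_bound_cutoff (hw : IsDensity w M N) (hξ : IsDensity (fun q => w q / q.1) M' N')
    (hU : MemLp (vel numR 0 w) 2 axiMeasure) (hV : MemLp (vel numZ 0 w) 2 axiMeasure)
    (hodd : ∀ᵐ p ∂axiMeasure, w (p.1, -p.2) = -w p) : ∃ C, ∀ B, 1 ≤ B →
    1 / 2 * (∫ p in box B, cutoff B p.1 * cutoff B p.2 * (vel numR 0 w p ^ 2 / p.1)) +
      ∫ z in (0 : ℝ)..B, cutoff B z * (vel numZ 0 w (0, z) ^ 2 / 2) ≤ C := by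
  have iw := integrableOn_quadrant_of_density hξ
  have iU := integrableOn_quadrant_sq hU
  have iV := integrableOn_quadrant_sq hV
  have cU := continuous_vel isNumerator_numR hw
  have cV := continuous_vel isNumerator_numZ hw
  set A := Real.pi * M + N with hA
  have hA0 : 0 ≤ A := (abs_nonneg _).trans (abs_vel_le isNumerator_numR hw 0 0)
  have iX : IntegrableOn (fun p => A * |w p| + (2 * (p.1 * vel numR 0 w p ^ 2) +
      10 * (p.1 * vel numZ 0 w p ^ 2))) quadrant :=
    (iw.abs.const_mul A).add ((iU.const_mul 2).add (iV.const_mul 10))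
  refine ⟨∫ p in quadrant, (A * |w p| + (2 * (p.1 * vel numR 0 w p ^ 2) +
    10 * (p.1 * vel numZ 0 w p ^ 2))), fun B hB => ?_⟩
  have hB0 : 0 < B := by linarith
  have cc := continuous_cutoff B
  have cd := continuous_cutoffDeriv B
  have hid := quadratic_identity hB0.le (hasDerivAt_cutoff B) cd (cutoff_self hB0) hw hξ hodd
  simp only [cutoff_zero, one_mul] at hid
  have i1 : IntegrableOn (fun p => cutoff B p.1 * cutoff B p.2 * vel numZ 0 w p * w p) (box B) := by
    refine ((iw.mono_set (box_subset_quadrant B)).bdd_mul (c := A)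
      (Continuous.aestronglyMeasurable (by fun_prop)) ?_)
    filter_upwards [ae_restrict_mem (measurableSet_box B)] with p hp
    rw [norm_mul, norm_mul, Real.norm_of_nonneg (cutoff_nonneg _ _),
      Real.norm_of_nonneg (cutoff_nonneg _ _), Real.norm_eq_abs]
    calc _ ≤ 1 * 1 * A := by
          have h1 := cutoff_le_one hp.1
          have h2 := cutoff_le_one hp.2
          have h3 := abs_vel_le isNumerator_numZ hw 0 p
          have h4 := cutoff_nonneg B p.2
          gcongr
      _ = A := by ring
  obtain ⟨C, hC⟩ := abs_quad_le cc cd hw hξ B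
  have i2 := integrableOn_box_of_bound
      (measurable_quad cU.measurable cV.measurable cc.measurable cd.measurable) (hC 0)
  have i3 : IntegrableOn (fun p => cutoff B p.1 * cutoff B p.2 * (vel numR 0 w p ^ 2 / p.1))
      (box B) := by
    refine (integrableOn_box_velR_sq hw hξ B).bdd_mul (c := 1)
      (Continuous.aestronglyMeasurable (by fun_prop)) ?_
    filter_upwards [ae_restrict_mem (measurableSet_box B)] with p hp
    rw [norm_mul, Real.norm_of_nonneg (cutoff_nonneg _ _), Real.norm_of_nonneg (cutoff_nonneg _ _)]
    exact mul_le_one₀ (cutoff_le_one hp.1) (cutoff_nonneg _ _) (cutoff_le_one hp.2)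
  have hpt : ∀ p ∈ box B, 1 / 2 * (cutoff B p.1 * cutoff B p.2 * (vel numR 0 w p ^ 2 / p.1)) -
      (cutoff B p.1 * cutoff B p.2 * vel numZ 0 w p * w p +
        (cutoff B p.1 * cutoff B p.2 * (vel numR 0 w p ^ 2 / p.1) +
          cutoffDeriv B p.1 * cutoff B p.2 * ((vel numZ 0 w p ^ 2 - vel numR 0 w p ^ 2) / 2) -
          cutoff B p.1 * cutoffDeriv B p.2 * (vel numR 0 w p * vel numZ 0 w p))) ≤
      A * |w p| + (2 * (p.1 * vel numR 0 w p ^ 2) + 10 * (p.1 * vel numZ 0 w p ^ 2)) := by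
    intro p hp
    have hr : 0 < p.1 := hp.1.1
    have a0 := cutoff_nonneg B p.1
    have a1 := cutoff_le_one hp.1
    have b0 := cutoff_nonneg B p.2
    have b1 := cutoff_le_one hp.2
    have d1 := abs_cutoffDeriv_le hp.1
    have d2 := cutoffDeriv_sq_le hp.2
    have hv := abs_vel_le isNumerator_numZ hw 0 p
    have hB2 : 1 ≤ B ^ 2 := one_le_pow₀ hB
    generalize vel numR 0 w p = u at *
    generalize vel numZ 0 w p = v at *
    generalize cutoff B p.1 = a at *
    generalize cutoff B p.2 = b at *
    generalize cutoffDeriv B p.1 = a' at *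
    generalize cutoffDeriv B p.2 = b' at *
    generalize p.1 = r at *
    have e1 : -(a * b * v * w p) ≤ A * |w p| := by
      refine (neg_le_abs _).trans ?_
      rw [abs_mul, abs_mul, abs_of_nonneg (mul_nonneg a0 b0)]
      gcongr
      calc a * b * |v| ≤ 1 * 1 * A := by gcongr
        _ = A := by ring
    have e2 : -(a' * b * ((v ^ 2 - u ^ 2) / 2)) ≤ 2 * (r * u ^ 2) + 2 * (r * v ^ 2) := by
      refine (neg_le_abs _).trans ?_
      rw [abs_mul, abs_mul, abs_of_nonneg b0]
      have h1 : |a'| ≤ 4 * r := d1.trans (div_le_self (by positivity) hB2)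
      have h2 : |(v ^ 2 - u ^ 2) / 2| ≤ (u ^ 2 + v ^ 2) / 2 := by
        rw [abs_le]; constructor <;> nlinarith [sq_nonneg u, sq_nonneg v]
      calc |a'| * b * |(v ^ 2 - u ^ 2) / 2| ≤ (4 * r) * 1 * ((u ^ 2 + v ^ 2) / 2) := by gcongr
        _ = _ := by ring
    have e3 : a * b' * (u * v) ≤ 1 / 2 * (a * b * (u ^ 2 / r)) + 8 * (r * v ^ 2) := by
      have d3 : b' ^ 2 ≤ 16 * b := d2.trans (by gcongr; exact div_le_self (by norm_num) hB2)
      have h1 : b' * (u * v) ≤ 1 / 2 * (b * (u ^ 2 / r)) + 8 * (r * v ^ 2) := by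
        have key : (b' * (u * v)) * 16 * r ≤ (1 / 2 * (b * (u ^ 2 / r)) +
            8 * (r * v ^ 2)) * 16 * r := by
          have e : (1 / 2 * (b * (u ^ 2 / r)) + 8 * (r * v ^ 2)) * 16 * r = 8 * (b * u ^ 2) +
              128 * (r * v) ^ 2 := by
            field_simp; ring
          rw [e]
          nlinarith [sq_nonneg (b' * u - 16 * (r * v)), mul_le_mul_of_nonneg_right d3 (sq_nonneg u)]
        exact le_of_mul_le_mul_right (by linarith) (show 0 < 16 * r by positivity)
      calc a * b' * (u * v) = a * (b' * (u * v)) := by ring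
        _ ≤ a * (1 / 2 * (b * (u ^ 2 / r)) + 8 * (r * v ^ 2)) := by gcongr
        _ = 1 / 2 * (a * b * (u ^ 2 / r)) + a * (8 * (r * v ^ 2)) := by ring
        _ ≤ _ := by
          have : a * (8 * (r * v ^ 2)) ≤ 8 * (r * v ^ 2) := mul_le_of_le_one_left (by positivity) a1
          linarith
    linarith
  have i12 : IntegrableOn (fun p => cutoff B p.1 * cutoff B p.2 * vel numZ 0 w p * w p +
        (cutoff B p.1 * cutoff B p.2 * (vel numR 0 w p ^ 2 / p.1) +
          cutoffDeriv B p.1 * cutoff B p.2 * ((vel numZ 0 w p ^ 2 - vel numR 0 w p ^ 2) / 2) -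
          cutoff B p.1 * cutoffDeriv B p.2 * (vel numR 0 w p * vel numZ 0 w p))) (box B) :=
            i1.add i2
  have hint := setIntegral_mono_on ((i3.const_mul (1 / 2)).sub i12)
      (iX.mono_set (box_subset_quadrant B)) (measurableSet_box B) hpt
  rw [integral_sub' (i3.const_mul (1 / 2)) i12, integral_const_mul] at hint
  have hadd : ∫ p in box B, (cutoff B p.1 * cutoff B p.2 * vel numZ 0 w p * w p +
        (cutoff B p.1 * cutoff B p.2 * (vel numR 0 w p ^ 2 / p.1) +
          cutoffDeriv B p.1 * cutoff B p.2 * ((vel numZ 0 w p ^ 2 - vel numR 0 w p ^ 2) / 2) -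
          cutoff B p.1 * cutoffDeriv B p.2 * (vel numR 0 w p * vel numZ 0 w p))) =
        -∫ z in (0 : ℝ)..B, cutoff B z * (vel numZ 0 w (0, z) ^ 2 / 2) := by
    rw [← hid]; exact integral_add i1 i2
  have hmono := setIntegral_mono_set iX (s := box B) (by
      filter_upwards [ae_restrict_mem measurableSet_quadrant] with p hp
      have : 0 < p.1 := hp.1
      simp only [Pi.zero_apply]; positivity) (box_subset_quadrant B).eventuallyLE
  rw [hadd] at hint
  linarith

/-- The dissipation is finite, and equals `-∫ u_z ω` over the quadrant: the quadratic identity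
with a cutoff at scale `B`, as `B → ∞`. -/
theorem dissipation_identity (hw : IsDensity w M N) (hξ : IsDensity (fun q => w q / q.1) M' N')
    (hU : MemLp (vel numR 0 w) 2 axiMeasure) (hV : MemLp (vel numZ 0 w) 2 axiMeasure)
    (hodd : ∀ᵐ p ∂axiMeasure, w (p.1, -p.2) = -w p) :
    IntegrableOn (fun z : ℝ => vel numZ 0 w (0, z) ^ 2 / 2) (Ioi 0) ∧
    IntegrableOn (fun p => vel numR 0 w p ^ 2 / p.1) quadrant ∧
    ∫ p in quadrant, vel numZ 0 w p * w p = -((∫ z in Ioi (0 : ℝ), vel numZ 0 w (0, z) ^ 2 / 2) +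
      ∫ p in quadrant, vel numR 0 w p ^ 2 / p.1) := by
  have iw := integrableOn_quadrant_of_density hξ
  have iU := integrableOn_quadrant_sq hU
  have iV := integrableOn_quadrant_sq hV
  have cU := continuous_vel isNumerator_numR hw
  have cV := continuous_vel isNumerator_numZ hw
  have cV0 : Continuous fun z : ℝ => vel numZ 0 w (0, z) ^ 2 / 2 := by fun_prop
  obtain ⟨C, hC⟩ := exists_bound_cutoff hw hξ hU hV hodd
  have iQ : ∀ B, 0 < B → IntegrableOn (fun p => cutoff B p.1 * cutoff B p.2 *
      (vel numR 0 w p ^ 2 / p.1)) (box B) := by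
    intro B hB
    have cc := continuous_cutoff B
    refine (integrableOn_box_velR_sq hw hξ B).bdd_mul (c := 1)
      (Continuous.aestronglyMeasurable (by fun_prop)) ?_
    filter_upwards [ae_restrict_mem (measurableSet_box B)] with p hp
    rw [norm_mul, Real.norm_of_nonneg (cutoff_nonneg _ _), Real.norm_of_nonneg (cutoff_nonneg _ _)]
    exact mul_le_one₀ (cutoff_le_one hp.1) (cutoff_nonneg _ _) (cutoff_le_one hp.2)
  have nnQ : ∀ B p, p ∈ box B → 0 ≤ cutoff B p.1 * cutoff B p.2 * (vel numR 0 w p ^ 2 / p.1) := by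
    intro B p hp
    have : 0 < p.1 := hp.1.1
    have h1 := cutoff_nonneg B p.1
    have h2 := cutoff_nonneg B p.2
    positivity
  have bQ : ∀ B, 0 < B → 0 ≤ ∫ p in box B, cutoff B p.1 * cutoff B p.2 *
      (vel numR 0 w p ^ 2 / p.1) :=
    fun B hB => setIntegral_nonneg (measurableSet_box B) (nnQ B)
  have bZ : ∀ B, 0 < B → 0 ≤ ∫ z in (0 : ℝ)..B, cutoff B z * (vel numZ 0 w (0, z) ^ 2 / 2) :=
      fun B hB =>
    intervalIntegral.integral_nonneg hB.le fun z _ => mul_nonneg (cutoff_nonneg _ _) (by positivity)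
  have fin1 : IntegrableOn (fun z : ℝ => vel numZ 0 w (0, z) ^ 2 / 2) (Ioi 0) := by
    refine integrableOn_Ioi_of_intervalIntegral_norm_bounded (2 * C) 0 (l := atTop) (b := id)
      (fun B => cV0.integrableOn_Ioc) tendsto_id ?_
    filter_upwards [eventually_ge_atTop 1] with B hB
    have hB0 : 0 < B := by linarith
    have cc := continuous_cutoff (2 * B)
    have h1 := hC (2 * B) (by linarith)
    have h2 := bQ (2 * B) (by linarith)
    have h3 : ∫ z in (0 : ℝ)..B, cutoff (2 * B) z * (vel numZ 0 w (0, z) ^ 2 / 2) ≤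
        ∫ z in (0 : ℝ)..(2 * B), cutoff (2 * B) z * (vel numZ 0 w (0, z) ^ 2 / 2) :=
      intervalIntegral.integral_mono_interval le_rfl hB0.le (by linarith)
        (Eventually.of_forall fun z => mul_nonneg (cutoff_nonneg _ _) (by positivity))
        (Continuous.intervalIntegrable (by fun_prop) _ _)
    have h4 : ∫ z in (0 : ℝ)..B, 1 / 2 * ‖vel numZ 0 w (0, z) ^ 2 / 2‖ ≤
        ∫ z in (0 : ℝ)..B, cutoff (2 * B) z * (vel numZ 0 w (0, z) ^ 2 / 2) := by
      simp only [intervalIntegral.integral_of_le hB0.le]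
      refine setIntegral_mono_on (Continuous.integrableOn_Ioc (by fun_prop))
        (Continuous.integrableOn_Ioc (by fun_prop))
        measurableSet_Ioc fun z hz => ?_
      rw [Real.norm_of_nonneg (by positivity)]
      have := le_cutoff hB0 hz
      gcongr
    rw [intervalIntegral.integral_const_mul] at h4
    simp only [id]
    linarith
  have fin2 : IntegrableOn (fun p => vel numR 0 w p ^ 2 / p.1) quadrant := by
    have cover : AECover (volume.restrict quadrant) atTop box :=
      ⟨(ae_restrict_mem measurableSet_quadrant).mono fun p hp => eventually_mem_box hp,
        measurableSet_box⟩
    refine cover.integrable_of_integral_bounded_of_nonneg_ae (8 * C) (fun B => ?_) ?_ ?_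
    · rw [IntegrableOn, Measure.restrict_restrict (measurableSet_box B),
        inter_eq_self_of_subset_left (box_subset_quadrant B)]
      exact integrableOn_box_velR_sq hw hξ B
    · filter_upwards [ae_restrict_mem measurableSet_quadrant] with p hp
      have : 0 < p.1 := hp.1
      positivity
    · filter_upwards [eventually_ge_atTop 1] with B hB
      have hB0 : 0 < B := by linarith
      have h1 := hC (2 * B) (by linarith)
      have h2 := bZ (2 * B) (by linarith)
      rw [Measure.restrict_restrict (measurableSet_box B),
        inter_eq_self_of_subset_left (box_subset_quadrant B)]
      have hsub : box B ⊆ box (2 * B) := prod_mono (Ioo_subset_Ioo_right (by linarith))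
          (Ioo_subset_Ioo_right (by linarith))
      have h3 := setIntegral_mono_set (iQ (2 * B) (by linarith)) (by
        filter_upwards [ae_restrict_mem (measurableSet_box (2 * B))] with p hp using nnQ _ p hp)
          hsub.eventuallyLE
      have h4 : ∫ p in box B, 1 / 4 * (vel numR 0 w p ^ 2 / p.1) ≤
          ∫ p in box B, cutoff (2 * B) p.1 * cutoff (2 * B) p.2 * (vel numR 0 w p ^ 2 / p.1) := by
        refine setIntegral_mono_on ((integrableOn_box_velR_sq hw hξ B).const_mul _)
          ((iQ (2 * B) (by linarith)).mono_set hsub) (measurableSet_box B) fun p hp => ?_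
        have hr : 0 < p.1 := hp.1.1
        have b1 := le_cutoff hB0 (Ioo_subset_Ioc_self hp.1)
        have b2 := le_cutoff hB0 (Ioo_subset_Ioc_self hp.2)
        have : 1 / 4 ≤ cutoff (2 * B) p.1 * cutoff (2 * B) p.2 := by nlinarith
        gcongr
      rw [integral_const_mul] at h4
      linarith
  refine ⟨fin1, fin2, ?_⟩
  have iVw : IntegrableOn (fun p => vel numZ 0 w p * w p) quadrant :=
    iw.bdd_mul (c := Real.pi * M + N) cV.aestronglyMeasurable (Eventually.of_forall fun p =>
      abs_vel_le isNumerator_numZ hw 0 p)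
  have iUV : IntegrableOn (fun p => vel numR 0 w p * vel numZ 0 w p) quadrant := by
    refine ((fin2.add iV).const_mul (1 / 2)).mono' (by fun_prop) ?_
    filter_upwards [ae_restrict_mem measurableSet_quadrant] with p hp
    have hr : 0 < p.1 := hp.1
    simp only [Pi.add_apply]
    rw [Real.norm_eq_abs, abs_le]
    generalize vel numR 0 w p = u at *
    generalize vel numZ 0 w p = v at *
    have e : u ^ 2 / p.1 = p.1 * (u / p.1) ^ 2 := by field_simp
    have e' : u * v = p.1 * ((u / p.1) * v) := by field_simp
    rw [e, e']
    generalize u / p.1 = a at *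
    constructor <;> nlinarith [mul_nonneg hr.le (sq_nonneg (a - v)),
      mul_nonneg hr.le (sq_nonneg (a + v))]
  have iUU : IntegrableOn (fun p => p.1 * ((vel numZ 0 w p ^ 2 - vel numR 0 w p ^ 2) / 2))
      quadrant := by
    refine ((iV.sub iU).const_mul (1 / 2)).congr (Eventually.of_forall fun p => ?_)
    simp only [Pi.sub_apply]; ring
  have cc := continuous_cutoff
  have cd := continuous_cutoffDeriv
  have m1 : ∀ B, Measurable fun p : ℝ × ℝ => cutoff B p.1 * cutoff B p.2 := fun B => by
    have := cc B; exact Continuous.measurable (by fun_prop)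
  have bd1 : ∀ᶠ B in atTop, ∀ p ∈ box B, |cutoff B p.1 * cutoff B p.2| ≤ 1 :=
      Eventually.of_forall fun B p hp => by
    rw [abs_of_nonneg (mul_nonneg (cutoff_nonneg _ _) (cutoff_nonneg _ _))]
    exact mul_le_one₀ (cutoff_le_one hp.1) (cutoff_nonneg _ _) (cutoff_le_one hp.2)
  have lim1 : ∀ p ∈ quadrant, Tendsto (fun B => cutoff B p.1 * cutoff B p.2) atTop (𝓝 1) :=
      fun p _ => by
    simpa using (tendsto_cutoff p.1).mul (tendsto_cutoff p.2)
  have L1 := tendsto_setIntegral_mul measurableSet_quadrant measurableSet_box box_subset_quadrant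
    (fun p => eventually_mem_box) iVw m1 bd1 lim1
  have L2 := tendsto_setIntegral_mul measurableSet_quadrant measurableSet_box box_subset_quadrant
    (fun p => eventually_mem_box) fin2 m1 bd1 lim1
  have L3 := tendsto_setIntegral_mul measurableSet_quadrant measurableSet_box box_subset_quadrant
    (fun p => eventually_mem_box) (c := fun B p => cutoffDeriv B p.1 / p.1 * cutoff B p.2)
    (a := 0) iUU
    (fun B => by have := (cc B).measurable; have := (cd B).measurable; fun_prop)
    (by
      filter_upwards [eventually_ge_atTop 2] with B hB p hp
      have hr : 0 < p.1 := hp.1.1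
      rw [abs_mul, abs_div, abs_of_pos hr, abs_of_nonneg (cutoff_nonneg _ _)]
      refine mul_le_one₀ ?_ (cutoff_nonneg _ _) (cutoff_le_one hp.2)
      rw [div_le_one hr]
      refine (abs_cutoffDeriv_le hp.1).trans ?_
      rw [div_le_iff₀ (by positivity)]
      have h4 : 4 ≤ B ^ 2 := by nlinarith
      nlinarith)
    (fun p _ => by simpa using ((tendsto_cutoffDeriv p.1).div_const p.1).mul (tendsto_cutoff p.2))
  have L4 := tendsto_setIntegral_mul measurableSet_quadrant measurableSet_box box_subset_quadrant
    (fun p => eventually_mem_box) (c := fun B p => cutoff B p.1 * cutoffDeriv B p.2) (a := 0) iUV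
    (fun B => by have := (cc B).measurable; have := (cd B).measurable; fun_prop)
    (by
      filter_upwards [eventually_ge_atTop 4] with B hB p hp
      have hz : 0 < p.2 := hp.2.1
      rw [abs_mul, abs_of_nonneg (cutoff_nonneg _ _)]
      refine mul_le_one₀ (cutoff_le_one hp.1) (abs_nonneg _) ?_
      refine (abs_cutoffDeriv_le hp.2).trans ?_
      rw [div_le_one (by positivity)]
      nlinarith [hp.2.2])
    (fun p _ => by simpa using (tendsto_cutoff p.1).mul (tendsto_cutoffDeriv p.2))
  have L5 := tendsto_setIntegral_mul (μ := volume) (S := Ioi (0 : ℝ))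
      (s := fun B => Ioo 0 B) measurableSet_Ioi
    (fun _ => measurableSet_Ioo) (fun B => Ioo_subset_Ioi_self)
    (fun z hz => by filter_upwards [eventually_gt_atTop z] with B hB using ⟨hz, hB⟩) fin1
    (fun B => (cc B).measurable) (Eventually.of_forall fun B z hz => by
      rw [abs_of_nonneg (cutoff_nonneg _ _)]; exact cutoff_le_one hz) (fun z _ => tendsto_cutoff z)
  have lhs := L1.add ((L2.add L3).sub L4)
  simp only [one_mul, zero_mul, add_zero, sub_zero] at lhs L5
  have := tendsto_nhds_unique (lhs.congr' ?_) L5.neg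
  · linarith
  filter_upwards [eventually_gt_atTop 0] with B hB
  have hid := quadratic_identity hB.le (hasDerivAt_cutoff B) (cd B) (cutoff_self hB) hw hξ hodd
  simp only [cutoff_zero, one_mul] at hid
  rw [intervalIntegral.integral_of_le hB.le, integral_Ioc_eq_integral_Ioo] at hid
  rw [← hid]
  congr 1
  · exact setIntegral_congr_fun (measurableSet_box B) fun p _ => by ring
  have hle : ∀ {c : ℝ × ℝ → ℝ} {X : ℝ × ℝ → ℝ} {K : ℝ}, IntegrableOn X quadrant → Measurable c →
      (∀ p ∈ box B, |c p| ≤ K) →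
      IntegrableOn (fun p => c p * X p) (box B) := fun hX hc hK =>
    (hX.mono_set (box_subset_quadrant B)).bdd_mul hc.aestronglyMeasurable
    ((ae_restrict_mem (measurableSet_box B)).mono hK)
  have j2 := iQ B hB
  have j3 := hle (c := fun p => cutoffDeriv B p.1 / p.1 * cutoff B p.2) (K := 4 / B ^ 2) iUU
    (by have := (cc B).measurable; have := (cd B).measurable; fun_prop) (fun p hp => by
      have hr : 0 < p.1 := hp.1.1
      rw [abs_mul, abs_div, abs_of_pos hr, abs_of_nonneg (cutoff_nonneg _ _)]
      refine (mul_le_of_le_one_right (by positivity) (cutoff_le_one hp.2)).trans ?_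
      rw [div_le_iff₀ hr]
      exact (abs_cutoffDeriv_le hp.1).trans (le_of_eq (by ring)))
  have j4 := hle (c := fun p => cutoff B p.1 * cutoffDeriv B p.2) (K := 4 * B / B ^ 2) iUV
    (by have := (cc B).measurable; have := (cd B).measurable; fun_prop) (fun p hp => by
      rw [abs_mul, abs_of_nonneg (cutoff_nonneg _ _)]
      refine (mul_le_of_le_one_left (abs_nonneg _) (cutoff_le_one hp.1)).trans ?_
      refine (abs_cutoffDeriv_le hp.2).trans ?_
      have := hp.2.2.le
      gcongr)
  rw [← integral_add j2 j3]
  refine (integral_sub (j2.add j3) j4).symm.trans ?_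
  refine setIntegral_congr_fun (measurableSet_box B) fun p hp => ?_
  have hr : p.1 ≠ 0 := hp.1.1.ne'
  simp only [Pi.add_apply]
  field_simp

end

/-! ### The lower bound for the dissipation -/

/-- The vertical weight `z / (z + δ) * (1 - z / B)` on `[0, B]`; the modulus only makes it
continuous on the whole line. -/
def vertWeight (δ B z : ℝ) : ℝ := z / (|z| + δ) * (1 - z / B)

/-- The derivative of `vertWeight δ B` on `(0, ∞)`. -/
def vertWeightDeriv (δ B z : ℝ) : ℝ := δ / (|z| + δ) ^ 2 * (1 - z / B) - z / (|z| + δ) / B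

section
variable {δ B : ℝ}

lemma continuous_vertWeight (hδ : 0 < δ) : Continuous (vertWeight δ B) := by
  unfold vertWeight
  exact (continuous_id.div (by fun_prop) fun z => by positivity).mul (by fun_prop)

lemma continuous_vertWeightDeriv (hδ : 0 < δ) : Continuous (vertWeightDeriv δ B) := by
  unfold vertWeightDeriv
  exact ((continuous_const.div (by fun_prop) fun z => by positivity).mul (by fun_prop)).sub
    ((continuous_id.div (by fun_prop) fun z => by positivity).div_const B)

lemma hasDerivAt_vertWeight (hδ : 0 < δ) {z : ℝ} (hz : 0 < z) :
    HasDerivAt (vertWeight δ B) (vertWeightDeriv δ B z) z := by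
  have h1 : HasDerivAt (fun z : ℝ => z / (z + δ) * (1 - z / B)) (vertWeightDeriv δ B z) z := by
    have h := ((hasDerivAt_id z).fun_div ((hasDerivAt_id z).add_const δ)
        (by simp only [id]; positivity)).fun_mul
      (((hasDerivAt_id z).div_const B).const_sub 1)
    refine h.congr_deriv ?_
    simp only [vertWeightDeriv, id, abs_of_pos hz]
    ring
  refine h1.congr_of_eventuallyEq ?_
  filter_upwards [lt_mem_nhds hz] with y hy
  rw [vertWeight, abs_of_pos hy]

lemma one_sub_div_mem {z : ℝ} (hz : z ∈ Icc 0 B) (hB : 0 < B) : 0 ≤ 1 - z / B ∧ 1 - z / B ≤ 1 := by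
  have h0 : 0 ≤ z / B := div_nonneg hz.1 hB.le
  have h1 : z / B ≤ 1 := (div_le_one hB).2 hz.2
  constructor <;> linarith

lemma div_add_le_one (hδ : 0 < δ) {z : ℝ} (hz : 0 ≤ z) : z / (|z| + δ) ≤ 1 := by
  rw [abs_of_nonneg hz, div_le_one (by positivity)]; linarith

lemma vertWeight_mem (hδ : 0 < δ) (hB : 0 < B) {z : ℝ} (hz : z ∈ Icc 0 B) :
    0 ≤ vertWeight δ B z ∧ vertWeight δ B z ≤ 1 := by
  have h := one_sub_div_mem hz hB
  have h0 : 0 ≤ z / (|z| + δ) := by have := hz.1; positivity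
  exact ⟨mul_nonneg h0 h.1, mul_le_one₀ (div_add_le_one hδ hz.1) h.1 h.2⟩

lemma abs_vertWeightDeriv_le (hδ : 0 < δ) (hB : 0 < B) {z : ℝ} (hz : z ∈ Icc 0 B) :
    |vertWeightDeriv δ B z| ≤ 1 / (|z| + δ) + 1 / B := by
  have h := one_sub_div_mem hz hB
  have h0 : 0 ≤ z / (|z| + δ) := by have := hz.1; positivity
  refine (abs_sub _ _).trans (add_le_add ?_ ?_)
  · rw [abs_mul, abs_of_nonneg h.1, abs_of_nonneg (by positivity)]
    refine (mul_le_of_le_one_right (by positivity) h.2).trans ?_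
    rw [div_le_div_iff₀ (by positivity) (by positivity)]
    nlinarith [abs_nonneg z, mul_nonneg (abs_nonneg z) (abs_nonneg z),
      mul_nonneg (abs_nonneg z) hδ.le]
  · rw [abs_of_nonneg (by positivity)]
    have := div_add_le_one hδ hz.1
    gcongr

/-- The weights of the linear identity used for the lower bound. -/
lemma isWeight_vertWeight (hδ : 0 < δ) (hB : 0 < B) :
    IsWeight (vertWeight δ B) (vertWeightDeriv δ B) (fun z => ∫ s in z..B, vertWeight δ B s)
      (cutoff B) (fun r => -(4 / B ^ 2) * (1 - (r / B) ^ 2)) (fun r => 8 * r / B ^ 4) B where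
  pos := hB
  hasDerivAt_f _ := hasDerivAt_vertWeight hδ
  hasDerivAt_Φ z := by
    have hc := continuous_vertWeight (B := B) hδ
    exact intervalIntegral.integral_hasDerivAt_left (hc.intervalIntegrable _ _)
      hc.stronglyMeasurable.stronglyMeasurableAtFilter hc.continuousAt
  hasDerivAt_g r := (hasDerivAt_cutoff B r).congr_deriv (by rw [cutoffDeriv]; ring)
  hasDerivAt_h r := by
    refine ((((hasDerivAt_id r).div_const B).fun_pow 2).const_sub 1 |>.const_mul
      (-(4 / B ^ 2))).congr_deriv ?_
    norm_num
    field_simp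
    ring
  continuous_f := continuous_vertWeight hδ
  continuous_f' := continuous_vertWeightDeriv hδ
  continuous_h' := by fun_prop
  f_zero := by simp [vertWeight]
  f_end := by simp [vertWeight, hB.ne']
  Φ_end := by simp
  g_end := cutoff_self hB
  h_end := by simp [hB.ne']

/-- The bound for the coefficient of `u_r` in the linear identity, in the form in which Young's
inequality against `u_r² / r` needs it. -/
lemma abs_coeff_le (hδ : 0 < δ) {p : ℝ × ℝ} (hp : p ∈ box B) :
    p.1 * (vertWeightDeriv δ B p.2 * cutoff B p.1 - p.1 * (8 * p.1 / B ^ 4) * ∫ s in p.2..B,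
      vertWeight δ B s) ^ 2 ≤
      B * (2 * (1 / (|p.2| + δ) ^ 2) + 162 / B ^ 2) := by
  have hr := hp.1.1
  have hB : 0 < B := hp.1.1.trans hp.1.2
  have hz : p.2 ∈ Icc 0 B := ⟨hp.2.1.le, hp.2.2.le⟩
  have h1 : |∫ s in p.2..B, vertWeight δ B s| ≤ B := by
    have := intervalIntegral.norm_integral_le_of_norm_le_const (a := p.2) (b := B)
        (f := vertWeight δ B) (C := 1) (fun s hs => by
      rw [uIoc_of_le hz.2] at hs
      have h := vertWeight_mem hδ hB (z := s) ⟨hz.1.trans hs.1.le, hs.2⟩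
      rw [Real.norm_of_nonneg h.1]; exact h.2)
    rw [Real.norm_eq_abs, one_mul, abs_of_nonneg (sub_nonneg.2 hz.2)] at this
    linarith [hz.1]
  have h2 : |p.1 * (8 * p.1 / B ^ 4)| ≤ 8 / B ^ 2 := by
    rw [abs_of_nonneg (by positivity), mul_div_assoc', div_le_div_iff₀ (by positivity)
      (by positivity)]
    have : p.1 * p.1 ≤ B * B := mul_le_mul hp.1.2.le hp.1.2.le hr.le hB.le
    nlinarith [mul_le_mul_of_nonneg_right this (sq_nonneg B)]
  have h3 : |vertWeightDeriv δ B p.2 * cutoff B p.1| ≤ 1 / (|p.2| + δ) + 1 / B := by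
    rw [abs_mul, abs_of_nonneg (cutoff_nonneg _ _)]
    exact (mul_le_of_le_one_right (abs_nonneg _) (cutoff_le_one hp.1)).trans
      (abs_vertWeightDeriv_le hδ hB hz)
  have h4 : |vertWeightDeriv δ B p.2 * cutoff B p.1 - p.1 * (8 * p.1 / B ^ 4) * ∫ s in p.2..B,
      vertWeight δ B s| ≤
      1 / (|p.2| + δ) + 9 / B := by
    refine (abs_sub _ _).trans ?_
    rw [abs_mul (p.1 * (8 * p.1 / B ^ 4))]
    calc _ ≤ (1 / (|p.2| + δ) + 1 / B) + 8 / B ^ 2 * B := by gcongr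
      _ = _ := by field_simp; ring
  calc _ ≤ B * (1 / (|p.2| + δ) + 9 / B) ^ 2 := by
        rw [← sq_abs (vertWeightDeriv δ B p.2 * cutoff B p.1 - _)]
        have := hp.1.2.le
        gcongr
    _ ≤ B * (2 * (1 / (|p.2| + δ)) ^ 2 + 2 * (9 / B) ^ 2) := by
        gcongr
        nlinarith [sq_nonneg (1 / (|p.2| + δ) - 9 / B)]
    _ = _ := by rw [div_pow, div_pow]; ring

lemma integral_inv_add_sq_le (hδ : 0 < δ) (hB : 0 < B) :
    ∫ z in Ioo 0 B, 1 / (|z| + δ) ^ 2 ≤ 1 / δ := by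
  rw [← integral_Ioc_eq_integral_Ioo, ← intervalIntegral.integral_of_le hB.le]
  have e : ∫ z in (0 : ℝ)..B, 1 / (|z| + δ) ^ 2 = ∫ z in (0 : ℝ)..B, 1 / (z + δ) ^ 2 := by
    refine intervalIntegral.integral_congr fun z hz => ?_
    rw [uIcc_of_le hB.le] at hz
    simp only [abs_of_nonneg hz.1]
  rw [e, intervalIntegral.integral_eq_sub_of_hasDerivAt (f := fun z => -(1 / (z + δ)))]
  · have : 0 < 1 / (B + δ) := by positivity
    simp only [zero_add]
    linarith
  · intro z hz
    rw [uIcc_of_le hB.le] at hz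
    have hz' : z + δ ≠ 0 := by have := hz.1; positivity
    have h := (((hasDerivAt_id z).add_const δ).fun_inv hz').fun_neg
    simp only [id, ← one_div] at h
    refine h.congr_deriv ?_
    ring
  · refine ContinuousOn.intervalIntegrable fun z hz => ContinuousAt.continuousWithinAt ?_
    rw [uIcc_of_le hB.le] at hz
    have hz' : (z + δ) ^ 2 ≠ 0 := by have := hz.1; positivity
    exact ContinuousAt.div (by fun_prop) (by fun_prop) hz'

lemma integral_coeff_le (hδ : 0 < δ) (hδB : 2 * δ ≤ B) :
    ∫ p in box B, B * (2 * (1 / (|p.2| + δ) ^ 2) + 162 / B ^ 2) ≤ 83 * B ^ 2 / δ := by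
  have hB : 0 < B := by linarith
  have h := setIntegral_prod_mul (μ := (volume : Measure ℝ)) (ν := (volume : Measure ℝ))
      (fun _ : ℝ => B)
    (fun z : ℝ => 2 * (1 / (|z| + δ) ^ 2) + 162 / B ^ 2) (Ioo 0 B) (Ioo 0 B)
  rw [box, Measure.volume_eq_prod, h, setIntegral_const, measureReal_def, Real.volume_Ioo, sub_zero,
    ENNReal.toReal_ofReal hB.le, smul_eq_mul]
  have hc : Continuous fun z : ℝ => 2 * (1 / (|z| + δ) ^ 2) :=
    continuous_const.mul (continuous_const.div (by fun_prop) fun z => by positivity)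
  have i1 : IntegrableOn (fun z : ℝ => 2 * (1 / (|z| + δ) ^ 2)) (Ioo 0 B) :=
      hc.integrableOn_Ioc.mono_set Ioo_subset_Ioc_self
  have i2 : IntegrableOn (fun _ : ℝ => 162 / B ^ 2) (Ioo 0 B) := integrableOn_const (by simp)
  rw [integral_add i1 i2, integral_const_mul, setIntegral_const, measureReal_def, Real.volume_Ioo,
    sub_zero,
    ENNReal.toReal_ofReal hB.le, smul_eq_mul]
  have h1 := integral_inv_add_sq_le hδ hB
  have h2 : B * B * (B * (162 / B ^ 2)) ≤ 81 * B ^ 2 / δ := by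
    rw [le_div_iff₀ hδ]
    field_simp
    linarith
  have h3 : B * B * (2 * ∫ z in Ioo 0 B, 1 / (|z| + δ) ^ 2) ≤ B * B * (2 * (1 / δ)) := by gcongr
  calc _ = B * B * (2 * ∫ z in Ioo 0 B, 1 / (|z| + δ) ^ 2) + B * B * (B * (162 / B ^ 2)) := by ring
    _ ≤ B * B * (2 * (1 / δ)) + 81 * B ^ 2 / δ := add_le_add h3 h2
    _ = _ := by ring

end

/-- The region `r ≤ S`, `δ ≤ z ≤ S` of the upper quadrant. -/
def innerRegion (δ S : ℝ) : Set (ℝ × ℝ) := quadrant ∩ {p | p.1 ≤ S ∧ δ ≤ p.2 ∧ p.2 ≤ S}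

lemma measurableSet_innerRegion (δ S : ℝ) : MeasurableSet (innerRegion δ S) := by
  refine measurableSet_quadrant.inter ?_
  exact (measurableSet_le measurable_fst measurable_const).inter
    ((measurableSet_le measurable_const measurable_snd).inter
    (measurableSet_le measurable_snd measurable_const))

/-- The dissipation: half the square integral of the axial velocity on the upper half axis plus the
integral of `u_r² / r` on the quadrant. -/
def dissipation (w : ℝ × ℝ → ℝ) : ℝ :=
  (∫ z in Ioi (0 : ℝ), vel numZ 0 w (0, z) ^ 2 / 2) + ∫ p in quadrant, vel numR 0 w p ^ 2 / p.1

section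
variable {w : ℝ × ℝ → ℝ} {M N M' N' δ S c : ℝ}

lemma ae_quadrant_nonneg (h : IsOddNonneg w) : ∀ᵐ p ∂(volume.restrict quadrant), 0 ≤ w p := by
  have h1 := ae_restrict_of_ae_restrict_of_subset (s := quadrant) (fun p hp => hp.1)
      (ae_axi_iff.1 h.nonneg)
  filter_upwards [h1, ae_restrict_mem measurableSet_quadrant] with p hp hq using hp hq.2.le

/-- The linear identity bounds the mass of an inner region by the dissipation, through Young's
inequality with a parameter `l`. -/
lemma dissipation_ge (hw : IsDensity w M N) (hξ : IsDensity (fun q => w q / q.1) M' N')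
    (hU : MemLp (vel numR 0 w) 2 axiMeasure) (hV : MemLp (vel numZ 0 w) 2 axiMeasure)
    (hodd : IsOddNonneg w) (hδ : 0 < δ) (hδS : δ ≤ S) (hc : 0 < c) (hmass : c ≤
    ∫ p in innerRegion δ S, w p) :
    c ^ 2 * δ / (43008 * S ^ 2) ≤ dissipation w := by
  obtain ⟨fin1, fin2, -⟩ := dissipation_identity hw hξ hU hV hodd.odd
  have iw := integrableOn_quadrant_of_density hξ
  have hS : 0 < S := by linarith
  set B := 2 * S with hBdef
  have hB : 0 < B := by positivity
  have cU := continuous_vel isNumerator_numR hw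
  have cV := continuous_vel isNumerator_numZ hw
  have H := isWeight_vertWeight (B := B) hδ hB
  have hid := linear_identity H hw hξ hodd.odd
  have cf := H.continuous_f
  have cf' := H.continuous_f'
  have cg := H.continuous_g
  have cΦ := H.continuous_Φ
  set f := vertWeight δ B with hf
  set a : ℝ × ℝ → ℝ := fun p => vertWeightDeriv δ B p.2 * cutoff B p.1 -
    p.1 * (8 * p.1 / B ^ 4) * ∫ s in p.2..B, f s with ha
  have ca : Continuous a := by simp only [ha]; fun_prop
  have hsub : innerRegion δ S ⊆ box B := fun p hp =>
    ⟨⟨hp.1.1, by have := hp.2.1; linarith⟩, ⟨hp.1.2, by have := hp.2.2.2; linarith⟩⟩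
  have ae0 : ∀ᵐ p ∂(volume.restrict (box B)), 0 ≤ w p :=
    ae_restrict_of_ae_restrict_of_subset (box_subset_quadrant B) (ae_quadrant_nonneg hodd)
  have iwB : IntegrableOn w (box B) := iw.mono_set (box_subset_quadrant B)
  have ifgw : IntegrableOn (fun p => f p.2 * cutoff B p.1 * w p) (box B) := by
    refine iwB.bdd_mul (c := 1) (Continuous.aestronglyMeasurable (by fun_prop)) ?_
    filter_upwards [ae_restrict_mem (measurableSet_box B)] with p hp
    have h1 := vertWeight_mem hδ hB (z := p.2) ⟨hp.2.1.le, hp.2.2.le⟩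
    rw [norm_mul, Real.norm_of_nonneg h1.1, Real.norm_of_nonneg (cutoff_nonneg _ _)]
    exact mul_le_one₀ h1.2 (cutoff_nonneg _ _) (cutoff_le_one hp.1)
  have lower : c / 8 ≤ ∫ p in box B, f p.2 * cutoff B p.1 * w p := by
    have s1 : ∫ p in innerRegion δ S, 1 / 8 * w p ≤ ∫ p in innerRegion δ S,
        f p.2 * cutoff B p.1 * w p := by
      refine setIntegral_mono_on_ae ((iwB.mono_set hsub).const_mul _) (ifgw.mono_set hsub)
        (measurableSet_innerRegion δ S) ?_
      rw [← ae_restrict_iff' (measurableSet_innerRegion δ S)]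
      filter_upwards [ae_restrict_of_ae_restrict_of_subset hsub ae0,
        ae_restrict_mem (measurableSet_innerRegion δ S)] with p h0 hp
      have hz := hp.1.2
      have g1 : 1 / 2 ≤ cutoff B p.1 := le_cutoff hS ⟨hp.1.1, hp.2.1⟩
      have f1 : 1 / 2 ≤ p.2 / (|p.2| + δ) := by
        rw [abs_of_pos hz, div_le_div_iff₀ (by norm_num) (by positivity)]; linarith [hp.2.2.1]
      have f2 : 1 / 2 ≤ 1 - p.2 / B := by
        have : p.2 / B ≤ 1 / 2 := by rw [div_le_div_iff₀ hB (by norm_num)]; linarith [hp.2.2.2]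
        linarith
      have f3 : 1 / 4 ≤ f p.2 := by simp only [hf, vertWeight]; nlinarith
      have : 1 / 8 ≤ f p.2 * cutoff B p.1 := by nlinarith
      gcongr
    have s2 := setIntegral_mono_set ifgw (s := innerRegion δ S) (by
      filter_upwards [ae0, ae_restrict_mem (measurableSet_box B)] with p h0 hp
      have h1 := vertWeight_mem hδ hB (z := p.2) ⟨hp.2.1.le, hp.2.2.le⟩
      exact mul_nonneg (mul_nonneg h1.1 (cutoff_nonneg _ _)) h0) hsub.eventuallyLE
    rw [integral_const_mul] at s1
    linarith
  -- Young's inequality; `a` is the coefficient of the radial velocity in the linear identity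
  have upper : ∀ l : ℝ, 0 < l → ∫ p in box B, f p.2 * cutoff B p.1 * w p ≤
      l / 2 * (84 * B ^ 2 / δ) + dissipation w / l := by
    intro l hl
    have j1 : ∫ p in box B, a p * vel numR 0 w p ≤ l / 2 * (83 * B ^ 2 / δ) +
        1 / l * ∫ p in quadrant, vel numR 0 w p ^ 2 / p.1 := by
      have k1 : IntegrableOn (fun p : ℝ × ℝ => B * (2 * (1 / (|p.2| + δ) ^ 2) + 162 / B ^ 2))
          (box B) := by
        refine Continuous.integrableOn_box (continuous_const.mul
          ((continuous_const.mul (continuous_const.div (by fun_prop) fun p =>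
          ?_)).add continuous_const)) B
        positivity
      have k2 : IntegrableOn (fun p => vel numR 0 w p ^ 2 / p.1) (box B) :=
          fin2.mono_set (box_subset_quadrant B)
      have k3 := setIntegral_mono_on (f := fun p => a p * vel numR 0 w p)
          (Continuous.integrableOn_box (by fun_prop) B)
        ((k1.const_mul (l / 2)).add (k2.const_mul (1 / (2 * l)))) (measurableSet_box B)
        (fun p hp => by
          have hr : 0 < p.1 := hp.1.1
          have := abs_coeff_le (B := B) hδ hp
          simp only [Pi.add_apply]
          have y : a p * vel numR 0 w p ≤ l / 2 * (p.1 * a p ^ 2) +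
              1 / (2 * l) * (vel numR 0 w p ^ 2 / p.1) := by
            have e : l / 2 * (p.1 * a p ^ 2) + 1 / (2 * l) *
                (vel numR 0 w p ^ 2 / p.1) - a p * vel numR 0 w p =
              (l * p.1 * a p - vel numR 0 w p) ^ 2 / (2 * l * p.1) := by field_simp; ring
            have : 0 ≤ (l * p.1 * a p - vel numR 0 w p) ^ 2 / (2 * l * p.1) := by positivity
            linarith
          refine y.trans ?_
          gcongr)
      have k4 : ∫ p in box B, vel numR 0 w p ^ 2 / p.1 ≤ ∫ p in quadrant,
          vel numR 0 w p ^ 2 / p.1 :=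
        setIntegral_mono_set fin2 (by
          filter_upwards [ae_restrict_mem measurableSet_quadrant] with p hp
          have : 0 < p.1 := hp.1
          simp only [Pi.zero_apply]; positivity) (box_subset_quadrant B).eventuallyLE
      have k5 := integral_coeff_le (B := B) hδ (by linarith)
      have k6 : 0 ≤ ∫ p in quadrant, vel numR 0 w p ^ 2 / p.1 :=
          setIntegral_nonneg measurableSet_quadrant fun p hp => by
        have : 0 < p.1 := hp.1
        positivity
      rw [integral_add' (k1.const_mul _) (k2.const_mul _), integral_const_mul (l / 2),
        integral_const_mul (1 / (2 * l))] at k3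
      calc _ ≤ _ := k3
        _ ≤ l / 2 * (83 * B ^ 2 / δ) + 1 / (2 * l) * ∫ p in quadrant, vel numR 0 w p ^ 2 / p.1 := by
          gcongr
        _ ≤ _ := by
          gcongr
          linarith
    have j2 : -∫ z in (0 : ℝ)..B, f z * cutoff B 0 * vel numZ 0 w (0, z) ≤ l / 2 * B +
        1 / l * ∫ z in Ioi (0 : ℝ), vel numZ 0 w (0, z) ^ 2 / 2 := by
      rw [intervalIntegral.integral_of_le hB.le, ← integral_neg]
      have k1 : IntegrableOn (fun _ : ℝ => (1 : ℝ)) (Ioc 0 B) := integrableOn_const (by simp)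
      have k2 : IntegrableOn (fun z : ℝ => vel numZ 0 w (0, z) ^ 2 / 2) (Ioc 0 B) :=
          fin1.mono_set Ioc_subset_Ioi_self
      have k3 := setIntegral_mono_on (f := fun z => -(f z * cutoff B 0 * vel numZ 0 w (0, z)))
        (Continuous.integrableOn_Ioc (by fun_prop)) ((k1.const_mul (l / 2)).add
        (k2.const_mul (1 / l))) measurableSet_Ioc (fun z hz => by
          have h1 := vertWeight_mem hδ hB (z := z) ⟨hz.1.le, hz.2⟩
          simp only [Pi.add_apply, cutoff_zero, mul_one]
          have e : l / 2 * f z ^ 2 + 1 / l * (vel numZ 0 w (0, z) ^ 2 / 2) +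
              f z * vel numZ 0 w (0, z) =
            (l * f z + vel numZ 0 w (0, z)) ^ 2 / (2 * l) := by field_simp; ring
          have h2 : 0 ≤ (l * f z + vel numZ 0 w (0, z)) ^ 2 / (2 * l) := by positivity
          have h3 : l / 2 * f z ^ 2 ≤ l / 2 * 1 := by
            gcongr
            exact pow_le_one₀ h1.1 h1.2
          linarith)
      rw [integral_add' (k1.const_mul _) (k2.const_mul _), integral_const_mul, integral_const_mul,
        setIntegral_const,
        measureReal_def, Real.volume_Ioc, sub_zero, ENNReal.toReal_ofReal hB.le, smul_eq_mul,
          mul_one] at k3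
      have k4 : ∫ z in Ioc 0 B, vel numZ 0 w (0, z) ^ 2 / 2 ≤ ∫ z in Ioi (0 : ℝ),
          vel numZ 0 w (0, z) ^ 2 / 2 :=
        setIntegral_mono_set fin1
          (Eventually.of_forall fun z => by simp only [Pi.zero_apply]; positivity)
          Ioc_subset_Ioi_self.eventuallyLE
      refine k3.trans ?_
      gcongr
    have j3 : B ≤ B ^ 2 / δ := by
      rw [le_div_iff₀ hδ]; nlinarith
    have j4 : l / 2 * B ≤ l / 2 * (B ^ 2 / δ) := by gcongr
    have e : ∫ p in box B, f p.2 * cutoff B p.1 * w p = (∫ p in box B, a p * vel numR 0 w p) +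
        -∫ z in (0 : ℝ)..B, f z * cutoff B 0 * vel numZ 0 w (0, z) := by linarith
    rw [e, dissipation]
    calc _ ≤ (l / 2 * (83 * B ^ 2 / δ) + 1 / l * ∫ p in quadrant, vel numR 0 w p ^ 2 / p.1) +
          (l / 2 * (B ^ 2 / δ) + 1 / l * ∫ z in Ioi (0 : ℝ), vel numZ 0 w (0, z) ^ 2 / 2) := by
            linarith
      _ = _ := by ring
  -- `l` is chosen such that the first term of the upper bound is half of the lower bound `c / 8`
  have key := lower.trans (upper (c * δ / (8 * (84 * B ^ 2))) (by positivity))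
  have e1 : c * δ / (8 * (84 * B ^ 2)) / 2 * (84 * B ^ 2 / δ) = c / 16 := by field_simp; norm_num
  rw [e1, div_div_eq_mul_div] at key
  have h2 : c / 16 ≤ dissipation w * (8 * (84 * B ^ 2)) / (c * δ) := by linarith
  rw [le_div_iff₀ (by positivity)] at h2
  rw [div_le_iff₀ (by positivity)]
  simp only [hBdef] at h2
  nlinarith

end

/-! ### The bound in terms of mass and vertical moment -/

section
variable {w : ℝ × ℝ → ℝ} {M N A N' : ℝ}

lemma dissipation_nonneg (w : ℝ × ℝ → ℝ) : 0 ≤ dissipation w := by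
  refine add_nonneg (integral_nonneg fun z => by simp only [Pi.zero_apply]; positivity)
    (setIntegral_nonneg measurableSet_quadrant fun p hp => ?_)
  have : 0 < p.1 := hp.1
  positivity

/-- The mass above height `S` is at most the vertical moment divided by `S`. -/
lemma integral_high_le (hodd : IsOddNonneg w) (iw : IntegrableOn w quadrant)
    (hZ : IntegrableOn (fun p : ℝ × ℝ => p.2 * w p) quadrant) {S : ℝ} (hS : 0 < S) :
    ∫ p in quadrant ∩ {p | S < p.2}, w p ≤ vertMoment w / S := by
  have hm : MeasurableSet (quadrant ∩ {p : ℝ × ℝ | S < p.2}) :=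
    measurableSet_quadrant.inter (measurableSet_lt measurable_const measurable_snd)
  rw [le_div_iff₀ hS, mul_comm, ← integral_const_mul]
  have h0 := ae_quadrant_nonneg hodd
  refine le_trans (setIntegral_mono_on_ae ((iw.mono_set inter_subset_left).const_mul S)
    (hZ.mono_set inter_subset_left) hm ?_)
    (setIntegral_mono_set hZ ?_ inter_subset_left.eventuallyLE)
  · rw [← ae_restrict_iff' hm]
    filter_upwards [ae_restrict_of_ae_restrict_of_subset inter_subset_left h0,
      ae_restrict_mem hm] with p hp hq
    have : S ≤ p.2 := le_of_lt (show S < p.2 from hq.2)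
    gcongr
  · filter_upwards [h0, ae_restrict_mem measurableSet_quadrant] with p hp hq
    exact mul_nonneg hq.2.le hp

/-- The mass in the thin slab `r ≤ R`, `z < δ` is at most `A R² δ` when `|w| ≤ A r`. -/
lemma integral_low_le (hξ : IsDensity (fun q => w q / q.1) A N') (iw : IntegrableOn w quadrant)
    {R δ : ℝ} (hR : 0 ≤ R)
    (hδ : 0 ≤ δ) : ∫ p in quadrant ∩ {p | p.1 ≤ R ∧ p.2 < δ}, w p ≤ A * R ^ 2 * δ := by
  have hs : quadrant ∩ {p : ℝ × ℝ | p.1 ≤ R ∧ p.2 < δ} = Ioc 0 R ×ˢ Ioo 0 δ := by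
    ext p
    simp only [quadrant, mem_inter_iff, mem_ofPred_eq, mem_prod, mem_Ioc, mem_Ioo]
    tauto
  have hv : volume (Ioc 0 R ×ˢ Ioo 0 δ) = ENNReal.ofReal (R * δ) := by
    rw [Measure.volume_eq_prod, Measure.prod_prod, Real.volume_Ioc, Real.volume_Ioo,
      ENNReal.ofReal_mul hR, sub_zero, sub_zero]
  have hm : MeasurableSet (Ioc 0 R ×ˢ Ioo 0 δ) := measurableSet_Ioc.prod measurableSet_Ioo
  rw [hs]
  have hb := ae_restrict_of_ae_restrict_of_subset (s := Ioc 0 R ×ˢ Ioo 0 δ) (fun p hp => hp.1.1)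
      (ae_axi_iff.1 hξ.ae_le)
  calc _ ≤ ∫ p in Ioc 0 R ×ˢ Ioo 0 δ, A * R := by
        refine setIntegral_mono_on_ae (iw.mono_set (hs ▸ inter_subset_left))
          (integrableOn_const (by rw [hv]; simp)) hm ?_
        rw [← ae_restrict_iff' hm]
        filter_upwards [hb, ae_restrict_mem hm] with p hp hq
        have hr : 0 < p.1 := hq.1.1
        rw [abs_div, abs_of_pos hr, div_le_iff₀ hr] at hp
        have := hξ.nonneg
        calc w p ≤ |w p| := le_abs_self _
          _ ≤ A * p.1 := hp
          _ ≤ A * R := by have := hq.1.2; gcongr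
    _ = _ := by
        rw [setIntegral_const, measureReal_def, hv, ENNReal.toReal_ofReal (by positivity),
          smul_eq_mul]; ring

/-- The constant of the lower bound, in terms of bounds for the mass, the relative vorticity and the
vertical moment. The absolute values only make it positive for all arguments. -/
def lowerConst (m₀ A Z : ℝ) : ℝ := 1 / (2752512 * (1 + (m₀ + 4 * Z) ^ 2 + (1 + |A|) * |m₀|))

lemma lowerConst_pos (m₀ A Z : ℝ) : 0 < lowerConst m₀ A Z := by unfold lowerConst; positivity

/-- If at least half of the mass lies above height `R`, the weights live at a scale determined by
the vertical moment; otherwise the bound `|w| ≤ A r` keeps a quarter of the mass off the symmetry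
plane. -/
theorem dissipation_lower_bound (hw : IsDensity w M N) (hξ : IsDensity (fun q => w q / q.1) A N')
    (hU : MemLp (vel numR 0 w) 2 axiMeasure) (hV : MemLp (vel numZ 0 w) 2 axiMeasure)
    (hodd : IsOddNonneg w) (hZ : IntegrableOn (fun p : ℝ × ℝ => p.2 * w p) quadrant)
    {m m₀ Z R : ℝ} (hm : 0 < m) (hmm : m ≤ m₀) (hZZ : vertMoment w ≤ Z) (hR : 1 ≤ R)
    (hmass : m ≤ massIn w R) :
    lowerConst m₀ A Z * m ^ 4 / R ^ 4 ≤ dissipation w := by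
  have iw := integrableOn_quadrant_of_density hξ
  have h0 := ae_quadrant_nonneg hodd
  have hR0 : 0 < R := by linarith
  have hm0 : 0 < m₀ := hm.trans_le hmm
  have hA := hξ.nonneg
  have hZ0 : 0 ≤ Z := by
    refine le_trans (integral_nonneg_of_ae ?_) hZZ
    filter_upwards [h0, ae_restrict_mem measurableSet_quadrant] with p hp hq using mul_nonneg
      hq.2.le hp
  have mono : ∀ {s t : Set (ℝ × ℝ)}, s ⊆ t → t ⊆ quadrant → ∫ p in s, w p ≤ ∫ p in t, w p :=
      fun hst ht =>
    setIntegral_mono_set (iw.mono_set ht) (ae_restrict_of_ae_restrict_of_subset ht h0)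
      hst.eventuallyLE
  have union : ∀ {s t : Set (ℝ × ℝ)}, MeasurableSet t → s ⊆ quadrant → t ⊆ quadrant →
      ∫ p in s ∪ t, w p ≤ (∫ p in s, w p) + ∫ p in t, w p := fun {s t} hmt hs ht => by
    rw [← sdiff_union_self, setIntegral_union disjoint_sdiff_left hmt
      (iw.mono_set (sdiff_subset.trans hs)) (iw.mono_set ht)]
    exact add_le_add (mono sdiff_subset hs) le_rfl
  have mQ := measurableSet_quadrant
  have mS : ∀ S : ℝ, MeasurableSet (quadrant ∩ {p : ℝ × ℝ | S < p.2}) := fun S =>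
    mQ.inter (measurableSet_lt measurable_const measurable_snd)
  have mL : ∀ δ : ℝ, MeasurableSet (quadrant ∩ {p : ℝ × ℝ | p.1 ≤ R ∧ p.2 < δ}) := fun δ =>
    mQ.inter ((measurableSet_le measurable_fst measurable_const).inter
      (measurableSet_lt measurable_snd measurable_const))
  set G := 1 + (m₀ + 4 * Z) ^ 2 + (1 + |A|) * |m₀| with hG
  have hGpos : 0 < G := by positivity
  by_cases hcase : m / 2 ≤ ∫ p in quadrant ∩ {p | p.1 ≤ R ∧ R ≤ p.2}, w p
  · -- at most `m / 4` lies above the height `S`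
    set S := R + 4 * Z / m with hSdef
    have hRS : R ≤ S := by have : 0 ≤ 4 * Z / m := by positivity
                           linarith
    have hS : 0 < S := by linarith
    have high : ∫ p in quadrant ∩ {p | S < p.2}, w p ≤ m / 4 := by
      refine (integral_high_le hodd iw hZ hS).trans ((div_le_iff₀ hS).2 (hZZ.trans ?_))
      have : m / 4 * (4 * Z / m) = Z := by field_simp
      rw [hSdef, mul_add, this]
      have : 0 ≤ m / 4 * R := by positivity
      linarith
    have hsub : quadrant ∩ {p : ℝ × ℝ | p.1 ≤ R ∧ R ≤ p.2} ⊆ innerRegion R S ∪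
        (quadrant ∩ {p | S < p.2}) := by
      rintro p ⟨hq, h1, h2⟩
      rcases le_or_gt p.2 S with h | h
      · exact Or.inl ⟨hq, h1.trans hRS, h2, h⟩
      · exact Or.inr ⟨hq, h⟩
    have hin : m / 4 ≤ ∫ p in innerRegion R S, w p := by
      have h1 := mono hsub (union_subset inter_subset_left inter_subset_left)
      have h2 := union (mS S) (s := innerRegion R S) inter_subset_left inter_subset_left
      linarith
    refine le_trans ?_ (dissipation_ge hw hξ hU hV hodd hR0 hRS (by positivity) hin)
    have hSle : S ≤ R * (m₀ + 4 * Z) / m := by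
      rw [le_div_iff₀ hm, hSdef]
      have : (R + 4 * Z / m) * m = R * m + 4 * Z := by field_simp
      rw [this]
      have : 4 * Z ≤ R * (4 * Z) := le_mul_of_one_le_left (by positivity) hR
      have : R * m ≤ R * m₀ := by gcongr
      linarith
    have hS2 : S ^ 2 ≤ R ^ 2 * G / m ^ 2 := by
      calc S ^ 2 ≤ (R * (m₀ + 4 * Z) / m) ^ 2 := by gcongr
        _ = R ^ 2 * (m₀ + 4 * Z) ^ 2 / m ^ 2 := by rw [div_pow, mul_pow]
        _ ≤ _ := by
          gcongr
          have : 0 ≤ (1 + |A|) * |m₀| := by positivity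
          linarith
    calc lowerConst m₀ A Z * m ^ 4 / R ^ 4 = m ^ 4 / (2752512 * G * R ^ 4) := by
          rw [lowerConst, ← hG]; field_simp
      _ ≤ m ^ 4 / (688128 * G * R ^ 1) := by
          gcongr
          · norm_num
          · norm_num
      _ = (m / 4) ^ 2 * R / (43008 * (R ^ 2 * G / m ^ 2)) := by field_simp; norm_num
      _ ≤ _ := by gcongr
  · push Not at hcase
    -- at most `m / 4` lies below the height `δ`
    set δ := m / (4 * (1 + A) * R ^ 2) with hδdef
    have hδ : 0 < δ := by positivity
    have low : ∫ p in quadrant ∩ {p | p.1 ≤ R ∧ p.2 < δ}, w p ≤ m / 4 := by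
      refine (integral_low_le hξ iw hR0.le hδ.le).trans ?_
      calc A * R ^ 2 * δ ≤ (1 + A) * R ^ 2 * δ := by gcongr; linarith
        _ = _ := by rw [hδdef]; field_simp
    have hhalf : m / 2 < ∫ p in quadrant ∩ {p | p.1 ≤ R ∧ p.2 < R}, w p := by
      have hsub : quadrant ∩ {p : ℝ × ℝ | p.1 ≤ R} ⊆ (quadrant ∩ {p | p.1 ≤ R ∧ R ≤ p.2}) ∪
          (quadrant ∩ {p | p.1 ≤ R ∧ p.2 < R}) := by
        rintro p ⟨hq, h1⟩
        rcases le_or_gt R p.2 with h | h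
        · exact Or.inl ⟨hq, h1, h⟩
        · exact Or.inr ⟨hq, h1, h⟩
      have h1 := mono hsub (union_subset inter_subset_left inter_subset_left)
      have h2 := union (mL R) (s := quadrant ∩ {p | p.1 ≤ R ∧ R ≤ p.2}) inter_subset_left
          inter_subset_left
      unfold massIn at hmass
      linarith
    have hδR : δ ≤ R := by
      by_contra! h
      have := mono (s := quadrant ∩ {p : ℝ × ℝ | p.1 ≤ R ∧ p.2 < R})
          (t := quadrant ∩ {p | p.1 ≤ R ∧ p.2 < δ})
        (fun p hp => ⟨hp.1, hp.2.1, hp.2.2.trans h⟩) inter_subset_left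
      linarith
    have hin : m / 4 ≤ ∫ p in innerRegion δ R, w p := by
      have hsub : quadrant ∩ {p : ℝ × ℝ | p.1 ≤ R ∧ p.2 < R} ⊆ innerRegion δ R ∪
          (quadrant ∩ {p | p.1 ≤ R ∧ p.2 < δ}) := by
        rintro p ⟨hq, h1, h2⟩
        rcases le_or_gt δ p.2 with h | h
        · exact Or.inl ⟨hq, h1, h, h2.le⟩
        · exact Or.inr ⟨hq, h1, h⟩
      have h1 := mono hsub (union_subset inter_subset_left inter_subset_left)
      have h2 := union (mL δ) (s := innerRegion δ R) inter_subset_left inter_subset_left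
      linarith
    refine le_trans ?_ (dissipation_ge hw hξ hU hV hodd hδ hδR (by positivity) hin)
    have hGm : (1 + A) * m ≤ G := by
      rw [hG, abs_of_nonneg hA, abs_of_pos hm0]
      have : (1 + A) * m ≤ (1 + A) * m₀ := by gcongr
      have := sq_nonneg (m₀ + 4 * Z)
      linarith
    calc lowerConst m₀ A Z * m ^ 4 / R ^ 4 = m ^ 4 / (2752512 * G * R ^ 4) := by
          rw [lowerConst, ← hG]; field_simp
      _ ≤ m ^ 4 / (2752512 * ((1 + A) * m) * R ^ 4) := by gcongr
      _ = _ := by rw [hδdef]; field_simp; norm_num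

variable {ω : ℝ → ℝ × ℝ → ℝ} {Φ : ℝ → ℝ × ℝ → ℝ × ℝ}

lemma InClass.dissipation_identity {w : ℝ × ℝ → ℝ} (h : InClass w)
    (hodd : ∀ᵐ p ∂axiMeasure, w (p.1, -p.2) = -w p) :
    IntegrableOn (fun z : ℝ => velZ w (0, z) ^ 2 / 2) (Ioi 0) ∧
    IntegrableOn (fun p => velR w p ^ 2 / p.1) quadrant ∧
    ∫ p in quadrant, velZ w p * w p = -((∫ z in Ioi (0 : ℝ), velZ w (0, z) ^ 2 / 2) +
      ∫ p in quadrant, velR w p ^ 2 / p.1) := by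
  have eR : velR w = vel numR 0 w := funext fun p => velR_eq_vel h.isDensity p
  have eZ : velZ w = vel numZ 0 w := funext fun p => velZ_eq_vel h.isDensity p
  rw [eR, eZ]
  exact AxiEuler.dissipation_identity h.isDensity h.isDensity_div (eR ▸ h.memLp_velR)
    (eZ ▸ h.memLp_velZ) hodd

lemma InClass.dissipation_eq {w : ℝ × ℝ → ℝ} (h : InClass w) :
    dissipation w = (∫ z in Ioi (0 : ℝ), velZ w (0, z) ^ 2 / 2) + ∫ p in quadrant,
      velR w p ^ 2 / p.1 := by
  have eR : velR w = vel numR 0 w := funext fun p => velR_eq_vel h.isDensity p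
  have eZ : velZ w = vel numZ 0 w := funext fun p => velZ_eq_vel h.isDensity p
  rw [dissipation, eR, eZ]

lemma IsTransported.hasDerivWithinAt_dissipation (h : IsTransported ω Φ) (hodd : IsOddNonneg (ω 0))
    (hZ : IntegrableOn (fun p : ℝ × ℝ => p.2 * ω 0 p) quadrant) {t : ℝ} (ht : 0 ≤ t) :
    HasDerivWithinAt (fun s => vertMoment (ω s)) (-dissipation (ω t)) (Ici 0) t := by
  have hd := h.hasDerivWithinAt_vertMoment hodd hZ ht
  rwa [((h.inClass t ht).dissipation_identity (h.odd hodd ht)).2.2,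
    ← (h.inClass t ht).dissipation_eq] at hd

/-- The vertical moment decreases, so that its initial value bounds it at all times. -/
lemma IsTransported.vertMoment_le (h : IsTransported ω Φ) (hodd : IsOddNonneg (ω 0))
    (hZ : IntegrableOn (fun p : ℝ × ℝ => p.2 * ω 0 p) quadrant) {t : ℝ} (ht : 0 ≤ t) :
    vertMoment (ω t) ≤ vertMoment (ω 0) := by
  have hd := fun s (hs : 0 ≤ s) => h.hasDerivWithinAt_dissipation hodd hZ hs
  refine antitoneOn_of_hasDerivWithinAt_nonpos (convex_Ici 0) (fun s hs =>
    (hd s hs).continuousWithinAt)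
    (f' := fun s => -dissipation (ω s)) (fun s hs => ?_) (fun s _ =>
    neg_nonpos.2 (dissipation_nonneg _))
    (mem_Ici.2 le_rfl) (mem_Ici.2 ht) ht
  exact (hd s (interior_subset hs)).mono interior_subset

end

end AxiEuler

end

theorem proposition5p1 :
    ∃ (R₀ : ℝ → ℝ → ℝ → ℝ) (c₀ : ℝ → ℝ → ℝ → ℝ → ℝ),
      (∀ m₀ A₀ E₀, 1 ≤ R₀ m₀ A₀ E₀) ∧
      (∀ m₀ A₀ E₀ Z₀, 0 < c₀ m₀ A₀ E₀ Z₀) ∧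
      ∀ ω : ℝ → ℝ × ℝ → ℝ,
        AxiEuler.IsSolution ω →
        AxiEuler.IsOddNonneg (ω 0) →
        MeasureTheory.IntegrableOn (fun p : ℝ × ℝ => p.2 * ω 0 p) AxiEuler.quadrant →
        ∀ m : ℝ, 0 < m → m ≤ AxiEuler.totalMass (ω 0) →
        ∀ t : ℝ, 0 ≤ t →
        ∀ R : ℝ,
          R₀ (AxiEuler.totalMass (ω 0)) (AxiEuler.relSup (ω 0)) (AxiEuler.energy (ω 0)) ≤ R →
          m ≤ AxiEuler.massIn (ω t) R →
          MeasureTheory.IntegrableOn (fun p : ℝ × ℝ => p.2 * ω t p) AxiEuler.quadrant ∧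
          MeasureTheory.IntegrableOn
            (fun z : ℝ => AxiEuler.velZ (ω t) (0, z) ^ 2 / 2) (Set.Ioi 0) ∧
          MeasureTheory.IntegrableOn
            (fun p : ℝ × ℝ => AxiEuler.velR (ω t) p ^ 2 / p.1) AxiEuler.quadrant ∧
          HasDerivWithinAt (fun s : ℝ => AxiEuler.vertMoment (ω s))
            (-((∫ z in Set.Ioi (0 : ℝ), AxiEuler.velZ (ω t) (0, z) ^ 2 / 2) +
              ∫ p in AxiEuler.quadrant, AxiEuler.velR (ω t) p ^ 2 / p.1))
            (Set.Ici 0) t ∧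
          c₀ (AxiEuler.totalMass (ω 0)) (AxiEuler.relSup (ω 0)) (AxiEuler.energy (ω 0))
              (AxiEuler.vertMoment (ω 0)) * m ^ 4 / R ^ 4 ≤
            (∫ z in Set.Ioi (0 : ℝ), AxiEuler.velZ (ω t) (0, z) ^ 2 / 2) +
              ∫ p in AxiEuler.quadrant, AxiEuler.velR (ω t) p ^ 2 / p.1 := by
  refine ⟨fun _ _ _ => 1, fun m₀ A₀ _ Z₀ => AxiEuler.lowerConst m₀ A₀ Z₀, fun _ _ _ => le_rfl,
    fun _ _ _ _ => AxiEuler.lowerConst_pos _ _ _, ?_⟩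
  rintro ω ⟨hin, Φ, hflow, htr⟩ hodd hZ m hm hm₀ t ht R hR hmass
  have h : AxiEuler.IsTransported ω Φ := ⟨hin, hflow, htr⟩
  have hw := hin t ht
  have hoddt := h.isOddNonneg hodd ht
  have eR : AxiEuler.velR (ω t) = AxiEuler.vel AxiEuler.numR 0 (ω t) :=
    funext fun p => AxiEuler.velR_eq_vel hw.isDensity p
  have eZ : AxiEuler.velZ (ω t) = AxiEuler.vel AxiEuler.numZ 0 (ω t) :=
    funext fun p => AxiEuler.velZ_eq_vel hw.isDensity p
  have hZt : IntegrableOn (fun p : ℝ × ℝ => p.2 * ω t p) AxiEuler.quadrant :=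
    (h.integrableOn_quadrant hodd ht measurable_snd).2 (h.integrableOn_snd hZ ht)
  obtain ⟨fin1, fin2, -⟩ := hw.dissipation_identity hoddt.odd
  refine ⟨hZt, fin1, fin2, ?_, ?_⟩ <;> rw [← hw.dissipation_eq]
  · exact h.hasDerivWithinAt_dissipation hodd hZ ht
  · exact AxiEuler.dissipation_lower_bound hw.isDensity (h.isDensity_div ht) (eR ▸ hw.memLp_velR)
      (eZ ▸ hw.memLp_velZ)
      hoddt hZt hm hm₀ (h.vertMoment_le hodd hZ ht) hR hmass
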